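/- Notation. Let $\omega=|p|$ on $\mathbb{R}^3$ and $\mathcal H=L^2(\mathbb R^3,\tfrac{dp}{2\omega};\mathbb C^3)$, with inner product $(\cdot,\cdot)$ antilinear in the first entry. Let $(Ph)_j(p)=\sum_k(\delta_{jk}-p_jp_k/|p|^2)h_k(p)$ be the transverse projection, $\mathcal H_T=P\mathcal H=\{h\in\mathcal H: p\cdot h(p)=0\}$, and $\mathcal S\subset\mathcal H_T$ the rapidly decreasing elements: for every $k$ there is $C$ with $|h(p)|\le C(1+|p|^2)^{-k}$. On the symmetric Fock space $\mathcal F(\mathcal H_T)$ with vacuum $\Omega_0$ let $a^*(h)$, $a(h)$ be the creation and annihilation operators, $A(h)=\tfrac1{\sqrt2}(a^*(h)+a(h))$, $W_{in}(h)=e^{iA(h)}$, and let $\mathfrak A$ be the $C^*$-algebra generated by $\{W_{in}(h):h\in\mathcal S\}$. A state on $\mathfrak A$ is a positive linear functional of norm one; it is a Fock state if it has the form $B\mapsto(\Psi,B\Psi)$ with a unit vector $\Psi\in\mathcal F(\mathcal H_T)$. Let $x:\mathbb R\to\mathbb R^3$ be $C^3$ with $|x'(t)|\le v_0<1$ for all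 $t$, and suppose that $x'(t)=v_{in}$ for all sufficiently negative $t$ and $x'(t)=v_{out}$ for all sufficiently large $t$ (so $x''$ has compact support). Put $\psi(p,t)=\omega t-p\cdot x(t)$, $$J(p)=-i(2\pi)^{-3/2}\,\frac1i\int\Big[\frac{\psi_{tt}}{\psi_t^2}x'(t)-\frac1{\psi_t}x''(t)\Big]e^{i\psi(p,t)}\,dt\quad(p\ne0),\qquad J_T(p)=P(p)J(p).$$ Then: 1. For every $h\in\mathcal S$ the integral $(h,J_T)=\int \overline{h(p)}\cdot J_T(p)\frac{dp}{2\omega}$ converges absolutely, and $(h,J_T)=\lim_{R\to\infty}(h,PJ_R)$, where $J_R(p)=-i(2\pi)^{-3/2}\int_{-R}^{R}x'(s)e^{i\psi(p,s)}ds$ is the amplitude of the point current $x'(t)\,\delta(y-x(t))$ cut off to $|t|\le R$. 2. Put $a^*_{out}(h)=a^*(h)-(J_T,h)$, $a_{out}(h)=a(h)-(h,J_T)$, $A_{out}(h)=\tfrac1{\sqrt2}(a^*_{out}(h)+a_{out}(h))$ and $W_{out}(h)=e^{iA_{out}(h)}$ for $h\in\mathcal S$. Then $W_{out}(h)\in\mathfrak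 A$, there is a unique $*$-automorphism $\alpha$ of $\mathfrak A$ with $\alpha(W_{out}(h))=W_{in}(h)$ for all $h\in\mathcal S$, and $\omega_{out}(B)=(\Omega_0,\alpha(B)\Omega_0)$ is a well-defined state on $\mathfrak A$. 3. $\omega_{out}$ is a Fock state if and only if $v_{in}=v_{out}$. The same equivalence holds if Fock states are understood as the states given by density matrices on $\mathcal F(\mathcal H_T)$. 4. $J_T\in\mathcal H_T$, i.e. $\int|J_T|^2\frac{dp}{2\omega}<\infty$, if and only if $v_{in}=v_{out}$. One always has $\int_{|p|\ge1}|J_T|^2\frac{dp}{2\omega}<\infty$. If $v_{in}\ne v_{out}$ there is a logarithmic infrared divergence at $p=0$: there are $c,C,\varepsilon_0>0$ such that for all $0<\varepsilon<\varepsilon_0$ $$c\,\log\tfrac1\varepsilon\;\le\;\int_{\varepsilon\le|p|\le1}|J_T(p)|^2\,\frac{dp}{2\omega}\;\le\;C\,\log\tfrac1\varepsilon .$$ -/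

import Mathlib

open MeasureTheory Filter Topology
open scoped ComplexConjugate ComplexOrder ENNReal

noncomputable section

/-! ## Symmetric Fock space over a complex inner product space -/

section Fock

variable (E : Type*)

/-- Finite formal linear combinations of symmetric product vectors. The basis vector indexed by the
tuple `(f₁, …, fₙ)` stands for `a*(f₁) ⋯ a*(fₙ) Ω₀ = √n! · Sym (f₁ ⊗ ⋯ ⊗ fₙ)`. -/
def FockCore : Type _ := (Σ n : ℕ, Fin n → E) →₀ ℂ

instance : AddCommGroup (FockCore E) :=
  inferInstanceAs (AddCommGroup ((Σ n : ℕ, Fin n → E) →₀ ℂ))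

instance : Module ℂ (FockCore E) :=
  inferInstanceAs (Module ℂ ((Σ n : ℕ, Fin n → E) →₀ ℂ))

variable {E}

/-- The product vector `f₁ ⋯ fₙ`. -/
def FockCore.prodVec {n : ℕ} (f : Fin n → E) : FockCore E :=
  Finsupp.single (⟨n, f⟩ : Σ n : ℕ, Fin n → E) (1 : ℂ)

variable [NormedAddCommGroup E] [InnerProductSpace ℂ E]

/-- The inner product of two product vectors: the permanent of the matrix `⟪fᵢ, gⱼ⟫`, which is zero
when the particle numbers differ (there is then no bijection `e`). -/
def permKernel (a b : Σ n : ℕ, Fin n → E) : ℂ :=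
  ∑ e : Fin a.1 ≃ Fin b.1, ∏ i, inner ℂ (a.2 i) (b.2 (e i))

theorem permKernel_conj_symm (a b : Σ n : ℕ, Fin n → E) :
    conj (permKernel b a) = permKernel a b := by
  unfold permKernel
  rw [map_sum]
  refine Fintype.sum_equiv ⟨Equiv.symm, Equiv.symm, fun _ => rfl, fun _ => rfl⟩ _ _ ?_
  intro e
  rw [map_prod]
  refine Fintype.prod_equiv e _ _ ?_
  intro i
  simp

/-- Auxiliary for positivity: the `n`-particle part of the kernel, symmetrised on both sides. -/
theorem permKernel_symmetrise (a b : Σ n : ℕ, Fin n → E) :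
    ∑ σ : Fin a.1 ≃ Fin a.1, ∑ τ : Fin a.1 ≃ Fin b.1,
      ∏ i, inner ℂ (a.2 (σ i)) (b.2 (τ i)) = (Nat.factorial a.1 : ℂ) * permKernel a b := by
  have h : ∀ σ : Fin a.1 ≃ Fin a.1, ∑ τ : Fin a.1 ≃ Fin b.1,
      ∏ i, inner ℂ (a.2 (σ i)) (b.2 (τ i)) = permKernel a b := by
    intro σ
    unfold permKernel
    refine Fintype.sum_equiv ⟨fun τ => σ.symm.trans τ, fun τ => σ.trans τ,
      fun τ => by ext; simp, fun τ => by ext; simp⟩ _ _ ?_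
    intro τ
    refine Fintype.prod_equiv σ _ _ ?_
    intro i
    simp
  rw [Finset.sum_congr rfl fun σ _ => h σ]
  simp [Fintype.card_perm]

theorem posSemidef_prod_gram {ι κ : Type*} [Fintype ι] [Fintype κ] (v : ι → κ → E) :
    (Matrix.of fun a b : ι => ∏ i, inner ℂ (v a i) (v b i)).PosSemidef := by
  classical
  have key : ∀ s : Finset κ,
      (Matrix.of fun a b : ι => ∏ i ∈ s, inner ℂ (v a i) (v b i)).PosSemidef := by
    intro s
    induction s using Finset.induction_on with
    | empty =>
      have h1 : (Matrix.of fun a b : ι => ∏ i ∈ (∅ : Finset κ), inner ℂ (v a i) (v b i)) =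
          Matrix.gram ℂ (fun _ : ι => (1 : ℂ)) := by
        ext a b
        simp [Matrix.gram]
      rw [h1]
      exact Matrix.posSemidef_gram ℂ (fun _ : ι => (1 : ℂ))
    | insert k s hk ih =>
      have h1 : (Matrix.of fun a b : ι => ∏ i ∈ insert k s, inner ℂ (v a i) (v b i)) =
          (Matrix.gram ℂ (fun a : ι => v a k)).hadamard
            (Matrix.of fun a b : ι => ∏ i ∈ s, inner ℂ (v a i) (v b i)) := by
        ext a b
        simp [Matrix.gram, Matrix.hadamard, Finset.prod_insert hk]
      rw [h1]
      exact (Matrix.posSemidef_gram ℂ (fun a : ι => v a k)).hadamard ih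
  exact key Finset.univ

theorem permKernel_nonneg (x : (Σ n : ℕ, Fin n → E) →₀ ℂ) :
    0 ≤ x.sum fun a z => x.sum fun b w => conj z * w * permKernel a b := by
  classical
  have hterm : ∀ n : ℕ, 0 ≤ ∑ a ∈ x.support, ∑ b ∈ x.support,
      ∑ σ : Fin n ≃ Fin a.1, ∑ τ : Fin n ≃ Fin b.1,
        conj (x a) * x b * ∏ i, inner ℂ (a.2 (σ i)) (b.2 (τ i)) := by
    intro n
    have h := (posSemidef_prod_gram (E := E)
      (fun (q : Σ a : x.support, (Fin n ≃ Fin a.1.1)) (i : Fin n) =>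
        q.1.1.2 (q.2 i))).dotProduct_mulVec_nonneg (fun q => x q.1.1)
    simp only [dotProduct, Matrix.mulVec, Fintype.sum_sigma, Matrix.of_apply, Pi.star_apply,
      RCLike.star_def] at h
    refine h.trans_eq ?_
    rw [← Finset.sum_coe_sort x.support]
    refine Finset.sum_congr rfl fun a _ => ?_
    conv_rhs => rw [Finset.sum_comm]
    refine Finset.sum_congr rfl fun σ _ => ?_
    rw [← Finset.sum_coe_sort x.support, Finset.mul_sum]
    refine Finset.sum_congr rfl fun b _ => ?_
    rw [Finset.mul_sum]
    refine Finset.sum_congr rfl fun τ _ => ?_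
    ring
  have hsum : (x.sum fun a z => x.sum fun b w => conj z * w * permKernel a b) =
      ∑ n ∈ x.support.image Sigma.fst, ((Nat.factorial n : ℂ))⁻¹ *
        ∑ a ∈ x.support, ∑ b ∈ x.support,
        ∑ σ : Fin n ≃ Fin a.1, ∑ τ : Fin n ≃ Fin b.1,
          conj (x a) * x b * ∏ i, inner ℂ (a.2 (σ i)) (b.2 (τ i)) := by
    simp only [Finsupp.sum]
    have h1 : ∀ (c : ℕ → ℂ) (g : ℕ → (Σ n : ℕ, Fin n → E) → ℂ),
        ∑ n ∈ x.support.image Sigma.fst, c n * ∑ a ∈ x.support, g n a =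
          ∑ a ∈ x.support, ∑ n ∈ x.support.image Sigma.fst, c n * g n a := by
      intro c g
      rw [Finset.sum_comm]
      exact Finset.sum_congr rfl fun n _ => Finset.mul_sum _ _ _
    rw [h1]
    refine Finset.sum_congr rfl fun a ha => ?_
    rw [Finset.sum_eq_single a.1]
    · rw [Finset.mul_sum]
      refine Finset.sum_congr rfl fun b _ => ?_
      simp_rw [← Finset.mul_sum]
      rw [permKernel_symmetrise a b]
      have : (Nat.factorial a.1 : ℂ) ≠ 0 := by exact_mod_cast Nat.factorial_ne_zero _
      field_simp
    · intro n _ hn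
      have : IsEmpty (Fin n ≃ Fin a.1) := ⟨fun e => hn (by simpa using Fintype.card_congr e)⟩
      simp
    · intro h
      exact absurd (Finset.mem_image_of_mem _ ha) h
  rw [hsum]
  refine Finset.sum_nonneg fun n _ => mul_nonneg ?_ (hterm n)
  have : (0 : ℂ) ≤ (((Nat.factorial n : ℝ)⁻¹ : ℝ) : ℂ) := by
    exact_mod_cast inv_nonneg.mpr (Nat.cast_nonneg _)
  rwa [Complex.ofReal_inv, Complex.ofReal_natCast] at this

/-- The inner product of finite combinations of product vectors. -/
def permInner (x y : (Σ n : ℕ, Fin n → E) →₀ ℂ) : ℂ :=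
  x.sum fun a z => y.sum fun b w => conj z * w * permKernel a b

theorem permInner_conj_symm (x y : (Σ n : ℕ, Fin n → E) →₀ ℂ) :
    conj (permInner y x) = permInner x y := by
  unfold permInner
  simp only [Finsupp.sum, map_sum]
  rw [Finset.sum_comm]
  refine Finset.sum_congr rfl fun a _ => Finset.sum_congr rfl fun b _ => ?_
  rw [map_mul, map_mul, permKernel_conj_symm, Complex.conj_conj]
  ring

theorem permInner_add_left (x y z : (Σ n : ℕ, Fin n → E) →₀ ℂ) :
    permInner (x + y) z = permInner x z + permInner y z := by
  unfold permInner
  refine Finsupp.sum_add_index' (fun a => by simp) (fun a z w => ?_)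
  simp [← Finsupp.sum_add, add_mul]

theorem permInner_smul_left (x y : (Σ n : ℕ, Fin n → E) →₀ ℂ) (r : ℂ) :
    permInner (r • x) y = conj r * permInner x y := by
  unfold permInner
  refine (Finsupp.sum_smul_index (fun a => by simp)).trans ?_
  simp [Finsupp.mul_sum, mul_assoc]

instance FockCore.preCore : PreInnerProductSpace.Core ℂ (FockCore E) where
  inner x y := permInner x y
  conj_inner_symm x y := permInner_conj_symm x y
  re_inner_nonneg x := (Complex.le_def.mp (permKernel_nonneg x)).1
  add_left x y z := permInner_add_left x y z
  smul_left x y r := permInner_smul_left x y r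

instance : SeminormedAddCommGroup (FockCore E) :=
  InnerProductSpace.Core.toSeminormedAddCommGroup (𝕜 := ℂ)

instance : InnerProductSpace ℂ (FockCore E) := InnerProductSpace.ofCore _

variable (E) in
/-- The symmetric (bosonic) Fock space `⨁ₙ Symⁿ E` (Hilbert sum of completed symmetric tensor
powers): the Hausdorff completion of the span of all product vectors. Null vectors, that is, the
relations of multilinearity and symmetry, are divided out by the completion. -/
abbrev FockSpace : Type _ := UniformSpace.Completion (FockCore E)

/-- The vacuum vector `Ω₀`. -/
def fockVacuum : FockSpace E := ((FockCore.prodVec (Fin.elim0 : Fin 0 → E) : FockCore E) : FockSpace E)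

/-- Creation operator, `a*(h) (f₁ ⋯ fₙ) = h f₁ ⋯ fₙ`. -/
def creation (h : E) : Module.End ℂ (FockCore E) :=
  Finsupp.linearCombination ℂ fun a : Σ n : ℕ, Fin n → E =>
    FockCore.prodVec (Fin.cons h a.2 : Fin (a.1 + 1) → E)

/-- Annihilation operator, `a(h) (f₁ ⋯ fₙ) = ∑ₖ ⟪h, fₖ⟫ f₁ ⋯ f̂ₖ ⋯ fₙ`; it kills the vacuum. -/
def annihilation (h : E) : Module.End ℂ (FockCore E) :=
  Finsupp.linearCombination ℂ fun a : Σ n : ℕ, Fin n → E =>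
    match a with
    | ⟨0, _⟩ => (0 : FockCore E)
    | ⟨_ + 1, f⟩ => ∑ k, (inner ℂ h (f k) : ℂ) • FockCore.prodVec (k.removeNth f)

open Classical in
/-- `e^{iA}` for a field operator `A`, given on the dense domain of finite combinations of product
vectors, which are analytic vectors for it: the bounded operator on Fock space with
`e^{iA} Ψ = ∑ₙ (iⁿ / n!) Aⁿ Ψ` for `Ψ` in that domain. -/
def expI (A : Module.End ℂ (FockCore E)) : FockSpace E →L[ℂ] FockSpace E :=
  if h : ∃ T : FockSpace E →L[ℂ] FockSpace E, ∀ Ψ : FockCore E,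
      HasSum (fun n : ℕ => (Complex.I ^ n / (Nat.factorial n : ℂ)) •
        (((A ^ n) Ψ : FockCore E) : FockSpace E)) (T (Ψ : FockSpace E))
  then h.choose else 0

/-- The momentum space field operator `A(h) = (a*(h) + a(h)) / √2`. -/
def fieldOp (h : E) : Module.End ℂ (FockCore E) :=
  ((1 / Real.sqrt 2 : ℝ) : ℂ) • (creation h + annihilation h)

/-- The Weyl operator `W(h) = e^{i A(h)}`. -/
def weyl (h : E) : FockSpace E →L[ℂ] FockSpace E := expI (fieldOp h)

/-- The `C*`-algebra of operators on Fock space generated by the Weyl operators `W(h)`, `h ∈ S`. -/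
def weylAlgebra (S : Set E) : StarSubalgebra ℂ (FockSpace E →L[ℂ] FockSpace E) :=
  (StarAlgebra.adjoin ℂ (weyl '' S)).topologicalClosure

/-- A state: a positive linear functional of norm one. -/
def IsState {S : Set E} (ω : weylAlgebra S →L[ℂ] ℂ) : Prop :=
  (∀ B : weylAlgebra S, 0 ≤ ω (star B * B)) ∧ ‖ω‖ = 1

/-- `ω` is a Fock state: it is given by a unit vector of Fock space. -/
def IsFockState {S : Set E} (ω : weylAlgebra S →L[ℂ] ℂ) : Prop :=
  ∃ Ψ : FockSpace E, ‖Ψ‖ = 1 ∧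
    ∀ B : weylAlgebra S, ω B = inner ℂ Ψ ((B : FockSpace E →L[ℂ] FockSpace E) Ψ)

/-- `ω` is given by a density matrix `∑ₙ |Ψₙ⟩⟨Ψₙ|` of trace one on Fock space. -/
def IsFockNormalState {S : Set E} (ω : weylAlgebra S →L[ℂ] ℂ) : Prop :=
  ∃ Ψ : ℕ → FockSpace E, HasSum (fun n => ‖Ψ n‖ ^ 2) 1 ∧
    ∀ B : weylAlgebra S,
      HasSum (fun n => (inner ℂ (Ψ n) ((B : FockSpace E →L[ℂ] FockSpace E) (Ψ n)) : ℂ)) (ω B)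

end Fock

/-! ## The one-photon space -/

/-- Position and momentum space `ℝ³`. -/
abbrev R3 : Type := EuclideanSpace ℝ (Fin 3)

/-- `ℂ³` with its Hermitian inner product. -/
abbrev C3 : Type := EuclideanSpace ℂ (Fin 3)

/-- The inclusion `ℝ³ ⊆ ℂ³`. -/
def toC3 (v : R3) : C3 := WithLp.toLp 2 fun j => (v j : ℂ)

/-- The measure `dp / (2ω)` on momentum space, `ω = |p|`. -/
def photonMeasure : Measure R3 :=
  (volume : Measure R3).withDensity fun p => ENNReal.ofReal (1 / (2 * ‖p‖))

/-- The relativistic one-particle space `L²(ℝ³, dp / (2ω); ℂ³)`. -/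
abbrev PhotonL2 : Type := Lp C3 2 photonMeasure

/-- The one-photon space: the `h` with `p · h(p) = 0`. -/
def transverseSpace : Submodule ℂ PhotonL2 where
  carrier := {h | ∀ᵐ p ∂photonMeasure, ∑ j, ((p j : ℝ) : ℂ) * (h : R3 → C3) p j = 0}
  zero_mem' := by
    filter_upwards [Lp.coeFn_zero C3 2 photonMeasure] with p hp
    rw [hp]
    simp
  add_mem' := by
    intro f g hf hg
    filter_upwards [hf, hg, Lp.coeFn_add f g] with p h1 h2 h3
    rw [h3]
    simp only [Pi.add_apply, PiLp.add_apply, mul_add, Finset.sum_add_distrib, h1, h2, add_zero]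
  smul_mem' := by
    intro c f hf
    filter_upwards [hf, Lp.coeFn_smul c f] with p h1 h2
    simp only [h2, Pi.smul_apply, PiLp.smul_apply, smul_eq_mul, mul_left_comm _ c,
      ← Finset.mul_sum, h1, mul_zero]

/-- The transverse projection at momentum `p`: `(P z)ⱼ = ∑ₖ (δⱼₖ - pⱼ pₖ / |p|²) zₖ`. -/
def transverseProj (p : R3) (z : C3) : C3 :=
  WithLp.toLp 2 fun j => ∑ k, ((if j = k then (1 : ℂ) else 0) -
    ((p j * p k / ‖p‖ ^ 2 : ℝ) : ℂ)) * z k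

/-- The rapidly decreasing elements of the one-photon space. -/
def rapidSpace : Set transverseSpace :=
  {h | ∀ k : ℕ, ∃ C : ℝ, ∀ᵐ p ∂photonMeasure,
    ‖((h : PhotonL2) : R3 → C3) p‖ ≤ C * ((1 + ‖p‖ ^ 2) ^ k)⁻¹}

/-- The pairing `(f, g) = ∫ conj f(p) · g(p) dp / (2ω)`, antilinear in `f`. -/
def photonPairing (f g : R3 → C3) : ℂ := ∫ p, inner ℂ (f p) (g p) ∂photonMeasure

/-! ## The source: a point particle with trajectory `x` -/

section Source

variable (x : ℝ → R3)

/-- The phase `ψ(p, t) = ω t - p · x(t)`. -/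
def phase (p : R3) (t : ℝ) : ℝ := ‖p‖ * t - inner ℝ p (x t)

/-- `∂ψ/∂t = ω - p · x'(t)`. -/
def phaseD (p : R3) (t : ℝ) : ℝ := ‖p‖ - inner ℝ p (deriv x t)

/-- `∂²ψ/∂t² = - p · x''(t)`. -/
def phaseDD (p : R3) (t : ℝ) : ℝ := - inner ℝ p (deriv (deriv x) t)

/-- The amplitude of the current `x'(t) δ(y - x(t))` cut off to `|t| ≤ R`:
`J_R(p) = -i (2π)^{-3/2} ∫_{-R}^{R} x'(s) e^{iψ(p,s)} ds`. -/
def cutoffJ (R : ℝ) (p : R3) : C3 :=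
  (-Complex.I * (((2 * Real.pi) ^ (-(3 / 2) : ℝ) : ℝ) : ℂ)) •
    ∫ s in (-R)..R, Complex.exp (Complex.I * (phase x p s : ℂ)) • toC3 (deriv x s)

/-- The amplitude without cutoff, in its absolutely convergent form
`J(p) = -i (2π)^{-3/2} (1/i) ∫ [(ψ_tt / ψ_t²) x'(t) - (1 / ψ_t) x''(t)] e^{iψ(p,t)} dt`. -/
def sourceJ (p : R3) : C3 :=
  (-Complex.I * (((2 * Real.pi) ^ (-(3 / 2) : ℝ) : ℝ) : ℂ)) • (1 / Complex.I) •
    ∫ t, Complex.exp (Complex.I * (phase x p t : ℂ)) •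
      toC3 ((phaseDD x p t / phaseD x p t ^ 2) • deriv x t -
        (1 / phaseD x p t) • deriv (deriv x) t)

/-- The transverse part `J_T`. -/
def sourceJT (p : R3) : C3 := transverseProj p (sourceJ x p)

/-- `a*_out(h) = a*_in(h) - (J_T, h)`. -/
def creationOut (h : transverseSpace) : Module.End ℂ (FockCore transverseSpace) :=
  creation h - photonPairing (sourceJT x) ((h : PhotonL2) : R3 → C3) • 1

/-- `a_out(h) = a_in(h) - (h, J_T)`. -/
def annihilationOut (h : transverseSpace) : Module.End ℂ (FockCore transverseSpace) :=
  annihilation h - photonPairing ((h : PhotonL2) : R3 → C3) (sourceJT x) • 1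

/-- `A_out(h) = (a*_out(h) + a_out(h)) / √2`. -/
def fieldOpOut (h : transverseSpace) : Module.End ℂ (FockCore transverseSpace) :=
  ((1 / Real.sqrt 2 : ℝ) : ℂ) • (creationOut x h + annihilationOut x h)

/-- `W_out(h) = e^{i A_out(h)}`. -/
def weylOut (h : transverseSpace) : FockSpace transverseSpace →L[ℂ] FockSpace transverseSpace :=
  expI (fieldOpOut x h)

/-- The field algebra `𝔄`, generated by `W_in(h) = W(h)` for rapidly decreasing `h`. -/
abbrev fieldAlgebra :
    StarSubalgebra ℂ (FockSpace transverseSpace →L[ℂ] FockSpace transverseSpace) :=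
  weylAlgebra rapidSpace

/-- `α` is the automorphism of `𝔄` that takes each `W_out(h)` (an element of `𝔄`) to `W_in(h)`. -/
def IsScatteringAut (α : fieldAlgebra ≃⋆ₐ[ℂ] fieldAlgebra) : Prop :=
  ∀ h ∈ rapidSpace, ∃ B : fieldAlgebra,
    (B : FockSpace transverseSpace →L[ℂ] FockSpace transverseSpace) = weylOut x h ∧
    (α B : FockSpace transverseSpace →L[ℂ] FockSpace transverseSpace) = weyl h

/-- `ω = ω_in ∘ α` with `ω_in` the Fock vacuum and `α` the automorphism taking `W_out` to `W_in`. -/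
def IsOutState (ω : fieldAlgebra →L[ℂ] ℂ) : Prop :=
  ∃ α : fieldAlgebra ≃⋆ₐ[ℂ] fieldAlgebra, IsScatteringAut x α ∧
    ∀ B : fieldAlgebra, ω B = inner ℂ (fockVacuum : FockSpace transverseSpace)
      ((α B : FockSpace transverseSpace →L[ℂ] FockSpace transverseSpace) fockVacuum)

end Source

end

/-! The outgoing field differs from the incoming one by a real number:
$W_{out}(h)=e^{-i\ell(h)}W_{in}(h)$ with $\ell(h)=\sqrt2\,\mathrm{Re}(h,J_T)$ (`weylOut_eq`). So
$\alpha$ is the map $W(h)\mapsto e^{i\ell(h)}W(h)$, and everything depends on how singular the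
real-linear functional $\ell$ is.

Operator algebra. The Weyl relation gives $W(g)W(h)W(g)^*=e^{-i\,\mathrm{Im}(g,h)}W(h)$
(`weyl_conj`). With $g=i\sqrt2J$ this is the phase $\sqrt2\,\mathrm{Re}(h,J)$. Cutting $J_T$ off to
momentum shells gives $J_n\in\mathcal S$ with $(h,J_n)\to(h,J_T)$, so $\alpha$ exists as the
pointwise norm limit of the inner automorphisms of $W(i\sqrt2J_n)$ (`exists_isPhaseAut`), although
the unitaries themselves need not converge. If $J_T\in L^2$ no limit is needed: $\alpha$ is
implemented by $W(g)$, $g=i\sqrt2J_T$, and $\omega_{out}$ is the vector state of $W(g)^*\Omega_0$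
(`IsPhaseAut.isFockState`). If $J_T\notin L^2$, then $\|J_n\|\to\infty$, and $f_n=\pi
J_n/(\sqrt2\|J_n\|^2)$ tends to zero in norm while $\ell(f_n)=\pi$. A density matrix state satisfies
$\omega(W(f_n))\to1$ by strong continuity, but
$\omega_{out}(W(f_n))=-(\Omega_0,W(f_n)\Omega_0)\to-1$. This excludes density matrices and vectors
at once (`isWeylState_main`).

Analysis of the source. The amplitude in $J$ is $-\frac{d}{dt}(x'/\psi_t)$, and
$\psi_t\ge|p|(1-v_0)$, so there is no stationary phase. Directly $|J|\le K/|p|$. Since $x''$ has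
compact support and $x$ is $C^3$, another integration by parts gives $|J|\le K/|p|^2$, hence
convergence at large $p$. For small $p$, replacing $e^{i\psi}$ by 1 costs a bounded error and leaves
the boundary term $v_{out}/(\omega-p\cdot v_{out})-v_{in}/(\omega-p\cdot v_{in})$
(`exists_norm_sourceJ_sub_le`). It vanishes if the velocities agree. Otherwise, in a direction
orthogonal to both it is transverse and equals $(v_{out}-v_{in})/|p|$, so $|J_T|\ge\delta/|p|$ in a
cone (`exists_cone`); with the radial weight $r\,dr/2$ this diverges logarithmically.

Cut-off current. One integration by parts shows that $J_R-J$ consists of two boundary terms, which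
oscillate like $e^{iR(|p|-p\cdot v_{out})}$ and $e^{-iR(|p|-p\cdot v_{in})}$; paired with
$h\in\mathcal S$ they vanish by the Riemann-Lebesgue lemma along rays (`tendsto_pairing_cutoffJ`).
-/

noncomputable section

/-! ### Creation and annihilation operators on the core: adjointness and commutation relations -/

section FockCoreLemmas

variable {E : Type*}

theorem FockCore.induction {p : FockCore E → Prop} (h0 : p 0)
    (hprod : ∀ (n : ℕ) (f : Fin n → E), p (FockCore.prodVec f))
    (hadd : ∀ X Y, p X → p Y → p (X + Y)) (hsmul : ∀ (c : ℂ) X, p X → p (c • X))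
    (X : FockCore E) : p X := by
  refine Finsupp.induction_linear (motive := p) X h0 hadd fun a c => ?_
  have h := hsmul c _ (hprod a.1 a.2)
  have : (c • FockCore.prodVec a.2 : FockCore E) = Finsupp.single a c := by
    refine (Finsupp.smul_single c (⟨a.1, a.2⟩ : Σ n : ℕ, Fin n → E) (1 : ℂ)).trans ?_
    simp
  rwa [this] at h

variable [NormedAddCommGroup E] [InnerProductSpace ℂ E]

theorem creation_prodVec (h : E) {n : ℕ} (f : Fin n → E) :
    creation h (FockCore.prodVec f) = FockCore.prodVec (Fin.cons h f : Fin (n + 1) → E) := by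
  refine (Finsupp.linearCombination_single ℂ (1 : ℂ) (⟨n, f⟩ : Σ n : ℕ, Fin n → E)).trans ?_
  rw [one_smul]

theorem annihilation_prodVec_zero (h : E) (f : Fin 0 → E) :
    annihilation h (FockCore.prodVec f) = 0 := by
  refine (Finsupp.linearCombination_single ℂ (1 : ℂ) (⟨0, f⟩ : Σ n : ℕ, Fin n → E)).trans ?_
  rw [one_smul]

theorem annihilation_prodVec_succ (h : E) {n : ℕ} (f : Fin (n + 1) → E) :
    annihilation h (FockCore.prodVec f) =
      ∑ k, (inner ℂ h (f k) : ℂ) • FockCore.prodVec (k.removeNth f) := by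
  refine (Finsupp.linearCombination_single ℂ (1 : ℂ) (⟨n + 1, f⟩ : Σ n : ℕ, Fin n → E)).trans ?_
  rw [one_smul]

theorem inner_prodVec {n m : ℕ} (f : Fin n → E) (g : Fin m → E) :
    inner ℂ (FockCore.prodVec f : FockCore E) (FockCore.prodVec g) =
      ∑ e : Fin n ≃ Fin m, ∏ i, inner ℂ (f i) (g (e i)) := by
  have : permInner (Finsupp.single (⟨n, f⟩ : Σ n : ℕ, Fin n → E) 1)
      (Finsupp.single (⟨m, g⟩ : Σ n : ℕ, Fin n → E) 1) = permKernel ⟨n, f⟩ ⟨m, g⟩ := by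
    unfold permInner
    rw [Finsupp.sum_single_index, Finsupp.sum_single_index] <;> simp
  exact this

/-- A bijection of finite ordinals is given by the image of `0` and a bijection of the rest. -/
def finSuccEquivExtend {n m : ℕ} (q : Fin (m + 1) × (Fin n ≃ Fin m)) :
    Fin (n + 1) ≃ Fin (m + 1) :=
  (finSuccEquiv' 0).trans (q.2.optionCongr.trans (finSuccEquiv' q.1).symm)

theorem finSuccEquivExtend_zero {n m : ℕ} (q : Fin (m + 1) × (Fin n ≃ Fin m)) :
    finSuccEquivExtend q 0 = q.1 := by
  simp [finSuccEquivExtend]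

theorem finSuccEquivExtend_succ {n m : ℕ} (q : Fin (m + 1) × (Fin n ≃ Fin m)) (i : Fin n) :
    finSuccEquivExtend q i.succ = q.1.succAbove (q.2 i) := by
  have : (finSuccEquiv' (0 : Fin (n + 1))) i.succ = some i := by
    rw [← Fin.succAbove_zero, finSuccEquiv'_succAbove]
  simp [finSuccEquivExtend, this]

theorem finSuccEquivExtend_bijective {n m : ℕ} :
    Function.Bijective (finSuccEquivExtend : Fin (m + 1) × (Fin n ≃ Fin m) → _) := by
  constructor
  · rintro ⟨k, e⟩ ⟨k', e'⟩ h
    have h0 : k = k' := by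
      have := congrArg (fun e : Fin (n + 1) ≃ Fin (m + 1) => e 0) h
      simpa [finSuccEquivExtend_zero] using this
    subst h0
    congr 1
    ext i
    have := congrArg (fun e : Fin (n + 1) ≃ Fin (m + 1) => e i.succ) h
    simp only [finSuccEquivExtend_succ] at this
    rw [Fin.succAbove_right_injective this]
  · intro e
    let e' : Option (Fin n) ≃ Option (Fin m) :=
      (finSuccEquiv' 0).symm.trans (e.trans (finSuccEquiv' (e 0)))
    have hn : e' none = none := by simp [e']
    have hs : ∀ i, some (e'.removeNone i) = e' (some i) := by
      intro i
      refine Equiv.removeNone_some _ ?_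
      rcases h : e' (some i) with _ | y
      · exact absurd (e'.injective (h.trans hn.symm)) (by simp)
      · exact ⟨y, rfl⟩
    refine ⟨(e 0, e'.removeNone), ?_⟩
    ext i
    refine Fin.cases ?_ (fun i => ?_) i
    · rw [finSuccEquivExtend_zero]
    · rw [finSuccEquivExtend_succ, ← finSuccEquiv'_symm_some, hs]
      simp only [e', Equiv.trans_apply, Equiv.symm_apply_apply, finSuccEquiv'_symm_some,
        Fin.succAbove_zero]

/-- This is the expansion of a permanent along its first row: the bijections are sorted by the image
of `0`. -/
theorem inner_prodVec_cons_succ (h : E) {n m : ℕ} (f : Fin n → E) (g : Fin (m + 1) → E) :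
    inner ℂ (FockCore.prodVec (Fin.cons h f : Fin (n + 1) → E) : FockCore E) (FockCore.prodVec g) =
      ∑ k, inner ℂ h (g k) *
        inner ℂ (FockCore.prodVec f : FockCore E) (FockCore.prodVec (k.removeNth g)) := by
  simp only [inner_prodVec, Finset.mul_sum]
  rw [← Fintype.sum_prod_type', ← finSuccEquivExtend_bijective.sum_comp]
  refine Finset.sum_congr rfl fun q _ => ?_
  rw [Fin.prod_univ_succ, finSuccEquivExtend_zero]
  simp [finSuccEquivExtend_succ, Fin.removeNth]

/-- Both sides are sesquilinear, so product vectors suffice; there it is the permanent expansion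
along the row of `h`. -/
theorem inner_creation_left (h : E) (X Y : FockCore E) :
    inner ℂ (creation h X) Y = inner ℂ X (annihilation h Y) := by
  induction X using FockCore.induction with
  | h0 => simp
  | hadd X X' h1 h2 => simp only [map_add, inner_add_left, h1, h2]
  | hsmul c X h1 => simp only [map_smul, inner_smul_left, h1]
  | hprod n f =>
    induction Y using FockCore.induction with
    | h0 => simp
    | hadd X X' h1 h2 => simp only [map_add, inner_add_right, h1, h2]
    | hsmul c X h1 => simp only [map_smul, inner_smul_right, h1]
    | hprod m g =>
      rw [creation_prodVec]
      cases m with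
      | zero =>
        rw [annihilation_prodVec_zero, inner_zero_right, inner_prodVec]
        have : IsEmpty (Fin (n + 1) ≃ Fin 0) := ⟨fun e => (e 0).elim0⟩
        simp
      | succ m =>
        rw [annihilation_prodVec_succ, inner_prodVec_cons_succ, inner_sum]
        simp only [inner_smul_right]

theorem inner_annihilation_left (h : E) (X Y : FockCore E) :
    inner ℂ (annihilation h X) Y = inner ℂ X (creation h Y) := by
  rw [← inner_conj_symm, ← inner_creation_left, inner_conj_symm]

/-- This relation holds exactly, not only up to null vectors: contracting `g` with the first factor
`h` gives the scalar, and the other contractions leave `h` in front. -/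
theorem annihilation_creation (g h : E) (X : FockCore E) :
    annihilation g (creation h X) =
      creation h (annihilation g X) + (inner ℂ g h : ℂ) • X := by
  induction X using FockCore.induction with
  | h0 => simp
  | hadd X X' h1 h2 => simp only [map_add, h1, h2, smul_add]; abel
  | hsmul c X h1 => simp only [map_smul, h1, smul_add, smul_comm c]
  | hprod n f =>
    rw [creation_prodVec, annihilation_prodVec_succ, Fin.sum_univ_succ, add_comm]
    congr 1
    cases n with
    | zero => simp [annihilation_prodVec_zero]
    | succ n =>
      rw [annihilation_prodVec_succ, map_sum]
      refine Finset.sum_congr rfl fun k _ => ?_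
      rw [map_smul, creation_prodVec]
      congr 2
      ext i
      refine Fin.cases ?_ (fun i => ?_) i <;> simp [Fin.removeNth]

/-- The core keeps differently ordered tuples as different basis vectors, so creation operators
commute only up to null vectors. For this reason the relation, and everything derived from it, is
stated for matrix elements. Transposing the first two columns does not change a permanent. -/
theorem inner_creation_creation_comm (g h : E) (X Y : FockCore E) :
    inner ℂ X (creation g (creation h Y)) = inner ℂ X (creation h (creation g Y)) := by
  induction Y using FockCore.induction with
  | h0 => simp
  | hadd X X' h1 h2 => simp only [map_add, inner_add_right, h1, h2]
  | hsmul c X h1 => simp only [map_smul, inner_smul_right, h1]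
  | hprod n f =>
    induction X using FockCore.induction with
    | h0 => simp
    | hadd X X' h1 h2 => simp only [inner_add_left, h1, h2]
    | hsmul c X h1 => simp only [inner_smul_left, h1]
    | hprod m k =>
      simp only [creation_prodVec, inner_prodVec]
      refine Fintype.sum_equiv (Equiv.equivCongr (Equiv.refl _) (Equiv.swap 0 1)) _ _ fun e => ?_
      refine Finset.prod_congr rfl fun i _ => ?_
      congr 1
      simp only [Equiv.equivCongr_apply_apply, Equiv.refl_symm, Equiv.refl_apply]
      generalize e i = j
      refine Fin.cases ?_ (fun j => Fin.cases ?_ (fun j => ?_) j) j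
      · rw [Equiv.swap_apply_left]; rfl
      · rw [Fin.succ_zero_eq_one, Equiv.swap_apply_right]; rfl
      · rw [Equiv.swap_apply_of_ne_of_ne]
        · rfl
        · exact Fin.succ_ne_zero _
        · rw [← Fin.succ_zero_eq_one]; exact fun h => Fin.succ_ne_zero _ (Fin.succ_injective _ h)

theorem inner_fieldOp_left (h : E) (X Y : FockCore E) :
    inner ℂ (fieldOp h X) Y = inner ℂ X (fieldOp h Y) := by
  simp only [fieldOp, LinearMap.smul_apply, LinearMap.add_apply, inner_smul_left, inner_smul_right,
    inner_add_left, inner_add_right, inner_creation_left, inner_annihilation_left,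
    Complex.conj_ofReal]
  ring

theorem inner_annihilation_annihilation_comm (g h : E) (X Y : FockCore E) :
    inner ℂ X (annihilation g (annihilation h Y)) =
      inner ℂ X (annihilation h (annihilation g Y)) := by
  simp only [← inner_creation_left]
  rw [← inner_conj_symm, inner_creation_creation_comm, inner_conj_symm]

/-- The canonical commutation relation for field operators. -/
theorem inner_fieldOp_comm (g h : E) (X Y : FockCore E) :
    inner ℂ X (fieldOp g (fieldOp h Y)) =
      inner ℂ X (fieldOp h (fieldOp g Y)) +
        (Complex.I * ((inner ℂ g h : ℂ).im : ℂ)) * inner ℂ X Y := by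
  have hs : (((1 / Real.sqrt 2 : ℝ) : ℂ)) * ((1 / Real.sqrt 2 : ℝ) : ℂ) = 1 / 2 := by
    rw [← Complex.ofReal_mul]
    have : (1 / Real.sqrt 2) * (1 / Real.sqrt 2) = 1 / 2 := by
      rw [div_mul_div_comm, Real.mul_self_sqrt (by norm_num)]; norm_num
    rw [this]; norm_num
  have hc : (inner ℂ g h : ℂ) - inner ℂ h g = 2 * (Complex.I * ((inner ℂ g h : ℂ).im : ℂ)) := by
    rw [← inner_conj_symm h g, Complex.sub_conj]; push_cast; ring
  have h1 := annihilation_creation g h Y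
  have h2 := annihilation_creation h g Y
  have h3 := inner_creation_creation_comm g h X Y
  have h4 := inner_annihilation_annihilation_comm g h X Y
  simp only [fieldOp, LinearMap.smul_apply, LinearMap.add_apply, inner_smul_right,
    inner_add_right, map_smul, map_add, h1, h2]
  generalize (((1 / Real.sqrt 2 : ℝ) : ℂ)) = s at *
  rw [h3, h4]
  generalize (Complex.I * ((inner ℂ g h : ℂ).im : ℂ)) = z at *
  linear_combination (s * s * inner ℂ X Y) * hc + 2 * z * inner ℂ X Y * hs

end FockCoreLemmas

/-! ### Number bounds: the core consists of analytic vectors -/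

section FockBounds

variable {E : Type*} [NormedAddCommGroup E] [InnerProductSpace ℂ E]

/-- `FockBound N M X`: `X` is a combination of product vectors with at most `N` particles whose
norms, estimated by `√n! ∏ ‖fᵢ‖`, add up to at most `M`. -/
inductive FockBound (N : ℕ) : ℝ → FockCore E → Prop
  | zero : FockBound N 0 0
  | prodVec (c : ℂ) {n : ℕ} (hn : n ≤ N) (f : Fin n → E) :
      FockBound N (‖c‖ * (Real.sqrt n.factorial * ∏ i, ‖f i‖)) (c • FockCore.prodVec f)
  | add {M M' : ℝ} {X Y : FockCore E} :
      FockBound N M X → FockBound N M' Y → FockBound N (M + M') (X + Y)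
  | mono {M M' : ℝ} {X : FockCore E} : FockBound N M X → M ≤ M' → FockBound N M' X

theorem FockBound.sum {N : ℕ} {ι : Type*} (s : Finset ι) {M : ι → ℝ} {X : ι → FockCore E}
    (h : ∀ i ∈ s, FockBound N (M i) (X i)) : FockBound N (∑ i ∈ s, M i) (∑ i ∈ s, X i) := by
  classical
  induction s using Finset.induction_on with
  | empty => simpa using FockBound.zero
  | insert i s hi ih =>
    rw [Finset.sum_insert hi, Finset.sum_insert hi]
    exact (h i (by simp)).add (ih fun j hj => h j (by simp [hj]))

theorem FockBound.smul {N : ℕ} {M : ℝ} {X : FockCore E} (c : ℂ) (h : FockBound N M X) :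
    FockBound N (‖c‖ * M) (c • X) := by
  induction h with
  | zero => simpa using FockBound.zero
  | prodVec d hn f =>
    rw [smul_smul, ← mul_assoc, ← norm_mul]
    exact FockBound.prodVec _ hn f
  | add _ _ h1 h2 => rw [mul_add, smul_add]; exact h1.add h2
  | mono _ hM h1 => exact h1.mono (by gcongr)

theorem FockBound.le {N N' : ℕ} {M : ℝ} {X : FockCore E} (h : FockBound N M X) (hN : N ≤ N') :
    FockBound N' M X := by
  induction h with
  | zero => exact FockBound.zero
  | prodVec d hn f => exact FockBound.prodVec d (hn.trans hN) f
  | add _ _ h1 h2 => exact h1.add h2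
  | mono _ hM h1 => exact h1.mono hM

theorem FockBound.exists (X : FockCore E) : ∃ N M, FockBound N M X := by
  induction X using FockCore.induction with
  | h0 => exact ⟨0, 0, .zero⟩
  | hadd X X' h1 h2 =>
    obtain ⟨N, M, h1⟩ := h1
    obtain ⟨N', M', h2⟩ := h2
    exact ⟨max N N', M + M', (h1.le (le_max_left _ _)).add (h2.le (le_max_right _ _))⟩
  | hsmul c X h1 =>
    obtain ⟨N, M, h1⟩ := h1
    exact ⟨N, _, h1.smul c⟩
  | hprod n f => exact ⟨n, _, by simpa using FockBound.prodVec (1 : ℂ) le_rfl f⟩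

/-- The squared norm is a permanent of `n!` terms, each at most `(∏ ‖f i‖) ^ 2` by Cauchy-Schwarz.
-/
theorem norm_prodVec_le {n : ℕ} (f : Fin n → E) :
    ‖(FockCore.prodVec f : FockCore E)‖ ≤ Real.sqrt n.factorial * ∏ i, ‖f i‖ := by
  have hP : 0 ≤ ∏ i, ‖f i‖ := Finset.prod_nonneg fun _ _ => norm_nonneg _
  refine abs_le_of_sq_le_sq' ?_ (by positivity) |>.2
  rw [mul_pow, Real.sq_sqrt (by positivity), ← inner_self_eq_norm_sq (𝕜 := ℂ), inner_prodVec]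
  refine (RCLike.re_le_norm _).trans ((norm_sum_le _ _).trans ?_)
  have : ∀ e : Fin n ≃ Fin n, ‖∏ i, (inner ℂ (f i) (f (e i)) : ℂ)‖ ≤ (∏ i, ‖f i‖) ^ 2 := by
    intro e
    rw [norm_prod]
    calc ∏ i, ‖(inner ℂ (f i) (f (e i)) : ℂ)‖ ≤ ∏ i, (‖f i‖ * ‖f (e i)‖) :=
          Finset.prod_le_prod (fun _ _ => norm_nonneg _) fun i _ => norm_inner_le_norm _ _
      _ = (∏ i, ‖f i‖) ^ 2 := by
          rw [Finset.prod_mul_distrib, e.prod_comp (fun i => ‖f i‖), sq]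
  refine (Finset.sum_le_sum fun e _ => this e).trans ?_
  simp [Fintype.card_perm]

theorem FockBound.norm_le {N : ℕ} {M : ℝ} {X : FockCore E} (h : FockBound N M X) : ‖X‖ ≤ M := by
  induction h with
  | zero => simp
  | prodVec d hn f =>
    rw [norm_smul]
    exact mul_le_mul_of_nonneg_left (norm_prodVec_le f) (norm_nonneg _)
  | add _ _ h1 h2 => exact (norm_add_le _ _).trans (add_le_add h1 h2)
  | mono _ hM h1 => exact h1.trans hM

theorem FockBound.creation {N : ℕ} {M : ℝ} {X : FockCore E} (h : E) (hX : FockBound N M X) :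
    FockBound (N + 1) (Real.sqrt (N + 1) * ‖h‖ * M) (creation h X) := by
  induction hX with
  | zero => simpa using FockBound.zero
  | add _ _ h1 h2 => rw [mul_add, map_add]; exact h1.add h2
  | mono _ hM h1 => exact h1.mono (by gcongr)
  | @prodVec d n hn f =>
    rw [map_smul, creation_prodVec]
    refine (FockBound.prodVec d (Nat.succ_le_succ hn) _).mono ?_
    rw [Fin.prod_univ_succ, Nat.factorial_succ]
    push_cast
    rw [Real.sqrt_mul (by positivity)]
    simp only [Fin.cons_zero, Fin.cons_succ]
    have h1 : Real.sqrt (n + 1) ≤ Real.sqrt (N + 1) := Real.sqrt_le_sqrt (by gcongr)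
    have h2 : 0 ≤ ‖h‖ * (‖d‖ * (Real.sqrt n.factorial * ∏ i, ‖f i‖)) := by
      have hP : 0 ≤ ∏ i, ‖f i‖ := Finset.prod_nonneg fun _ _ => norm_nonneg _
      positivity
    calc _ = Real.sqrt (n + 1) * (‖h‖ * (‖d‖ * (Real.sqrt n.factorial * ∏ i, ‖f i‖))) := by ring
      _ ≤ Real.sqrt (N + 1) * (‖h‖ * (‖d‖ * (Real.sqrt n.factorial * ∏ i, ‖f i‖))) := by gcongr
      _ = _ := by ring

/-- There are `n + 1` contractions, and `(n + 1) √n! = √(n + 1) √(n + 1)!`, which costs the same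
factor as creation. The particle number is bounded by `N + 1`, far from sharply, so that both halves
of the field operator obey the same estimate. -/
theorem FockBound.annihilation {N : ℕ} {M : ℝ} {X : FockCore E} (h : E) (hX : FockBound N M X) :
    FockBound (N + 1) (Real.sqrt (N + 1) * ‖h‖ * M) (annihilation h X) := by
  induction hX with
  | zero => simpa using FockBound.zero
  | add _ _ h1 h2 => rw [mul_add, map_add]; exact h1.add h2
  | mono _ hM h1 => exact h1.mono (by gcongr)
  | @prodVec d n hn f =>
    have hP : 0 ≤ ∏ i, ‖f i‖ := Finset.prod_nonneg fun _ _ => norm_nonneg _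
    cases n with
    | zero =>
      rw [map_smul, annihilation_prodVec_zero, smul_zero]
      exact FockBound.zero.mono (by positivity)
    | succ n =>
      rw [map_smul, annihilation_prodVec_succ, Finset.smul_sum]
      simp only [smul_smul]
      refine (FockBound.sum _ fun k _ => FockBound.prodVec _ (by omega) _).mono ?_
      have hk : ∀ k : Fin (n + 1), ‖d * inner ℂ h (f k)‖ *
          (Real.sqrt n.factorial * ∏ i, ‖(k.removeNth f) i‖) ≤
          ‖h‖ * (‖d‖ * (Real.sqrt n.factorial * ∏ i, ‖f i‖)) := by
        intro k
        have hP' : 0 ≤ ∏ i, ‖(k.removeNth f) i‖ := Finset.prod_nonneg fun _ _ => norm_nonneg _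
        rw [Fin.prod_univ_succAbove _ k, norm_mul]
        calc _ ≤ ‖d‖ * (‖h‖ * ‖f k‖) * (Real.sqrt n.factorial * ∏ i, ‖(k.removeNth f) i‖) := by
              gcongr; exact norm_inner_le_norm _ _
          _ = _ := by simp only [Fin.removeNth]; ring
      refine (Finset.sum_le_sum fun k _ => hk k).trans ?_
      rw [Finset.sum_const, Finset.card_univ, Fintype.card_fin, nsmul_eq_mul, Nat.factorial_succ]
      push_cast
      rw [Real.sqrt_mul (by positivity)]
      have h1 : (n + 1 : ℝ) ≤ Real.sqrt (N + 1) * Real.sqrt (n + 1) := by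
        calc (n + 1 : ℝ) = Real.sqrt (n + 1) * Real.sqrt (n + 1) :=
              (Real.mul_self_sqrt (by positivity)).symm
          _ ≤ _ := by
            gcongr
            exact (Nat.le_succ n).trans hn
      calc _ ≤ (Real.sqrt (N + 1) * Real.sqrt (n + 1)) *
            (‖h‖ * (‖d‖ * (Real.sqrt n.factorial * ∏ i, ‖f i‖))) := by gcongr
        _ = _ := by ring

theorem FockBound.fieldOp {N : ℕ} {M : ℝ} {X : FockCore E} (h : E) (hX : FockBound N M X) :
    FockBound (N + 1) (2 * ‖h‖ * Real.sqrt (N + 1) * M) (fieldOp h X) := by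
  have hM : 0 ≤ M := (norm_nonneg _).trans hX.norm_le
  refine (((hX.creation h).add (hX.annihilation h)).smul _).mono ?_
  rw [Complex.norm_real, Real.norm_of_nonneg (by positivity), ← two_mul]
  have : 1 / Real.sqrt 2 ≤ 1 := by
    rw [div_le_one (by positivity)]; exact Real.one_le_sqrt.mpr (by norm_num)
  calc _ ≤ 1 * (2 * (Real.sqrt (N + 1) * ‖h‖ * M)) := by gcongr
    _ = _ := by ring

theorem norm_fieldOp_pow_le {N : ℕ} {M : ℝ} {X : FockCore E} (h : E) (hX : FockBound N M X)
    (n : ℕ) : ‖(fieldOp h ^ n) X‖ ≤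
      ‖h‖ ^ n * (2 ^ n * (∏ j ∈ Finset.range n, Real.sqrt (N + j + 1)) * M) := by
  suffices hb : FockBound (N + n)
      (‖h‖ ^ n * (2 ^ n * (∏ j ∈ Finset.range n, Real.sqrt (N + j + 1)) * M)) ((fieldOp h ^ n) X) from
    hb.norm_le
  induction n with
  | zero => simpa using hX
  | succ n ih =>
    rw [pow_succ' (fieldOp h), Module.End.mul_apply]
    refine (ih.fieldOp h).mono (le_of_eq ?_)
    rw [Finset.prod_range_succ]
    push_cast
    ring

/-- The product of square roots grows only like `√n!` up to powers, so division by `n!` beats every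
geometric factor. -/
theorem summable_fockWeight (r : ℝ) (N : ℕ) :
    Summable fun n : ℕ => r ^ n * (2 ^ n * ∏ j ∈ Finset.range n, Real.sqrt (N + j + 1)) /
      n.factorial := by
  refine summable_of_ratio_norm_eventually_le (r := 1 / 2) (by norm_num) ?_
  -- The square of the ratio of consecutive terms is at most `4 r² (N + 1) / (n + 1)`, because `N +
  -- n + 1 ≤ (N + 1)(n + 1)`. The factor 16 makes the ratio at most 1/2 once this quantity is below
  -- 1.
  have hlim : Tendsto (fun n : ℕ => 16 * r ^ 2 * ((N : ℝ) + 1) / ((n : ℝ) + 1)) atTop (𝓝 0) := by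
    have := tendsto_one_div_add_atTop_nhds_zero_nat (𝕜 := ℝ)
    simpa [div_eq_mul_inv] using this.const_mul (16 * r ^ 2 * ((N : ℝ) + 1))
  filter_upwards [hlim.eventually (gt_mem_nhds zero_lt_one)] with n hn
  rw [Finset.prod_range_succ, Nat.factorial_succ]
  push_cast
  have key : |r| * 2 * Real.sqrt (N + n + 1) / (n + 1) ≤ 1 / 2 := by
    rw [div_le_iff₀ (by positivity)]
    refine abs_le_of_sq_le_sq' ?_ (by positivity) |>.2
    rw [mul_pow, mul_pow, sq_abs, Real.sq_sqrt (by positivity)]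
    rw [div_lt_one (by positivity)] at hn
    have : (N + n + 1 : ℝ) ≤ (N + 1) * (n + 1) := by nlinarith [mul_nonneg (Nat.cast_nonneg (α := ℝ) N) (Nat.cast_nonneg (α := ℝ) n)]
    calc r ^ 2 * 2 ^ 2 * (N + n + 1 : ℝ) ≤ r ^ 2 * 2 ^ 2 * ((N + 1) * (n + 1)) := by gcongr
      _ = (1 / 4) * (16 * r ^ 2 * (N + 1)) * (n + 1) := by ring
      _ ≤ (1 / 4) * (n + 1) * (n + 1) := by gcongr
      _ = _ := by ring
  have hP : 0 ≤ ∏ j ∈ Finset.range n, Real.sqrt (N + j + 1) :=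
    Finset.prod_nonneg fun _ _ => Real.sqrt_nonneg _
  simp only [norm_mul, norm_div, norm_pow, Real.norm_eq_abs, abs_of_nonneg hP,
    abs_of_nonneg (Real.sqrt_nonneg _), Nat.abs_cast, abs_two]
  rw [abs_of_nonneg (by positivity : (0 : ℝ) ≤ n + 1)]
  calc _ = (|r| * 2 * Real.sqrt (N + n + 1) / (n + 1)) *
        (|r| ^ n * (2 ^ n * ∏ j ∈ Finset.range n, Real.sqrt (N + j + 1)) / n.factorial) := by
        field_simp
        ring
    _ ≤ _ := by gcongr

end FockBounds

/-! ### Cauchy products of absolutely convergent double series -/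

section CauchyProduct

theorem hasSum_antidiagonal_of_norm_le {G : Type*} [NormedAddCommGroup G] [CompleteSpace G]
    {b : ℕ → ℕ → G} {u v : ℕ → ℝ} (hu : Summable u) (hv : Summable v) (hu0 : ∀ m, 0 ≤ u m)
    (hv0 : ∀ m, 0 ≤ v m) (hb : ∀ m n, ‖b m n‖ ≤ u m * v n) :
    HasSum (fun N => ∑ p ∈ Finset.HasAntidiagonal.antidiagonal N, b p.1 p.2) (∑' m, ∑' n, b m n) := by
  have S : Summable fun p : ℕ × ℕ => b p.1 p.2 :=
    Summable.of_norm_bounded (hu.mul_of_nonneg hv hu0 hv0) fun p => hb p.1 p.2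
  have h1 : (∑' m, ∑' n, b m n) = ∑' p : ℕ × ℕ, b p.1 p.2 :=
    (S.tsum_prod (f := fun p : ℕ × ℕ => b p.1 p.2)).symm
  rw [h1]
  have h2 := (Finset.HasAntidiagonal.sigmaAntidiagonalEquivProd (A := ℕ)).hasSum_iff.mpr S.hasSum
  refine h2.sigma fun N => ?_
  convert! hasSum_fintype _ using 1
  exact (Finset.sum_coe_sort (Finset.HasAntidiagonal.antidiagonal N) (fun p => b p.1 p.2)).symm

theorem sum_antidiagonal_pow_div_factorial (x y : ℂ) (N : ℕ) :
    ∑ p ∈ Finset.HasAntidiagonal.antidiagonal N, (x ^ p.1 / p.1.factorial) * (y ^ p.2 / p.2.factorial) =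
      (x + y) ^ N / N.factorial := by
  rw [(Commute.all x y).add_pow', Finset.sum_div]
  refine Finset.sum_congr rfl fun p hp => ?_
  rw [Finset.HasAntidiagonal.mem_antidiagonal] at hp
  subst hp
  rw [nsmul_eq_mul, Nat.cast_add_choose]
  have h1 : ((p.1 + p.2).factorial : ℂ) ≠ 0 := by exact_mod_cast Nat.factorial_ne_zero _
  have h2 : (p.1.factorial : ℂ) ≠ 0 := by exact_mod_cast Nat.factorial_ne_zero _
  have h3 : (p.2.factorial : ℂ) ≠ 0 := by exact_mod_cast Nat.factorial_ne_zero _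
  field_simp

end CauchyProduct

/-! ### Exponentials of symmetric operators with analytic vectors -/

section Exponential

variable {E : Type*} [NormedAddCommGroup E] [InnerProductSpace ℂ E]

/-- A symmetric operator on the core all of whose vectors are analytic. -/
structure IsAnalyticSymm (A : Module.End ℂ (FockCore E)) : Prop where
  symm : ∀ X Y : FockCore E, inner ℂ (A X) Y = inner ℂ X (A Y)
  summable : ∀ X : FockCore E, Summable fun n : ℕ => ‖(A ^ n) X‖ / n.factorial

variable {A : Module.End ℂ (FockCore E)}

theorem IsAnalyticSymm.inner_pow (hA : IsAnalyticSymm A) (n : ℕ) (X Y : FockCore E) :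
    inner ℂ ((A ^ n) X) Y = inner ℂ X ((A ^ n) Y) := by
  induction n generalizing Y with
  | zero => simp
  | succ n ih => rw [pow_succ', Module.End.mul_apply, hA.symm, ih, ← Module.End.mul_apply,
      ← pow_succ, pow_succ']

theorem IsAnalyticSymm.neg (hA : IsAnalyticSymm A) : IsAnalyticSymm (-A) where
  symm X Y := by simp [hA.symm]
  summable X := by
    refine (hA.summable X).congr fun n => ?_
    rcases Nat.even_or_odd n with hn | hn
    · rw [hn.neg_pow]
    · rw [hn.neg_pow, LinearMap.neg_apply, norm_neg]

theorem norm_expTerm (A : Module.End ℂ (FockCore E)) (X : FockCore E) (n : ℕ) :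
    ‖(Complex.I ^ n / (n.factorial : ℂ)) • (((A ^ n) X : FockCore E) : FockSpace E)‖ =
      ‖(A ^ n) X‖ / n.factorial := by
  rw [norm_smul, UniformSpace.Completion.norm_coe]
  simp [div_eq_inv_mul]

theorem IsAnalyticSymm.summable_expTerm (hA : IsAnalyticSymm A) (X : FockCore E) :
    Summable fun n : ℕ => (Complex.I ^ n / (n.factorial : ℂ)) •
      (((A ^ n) X : FockCore E) : FockSpace E) :=
  Summable.of_norm ((hA.summable X).congr fun n => (norm_expTerm A X n).symm)

/-- Expand into a double series and sum along antidiagonals. Symmetry moves all powers of `A` to the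
right, and the coefficients of `A ^ N` add up to `(-i + i) ^ N / N!`, so only `N = 0` survives. -/
theorem IsAnalyticSymm.inner_tsum_expTerm (hA : IsAnalyticSymm A) (X Y : FockCore E) :
    (inner ℂ (∑' n : ℕ, (Complex.I ^ n / (n.factorial : ℂ)) •
        (((A ^ n) X : FockCore E) : FockSpace E))
      (∑' n : ℕ, (Complex.I ^ n / (n.factorial : ℂ)) •
        (((A ^ n) Y : FockCore E) : FockSpace E)) : ℂ) = inner ℂ X Y := by
  set u := fun n : ℕ => (Complex.I ^ n / (n.factorial : ℂ)) •
    (((A ^ n) X : FockCore E) : FockSpace E) with hu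
  set v := fun n : ℕ => (Complex.I ^ n / (n.factorial : ℂ)) •
    (((A ^ n) Y : FockCore E) : FockSpace E) with hv
  have hus : Summable u := hA.summable_expTerm X
  have hvs : Summable v := hA.summable_expTerm Y
  have h1 : (inner ℂ (∑' n, u n) (∑' n, v n) : ℂ) = ∑' m, ∑' n, inner ℂ (u m) (v n) := by
    have e1 : (inner ℂ (∑' n, u n) (∑' n, v n) : ℂ) = ∑' m, inner ℂ (u m) (∑' n, v n) := by
      rw [← inner_conj_symm]
      have := ((innerSL ℂ (∑' n, v n)).hasSum hus.hasSum).mapL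
        (Complex.conjCLE : ℂ →L[ℝ] ℂ)
      refine Eq.trans ?_ (this.tsum_eq.symm.trans (tsum_congr fun m => ?_))
      · rfl
      · exact inner_conj_symm (u m) (∑' n, v n)
    rw [e1]
    refine tsum_congr fun m => ?_
    exact ((innerSL ℂ (u m)).hasSum hvs.hasSum).tsum_eq.symm
  have h2 := hasSum_antidiagonal_of_norm_le (b := fun m n => (inner ℂ (u m) (v n) : ℂ))
    (hA.summable X) (hA.summable Y) (fun m => by positivity) (fun m => by positivity)
    (fun m n => by
      rw [← norm_expTerm, ← norm_expTerm]
      exact norm_inner_le_norm _ _)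
  rw [h1]
  refine h2.unique ?_
  have h3 : ∀ N : ℕ, (∑ p ∈ Finset.HasAntidiagonal.antidiagonal N, (inner ℂ (u p.1) (v p.2) : ℂ)) =
      (-Complex.I + Complex.I) ^ N / N.factorial * inner ℂ X ((A ^ N) Y) := by
    intro N
    rw [← sum_antidiagonal_pow_div_factorial, Finset.sum_mul]
    refine Finset.sum_congr rfl fun p hp => ?_
    rw [Finset.HasAntidiagonal.mem_antidiagonal] at hp
    simp only [hu, hv, inner_smul_left, inner_smul_right, UniformSpace.Completion.inner_coe,
      hA.inner_pow, ← Module.End.mul_apply, ← pow_add, hp]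
    simp
    ring
  simp_rw [h3]
  convert! hasSum_single (α := ℂ) 0 ?_ using 1
  · simp
  · intro n hn
    simp [hn]

/-- The series preserves inner products on the core, so it is bounded and extends to the completion.
This rules out the default value `0` in the definition of `expI`. -/
theorem IsAnalyticSymm.exists_exp (hA : IsAnalyticSymm A) :
    ∃ T : FockSpace E →L[ℂ] FockSpace E, ∀ X : FockCore E,
      HasSum (fun n : ℕ => (Complex.I ^ n / (Nat.factorial n : ℂ)) •
        (((A ^ n) X : FockCore E) : FockSpace E)) (T (X : FockSpace E)) := by
  let T₀ : FockCore E →ₗ[ℂ] FockSpace E :=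
    { toFun := fun X => ∑' n : ℕ, (Complex.I ^ n / (n.factorial : ℂ)) •
        (((A ^ n) X : FockCore E) : FockSpace E)
      map_add' := fun X Y => by
        rw [← (hA.summable_expTerm X).tsum_add (hA.summable_expTerm Y)]
        refine tsum_congr fun n => ?_
        rw [map_add, UniformSpace.Completion.coe_add, smul_add]
      map_smul' := fun c X => by
        rw [RingHom.id_apply, ← tsum_const_smul'' c]
        refine tsum_congr fun n => ?_
        rw [map_smul, UniformSpace.Completion.coe_smul, smul_comm] }
  have hT₀ : ∀ X, ‖T₀ X‖ ≤ 1 * ‖X‖ := by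
    intro X
    have h := hA.inner_tsum_expTerm X X
    rw [inner_self_eq_norm_sq_to_K, inner_self_eq_norm_sq_to_K] at h
    change ((‖T₀ X‖ : ℝ) : ℂ) ^ 2 = _ at h
    have h' : ‖T₀ X‖ ^ 2 = ‖X‖ ^ 2 := Complex.ofReal_injective (by push_cast; exact h)
    rw [one_mul]
    exact le_of_eq ((sq_eq_sq₀ (norm_nonneg _) (norm_nonneg _)).mp h')
  let T₁ : FockCore E →L[ℂ] FockSpace E := T₀.mkContinuous 1 hT₀
  refine ⟨T₁.extend (UniformSpace.Completion.toComplL : FockCore E →L[ℂ] FockSpace E), fun X => ?_⟩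
  have := ContinuousLinearMap.extend_eq T₁
    (e := (UniformSpace.Completion.toComplL : FockCore E →L[ℂ] FockSpace E))
    UniformSpace.Completion.denseRange_coe
    (UniformSpace.Completion.isUniformInducing_coe (FockCore E)) X
  rw [UniformSpace.Completion.coe_toComplL] at this
  rw [this]
  exact (hA.summable_expTerm X).hasSum

theorem IsAnalyticSymm.hasSum_expI (hA : IsAnalyticSymm A) (X : FockCore E) :
    HasSum (fun n : ℕ => (Complex.I ^ n / (Nat.factorial n : ℂ)) •
      (((A ^ n) X : FockCore E) : FockSpace E)) (expI A (X : FockSpace E)) := by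
  have h := hA.exists_exp
  rw [expI, dif_pos h]
  exact h.choose_spec X

theorem FockSpace.ext_core {F : Type*} [NormedAddCommGroup F] [Module ℂ F]
    {S T : FockSpace E →L[ℂ] F}
    (h : ∀ X : FockCore E, S (X : FockSpace E) = T X) : S = T :=
  ContinuousLinearMap.ext fun x =>
    congrFun (UniformSpace.Completion.denseRange_coe.equalizer S.continuous T.continuous
      (funext h)) x

theorem FockSpace.ext_inner_core {x y : FockSpace E}
    (h : ∀ X : FockCore E, (inner ℂ (X : FockSpace E) x : ℂ) = inner ℂ (X : FockSpace E) y) :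
    x = y := by
  refine ext_inner_left ℂ fun z => ?_
  induction z using UniformSpace.Completion.induction_on with
  | hp => exact isClosed_eq (by fun_prop) (by fun_prop)
  | ih X => exact h X

theorem expI_eq_of_hasSum {T : FockSpace E →L[ℂ] FockSpace E}
    (h : ∀ X : FockCore E, HasSum (fun n : ℕ => (Complex.I ^ n / (Nat.factorial n : ℂ)) •
      (((A ^ n) X : FockCore E) : FockSpace E)) (T (X : FockSpace E))) : expI A = T := by
  have hex : ∃ T : FockSpace E →L[ℂ] FockSpace E, ∀ X : FockCore E,
      HasSum (fun n : ℕ => (Complex.I ^ n / (Nat.factorial n : ℂ)) •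
        (((A ^ n) X : FockCore E) : FockSpace E)) (T (X : FockSpace E)) := ⟨T, h⟩
  refine FockSpace.ext_core fun X => ?_
  rw [expI, dif_pos hex]
  exact (hex.choose_spec X).unique (h X)

theorem IsAnalyticSymm.inner_expI_expI (hA : IsAnalyticSymm A) (x y : FockSpace E) :
    (inner ℂ (expI A x) (expI A y) : ℂ) = inner ℂ x y := by
  induction x, y using UniformSpace.Completion.induction_on₂ with
  | hp => exact isClosed_eq (by fun_prop) (by fun_prop)
  | ih X Y =>
    rw [← (hA.hasSum_expI X).tsum_eq, ← (hA.hasSum_expI Y).tsum_eq, hA.inner_tsum_expTerm,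
      UniformSpace.Completion.inner_coe]

theorem IsAnalyticSymm.inner_expI_right (hA : IsAnalyticSymm A) (X : FockCore E) (y : FockSpace E) :
    HasSum (fun n : ℕ => (Complex.I ^ n / (Nat.factorial n : ℂ)) *
      (inner ℂ y (((A ^ n) X : FockCore E) : FockSpace E) : ℂ)) (inner ℂ y (expI A X)) := by
  simpa [inner_smul_right] using (innerSL ℂ y).hasSum (hA.hasSum_expI X)

theorem IsAnalyticSymm.adjoint_expI (hA : IsAnalyticSymm A) : star (expI A) = expI (-A) := by
  refine FockSpace.ext_core fun X => FockSpace.ext_inner_core fun Y => ?_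
  rw [ContinuousLinearMap.star_eq_adjoint, ContinuousLinearMap.adjoint_inner_right]
  refine HasSum.unique ?_ (hA.neg.inner_expI_right X Y)
  rw [← inner_conj_symm]
  have h := (hA.inner_expI_right Y X).mapL (Complex.conjCLE : ℂ →L[ℝ] ℂ)
  convert! h using 2 with n
  simp only [ContinuousLinearEquiv.coe_coe, Complex.conjCLE_apply, map_mul, map_div₀, map_pow,
    Complex.conj_I, Complex.conj_natCast, inner_conj_symm, UniformSpace.Completion.inner_coe]
  rw [hA.inner_pow, neg_pow Complex.I]
  rcases Nat.even_or_odd n with hn | hn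
  · simp [hn]
  · rw [hn.neg_pow, LinearMap.neg_apply, inner_neg_right]
    simp [hn, mul_neg, neg_div]

theorem IsAnalyticSymm.star_mul_expI (hA : IsAnalyticSymm A) : star (expI A) * expI A = 1 := by
  refine ContinuousLinearMap.ext fun x => ext_inner_left ℂ fun y => ?_
  rw [mul_apply_eq_comp, ContinuousLinearMap.star_eq_adjoint,
    ContinuousLinearMap.adjoint_inner_right, hA.inner_expI_expI]
  rfl

/-- Surjectivity comes from the isometry property for `-A`, whose exponential is the adjoint. -/
theorem IsAnalyticSymm.expI_mul_star (hA : IsAnalyticSymm A) : expI A * star (expI A) = 1 := by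
  have h := hA.neg.star_mul_expI
  rwa [← hA.adjoint_expI, star_star] at h

/-- The scalar commutes with `A`, so by the binomial theorem the series is the Cauchy product of
`exp (i c)` with the series of `expI A`. -/
theorem IsAnalyticSymm.summable_add_smul (hA : IsAnalyticSymm A) (c : ℝ) (X : FockCore E) :
    HasSum (fun n : ℕ => (Complex.I ^ n / (Nat.factorial n : ℂ)) •
      ((((A + (c : ℂ) • 1) ^ n) X : FockCore E) : FockSpace E))
      ((Complex.exp (Complex.I * c) • expI A) (X : FockSpace E)) := by
  have h := hasSum_antidiagonal_of_norm_le
    (b := fun m n => ((Complex.I * c) ^ m / (m.factorial : ℂ)) •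
      ((Complex.I ^ n / (n.factorial : ℂ)) • (((A ^ n) X : FockCore E) : FockSpace E)))
    (u := fun m => |c| ^ m / m.factorial) (Real.summable_pow_div_factorial |c|) (hA.summable X)
    (fun m => by positivity) (fun m => by positivity)
    (fun m n => by
      rw [norm_smul, norm_expTerm]
      simp)
  have h2 : (∑' m, ∑' n, ((Complex.I * c) ^ m / (m.factorial : ℂ)) •
      ((Complex.I ^ n / (n.factorial : ℂ)) • (((A ^ n) X : FockCore E) : FockSpace E))) =
      (Complex.exp (Complex.I * c) • expI A) (X : FockSpace E) := by
    simp_rw [tsum_const_smul'', (hA.hasSum_expI X).tsum_eq]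
    have h3 := NormedSpace.expSeries_div_hasSum_exp (Complex.I * c : ℂ)
    rw [← Complex.exp_eq_exp_ℂ] at h3
    exact (h3.smul_const _).tsum_eq
  rw [h2] at h
  convert! h using 2 with N
  have hcomm : Commute ((c : ℂ) • (1 : Module.End ℂ (FockCore E))) A :=
    (Commute.one_left A).smul_left _
  rw [add_comm A, hcomm.add_pow', LinearMap.sum_apply]
  have hsum : ∀ (s : Finset (ℕ × ℕ)) (f : ℕ × ℕ → FockCore E),
      (((∑ p ∈ s, f p : FockCore E)) : FockSpace E) = ∑ p ∈ s, ((f p : FockCore E) : FockSpace E) :=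
    fun s f => map_sum (UniformSpace.Completion.toComplL : FockCore E →L[ℂ] FockSpace E) f s
  rw [hsum, Finset.smul_sum]
  refine Finset.sum_congr rfl fun p hp => ?_
  rw [Finset.HasAntidiagonal.mem_antidiagonal] at hp
  subst hp
  rw [LinearMap.smul_apply, smul_pow, one_pow, smul_mul_assoc, one_mul, LinearMap.smul_apply,
    ← Nat.cast_smul_eq_nsmul ℂ, UniformSpace.Completion.coe_smul, UniformSpace.Completion.coe_smul,
    smul_smul, smul_smul, smul_smul, Nat.cast_add_choose]
  congr 1
  have h1 : ((p.1 + p.2).factorial : ℂ) ≠ 0 := by exact_mod_cast Nat.factorial_ne_zero _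
  have h2 : (p.1.factorial : ℂ) ≠ 0 := by exact_mod_cast Nat.factorial_ne_zero _
  have h3 : (p.2.factorial : ℂ) ≠ 0 := by exact_mod_cast Nat.factorial_ne_zero _
  field_simp
  ring

theorem IsAnalyticSymm.expI_add_smul (hA : IsAnalyticSymm A) (c : ℝ) :
    expI (A + (c : ℂ) • 1) = Complex.exp (Complex.I * c) • expI A :=
  expI_eq_of_hasSum (hA.summable_add_smul c)

end Exponential

/-! ### Weyl operators: unitarity, Weyl relation, strong continuity -/

section Weyl

variable {E : Type*} [NormedAddCommGroup E] [InnerProductSpace ℂ E]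

theorem isAnalyticSymm_fieldOp (h : E) : IsAnalyticSymm (fieldOp h) where
  symm := inner_fieldOp_left h
  summable X := by
    obtain ⟨N, M, hX⟩ := FockBound.exists X
    refine Summable.of_nonneg_of_le (fun n => by positivity) (fun n => ?_)
      ((summable_fockWeight ‖h‖ N).mul_right M)
    rw [div_mul_eq_mul_div, mul_assoc, mul_assoc]
    have := norm_fieldOp_pow_le h hX n
    rw [mul_assoc] at this
    gcongr

theorem star_mul_weyl (h : E) : star (weyl h) * weyl h = 1 :=
  (isAnalyticSymm_fieldOp h).star_mul_expI

theorem weyl_mul_star (h : E) : weyl h * star (weyl h) = 1 :=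
  (isAnalyticSymm_fieldOp h).expI_mul_star

theorem norm_weyl_apply (h : E) (x : FockSpace E) : ‖weyl h x‖ = ‖x‖ := by
  have h1 := (isAnalyticSymm_fieldOp h).inner_expI_expI x x
  rw [inner_self_eq_norm_sq_to_K, inner_self_eq_norm_sq_to_K] at h1
  have h' : ‖weyl h x‖ ^ 2 = ‖x‖ ^ 2 := by exact_mod_cast h1
  exact (sq_eq_sq₀ (norm_nonneg _) (norm_nonneg _)).mp h'

/-- Since the commutator is known only in matrix elements, the induction moves one factor `A(g)`
over to the left vector; hence `X` is generalised. -/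
theorem inner_fieldOp_pow_fieldOp (g h : E) (m : ℕ) (X Y : FockCore E) :
    inner ℂ X ((fieldOp g ^ (m + 1)) (fieldOp h Y)) =
      inner ℂ X (fieldOp h ((fieldOp g ^ (m + 1)) Y)) +
        (m + 1) * (Complex.I * ((inner ℂ g h : ℂ).im : ℂ)) * inner ℂ X ((fieldOp g ^ m) Y) := by
  induction m generalizing X with
  | zero => simpa using inner_fieldOp_comm g h X Y
  | succ m ih =>
    rw [pow_succ' (fieldOp g) (m + 1), Module.End.mul_apply, ← inner_fieldOp_left, ih,
      inner_fieldOp_left, inner_fieldOp_comm, inner_fieldOp_left, Module.End.mul_apply,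
      ← Module.End.mul_apply (fieldOp g) (fieldOp g ^ m), ← pow_succ' (fieldOp g)]
    push_cast
    ring

/-- This is `W(g) (A(h) + s) = A(h) W(g)` with `s = Im (g, h)`, in matrix elements because `A(h)` is
unbounded and lives on the core only. -/
theorem inner_weyl_fieldOp (g h : E) (X Y : FockCore E) :
    (inner ℂ (X : FockSpace E) (weyl g
      (((fieldOp h + (((inner ℂ g h : ℂ).im : ℝ) : ℂ) • 1) Y : FockCore E) : FockSpace E)) : ℂ) =
      inner ℂ ((fieldOp h X : FockCore E) : FockSpace E) (weyl g Y) := by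
  have hg := isAnalyticSymm_fieldOp g
  have h1 := hg.inner_expI_right (fieldOp h Y) X
  have h2 := hg.inner_expI_right Y (fieldOp h X : FockCore E)
  have h3 := hg.inner_expI_right Y X
  simp only [UniformSpace.Completion.inner_coe] at h1 h2 h3
  set s : ℂ := (((inner ℂ g h : ℂ).im : ℝ) : ℂ) with hs
  have h4 : HasSum (fun n : ℕ => (Complex.I ^ n / (n.factorial : ℂ)) *
      (inner ℂ X ((fieldOp g ^ n) (fieldOp h Y)) -
        inner ℂ (fieldOp h X) ((fieldOp g ^ n) Y))) (-s * inner ℂ (X : FockSpace E) (weyl g Y)) := by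
    -- The term `n = 0` vanishes by symmetry of `A(h)`. In the term `n + 1` the factor from the
    -- commutator cancels against the factorial, leaving `i · i · s = -s` times the `n`-th term of
    -- `W(g)`.
    rw [← hasSum_nat_add_iff' 1]
    simp only [Finset.range_one, Finset.sum_singleton, pow_zero, Module.End.one_apply,
      inner_fieldOp_left, sub_self, mul_zero, sub_zero]
    convert! h3.mul_left (-s) using 2 with n
    rw [inner_fieldOp_pow_fieldOp, Nat.factorial_succ, pow_succ]
    push_cast
    have h5 : (n.factorial : ℂ) ≠ 0 := by exact_mod_cast Nat.factorial_ne_zero _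
    have h6 : (n + 1 : ℂ) ≠ 0 := by exact_mod_cast Nat.succ_ne_zero n
    rw [add_sub_cancel_left, hs]
    generalize (((inner ℂ g h : ℂ).im : ℝ) : ℂ) = s
    generalize (inner ℂ X ((fieldOp g ^ n) Y) : ℂ) = z
    generalize Complex.I ^ n = w
    field_simp
    linear_combination (w * s * z) * Complex.I_sq
  have h5 := (h1.sub h2).unique (by simpa only [mul_sub] using h4)
  simp only [LinearMap.add_apply, LinearMap.smul_apply, Module.End.one_apply,
    UniformSpace.Completion.coe_add, UniformSpace.Completion.coe_smul, map_add, map_smul,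
    inner_add_right, inner_smul_right]
  change inner ℂ (X : FockSpace E) (weyl g ((fieldOp h Y : FockCore E) : FockSpace E)) -
    inner ℂ ((fieldOp h X : FockCore E) : FockSpace E) (weyl g Y) = _ at h5
  linear_combination h5

/-- The Weyl relation. -/
theorem weyl_mul_weyl (g h : E) :
    weyl h * weyl g = Complex.exp (Complex.I * ((inner ℂ g h : ℂ).im : ℝ)) • (weyl g * weyl h) := by
  have hh := isAnalyticSymm_fieldOp h
  set s : ℝ := (inner ℂ g h : ℂ).im with hs
  -- Iterating the intertwining relation carries every power of `A(h) + s` through `W(g)`. Summing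
  -- the exponential series then gives `W(g) e^{is} W(h) = W(h) W(g)`.
  have hpow : ∀ (n : ℕ) (X Y : FockCore E), (inner ℂ (X : FockSpace E) (weyl g
      ((((fieldOp h + (s : ℂ) • 1) ^ n) Y : FockCore E) : FockSpace E)) : ℂ) =
      inner ℂ (((fieldOp h ^ n) X : FockCore E) : FockSpace E) (weyl g Y) := by
    intro n
    induction n with
    | zero => intro X Y; simp
    | succ n ih =>
      intro X Y
      rw [pow_succ', Module.End.mul_apply, inner_weyl_fieldOp, ih, ← Module.End.mul_apply,
        ← pow_succ]
  refine FockSpace.ext_core fun Y => FockSpace.ext_inner_core fun X => ?_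
  have h1 := (innerSL ℂ (X : FockSpace E)).hasSum ((weyl g).hasSum (hh.summable_add_smul s Y))
  simp only [map_smul, innerSL_apply_apply, hpow, smul_eq_mul] at h1
  have h2 := (hh.neg.inner_expI_right X (weyl g Y)).mapL (Complex.conjCLE : ℂ →L[ℝ] ℂ)
  rw [← hh.adjoint_expI, ContinuousLinearMap.star_eq_adjoint,
    ContinuousLinearMap.adjoint_inner_right] at h2
  simp only [ContinuousLinearEquiv.coe_coe, Complex.conjCLE_apply, map_mul, inner_conj_symm] at h2
  rw [mul_apply_eq_comp, smul_apply, mul_apply_eq_comp,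
    inner_smul_right]
  have h3 : (inner ℂ (X : FockSpace E) (weyl g ((Complex.exp (Complex.I * s) • expI (fieldOp h))
      (Y : FockSpace E))) : ℂ) = Complex.exp (Complex.I * s) *
      inner ℂ (X : FockSpace E) (weyl g (weyl h Y)) := by
    rw [smul_apply, map_smul, inner_smul_right]; rfl
  rw [← h3]
  refine HasSum.unique ?_ h1
  convert! h2 using 2 with n
  rw [neg_pow (fieldOp h)]
  have h4 : ((((-1) ^ n * fieldOp h ^ n) X : FockCore E) : FockSpace E) =
      ((-1 : ℂ) ^ n) • (((fieldOp h ^ n) X : FockCore E) : FockSpace E) := by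
    rw [← UniformSpace.Completion.coe_smul]
    congr 1
    rcases Nat.even_or_odd n with hn | hn <;> simp [hn]
  rw [h4, inner_smul_left]
  simp only [map_div₀, map_pow, Complex.conj_I, Complex.conj_natCast, map_neg, map_one]
  rw [neg_pow Complex.I]
  rw [mul_div_assoc, mul_comm ((-1 : ℂ) ^ n), mul_assoc, ← mul_assoc ((-1 : ℂ) ^ n), ← mul_pow]
  norm_num

theorem weyl_conj (g h : E) :
    weyl g * weyl h * star (weyl g) =
      Complex.exp (-Complex.I * ((inner ℂ g h : ℂ).im : ℝ)) • weyl h := by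
  have h1 := weyl_mul_weyl g h
  have h2 : weyl g * weyl h =
      Complex.exp (-Complex.I * ((inner ℂ g h : ℂ).im : ℝ)) • (weyl h * weyl g) := by
    rw [h1, smul_smul, ← Complex.exp_add]
    simp
  rw [h2, smul_mul_assoc, mul_assoc, weyl_mul_star, mul_one]

/-- Without the term `n = 0`, each term of the series contains at least one factor `‖h‖`; for `‖h‖ ≤
1` the rest is bounded by a constant that depends on `X` only. -/
theorem norm_weyl_sub_le (X : FockCore E) : ∃ K : ℝ, ∀ h : E, ‖h‖ ≤ 1 →
    ‖weyl h (X : FockSpace E) - X‖ ≤ ‖h‖ * K := by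
  obtain ⟨N, M, hX⟩ := FockBound.exists X
  have hS := (summable_fockWeight 1 N).mul_right M
  refine ⟨∑' n : ℕ, 1 ^ (n + 1) * (2 ^ (n + 1) * ∏ j ∈ Finset.range (n + 1),
    Real.sqrt (N + j + 1)) / (n + 1).factorial * M, fun h hh => ?_⟩
  have h1 := (isAnalyticSymm_fieldOp h).hasSum_expI X
  have hS' := (summable_nat_add_iff 1).mpr hS
  rw [← hasSum_nat_add_iff' 1] at h1
  refine (h1.norm_le_of_bounded (hS'.hasSum.mul_left ‖h‖) fun n => ?_).trans_eq' ?_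
  swap
  · simp [weyl]
  · rw [norm_expTerm]
    have h2 := norm_fieldOp_pow_le h hX (n + 1)
    have h3 : ‖h‖ ^ (n + 1) ≤ ‖h‖ := by
      rw [pow_succ]
      exact mul_le_of_le_one_left (norm_nonneg _) (pow_le_one₀ (norm_nonneg _) hh)
    have hP : 0 ≤ ∏ j ∈ Finset.range (n + 1), Real.sqrt (N + j + 1) :=
      Finset.prod_nonneg fun _ _ => Real.sqrt_nonneg _
    have hM : 0 ≤ M := (norm_nonneg _).trans hX.norm_le
    rw [one_pow, one_mul, div_mul_eq_mul_div, mul_div_assoc']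
    gcongr
    exact h2.trans (mul_le_mul_of_nonneg_right h3 (by positivity))

/-- The Weyl operators depend strongly continuously on the test function. -/
theorem tendsto_weyl_apply {ι : Type*} {l : Filter ι} {h : ι → E} (hh : Tendsto h l (𝓝 0))
    (x : FockSpace E) : Tendsto (fun i => weyl (h i) x) l (𝓝 x) := by
  rw [Metric.tendsto_nhds]
  intro ε hε
  obtain ⟨X, hX⟩ : ∃ X : FockCore E, dist x (X : FockSpace E) < ε / 3 := by
    obtain ⟨_, ⟨X, rfl⟩, hX⟩ := Metric.mem_closure_iff.mp
      (UniformSpace.Completion.denseRange_coe x) (ε / 3) (by positivity)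
    exact ⟨X, hX⟩
  obtain ⟨K, hK⟩ := norm_weyl_sub_le (E := E) X
  have h1 : Tendsto (fun i => ‖h i‖) l (𝓝 0) := by simpa using hh.norm
  have h2 : Tendsto (fun i => ‖h i‖ * K) l (𝓝 0) := by simpa using h1.mul_const K
  filter_upwards [h1.eventually (gt_mem_nhds zero_lt_one),
    h2.eventually (gt_mem_nhds (by positivity : 0 < ε / 3))] with i hi1 hi2
  have e1 := hK (h i) hi1.le
  rw [dist_eq_norm] at hX ⊢
  -- Unitarity makes the error of approximating `x` by `X` uniform in `i`.
  have e2 : weyl (h i) x - x = weyl (h i) (x - X) + (weyl (h i) X - X) - (x - X) := by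
    rw [map_sub]; abel
  rw [e2]
  refine (norm_sub_le _ _).trans_lt ((add_le_add_left (norm_add_le _ _) _).trans_lt ?_)
  rw [norm_weyl_apply]
  linarith

end Weyl

/-! ### Pointwise norm limits of inner automorphisms -/

section ConjLimit

variable {A : Type*} [CStarAlgebra A] {U : ℕ → A}

theorem norm_le_one_of_star_mul {u : A} (h : star u * u = 1) : ‖u‖ ≤ 1 := by
  have h1 : ‖u‖ * ‖u‖ = ‖(1 : A)‖ := by rw [← CStarRing.norm_star_mul_self, h]
  rcases subsingleton_or_nontrivial A with h2 | h2
  · rw [Subsingleton.elim u 0, norm_zero]; exact zero_le_one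
  · rw [CStarRing.norm_one] at h1
    nlinarith [norm_nonneg u]

theorem norm_conj_le {u : A} (h : star u * u = 1) (b : A) : ‖u * b * star u‖ ≤ ‖b‖ := by
  have h1 := norm_le_one_of_star_mul h
  calc ‖u * b * star u‖ ≤ ‖u‖ * ‖b‖ * ‖star u‖ :=
        (norm_mul_le _ _).trans (mul_le_mul_of_nonneg_right (norm_mul_le _ _) (norm_nonneg _))
    _ ≤ 1 * ‖b‖ * 1 := by rw [norm_star]; gcongr
    _ = ‖b‖ := by ring

/-- Conjugation by a unitary respects sums, products and adjoints, and these are norm continuous, so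
convergence on the generators suffices. Since the generators only acquire scalars, the limit stays
in the algebra. -/
theorem exists_conj_limit_adjoin (hU : ∀ n, star (U n) * U n = 1) (hU' : ∀ n, U n * star (U n) = 1)
    {G : Set A} (hG : ∀ w ∈ G, ∃ c : ℂ, Tendsto (fun n => U n * w * star (U n)) atTop (𝓝 (c • w)))
    {B : A} (hB : B ∈ StarAlgebra.adjoin ℂ G) :
    ∃ B' ∈ StarAlgebra.adjoin ℂ G, Tendsto (fun n => U n * B * star (U n)) atTop (𝓝 B') := by
  induction hB using StarAlgebra.adjoin_induction with
  | mem w hw =>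
    obtain ⟨c, hc⟩ := hG w hw
    exact ⟨c • w, SMulMemClass.smul_mem c (StarAlgebra.subset_adjoin ℂ G hw), hc⟩
  | algebraMap r =>
    refine ⟨algebraMap ℂ A r, algebraMap_mem _ r, tendsto_const_nhds.congr fun n => ?_⟩
    rw [← Algebra.commutes, mul_assoc, hU', mul_one]
  | add x y _ _ hx hy =>
    obtain ⟨x', hx', h1⟩ := hx
    obtain ⟨y', hy', h2⟩ := hy
    refine ⟨x' + y', add_mem hx' hy', (h1.add h2).congr fun n => ?_⟩
    rw [mul_add, add_mul]
  | mul x y _ _ hx hy =>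
    obtain ⟨x', hx', h1⟩ := hx
    obtain ⟨y', hy', h2⟩ := hy
    refine ⟨x' * y', mul_mem hx' hy', (h1.mul h2).congr fun n => ?_⟩
    calc U n * x * star (U n) * (U n * y * star (U n)) =
          U n * x * (star (U n) * U n) * y * star (U n) := by simp only [mul_assoc]
      _ = _ := by rw [hU, mul_one]; simp only [mul_assoc]
  | star x _ hx =>
    obtain ⟨x', hx', h1⟩ := hx
    refine ⟨star x', star_mem hx', h1.star.congr fun n => ?_⟩
    simp [mul_assoc]

/-- Conjugations are contractions uniformly in `n`, so convergence passes to norm limits. -/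
theorem exists_conj_limit_closure (hU : ∀ n, star (U n) * U n = 1) {T : StarSubalgebra ℂ A}
    (hT : ∀ B ∈ T, ∃ B' ∈ T, Tendsto (fun n => U n * B * star (U n)) atTop (𝓝 B'))
    {B : A} (hB : B ∈ T.topologicalClosure) :
    ∃ B' ∈ T.topologicalClosure, Tendsto (fun n => U n * B * star (U n)) atTop (𝓝 B') := by
  obtain ⟨b, hbT, hb⟩ := mem_closure_iff_seq_limit.mp (show B ∈ closure (T : Set A) from hB)
  choose b' hb'T hb' using fun k => hT (b k) (hbT k)
  have hdist : ∀ j k, dist (b' j) (b' k) ≤ dist (b j) (b k) := by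
    intro j k
    rw [dist_eq_norm, dist_eq_norm]
    refine le_of_tendsto ((hb' j).sub (hb' k)).norm (Eventually.of_forall fun n => ?_)
    rw [← sub_mul, ← mul_sub]
    exact norm_conj_le (hU n) _
  have hC : CauchySeq b' := by
    rw [Metric.cauchySeq_iff']
    intro ε hε
    obtain ⟨N, hN⟩ := Metric.cauchySeq_iff'.mp hb.cauchySeq ε hε
    exact ⟨N, fun n hn => (hdist _ _).trans_lt (hN n hn)⟩
  obtain ⟨B', hB'⟩ := cauchySeq_tendsto_of_complete hC
  refine ⟨B', mem_closure_of_tendsto hB' (Eventually.of_forall hb'T), ?_⟩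
  rw [Metric.tendsto_atTop]
  intro ε hε
  obtain ⟨k, hk1, hk2⟩ := ((Metric.tendsto_nhds.mp hb (ε / 3) (by positivity)).and
    (Metric.tendsto_nhds.mp hB' (ε / 3) (by positivity))).exists
  obtain ⟨N, hN⟩ := Metric.tendsto_atTop.mp (hb' k) (ε / 3) (by positivity)
  refine ⟨N, fun n hn => ?_⟩
  have h1 : dist (U n * B * star (U n)) (U n * b k * star (U n)) < ε / 3 := by
    rw [dist_eq_norm, ← sub_mul, ← mul_sub]
    refine (norm_conj_le (hU n) _).trans_lt ?_
    rwa [← dist_eq_norm, dist_comm]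
  have h2 := hN n hn
  have h3 := dist_triangle4 (U n * B * star (U n)) (U n * b k * star (U n)) (b' k) B'
  linarith

/-- The two differences are conjugates of each other. This makes the limit of the inverse
conjugations an inverse of the limit. -/
theorem tendsto_star_conj (hU : ∀ n, star (U n) * U n = 1) {B B' : A}
    (h : Tendsto (fun n => U n * B * star (U n)) atTop (𝓝 B')) :
    Tendsto (fun n => star (U n) * B' * U n) atTop (𝓝 B) := by
  rw [tendsto_iff_norm_sub_tendsto_zero] at h ⊢
  refine squeeze_zero (fun n => norm_nonneg _) (fun n => ?_) h
  have h1 : star (U n) * B' * U n - B = -(star (U n) * (U n * B * star (U n) - B') * U n) := by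
    have : star (U n) * (U n * B * star (U n)) * U n = B := by
      calc star (U n) * (U n * B * star (U n)) * U n =
            (star (U n) * U n) * B * (star (U n) * U n) := by simp only [mul_assoc]
        _ = B := by rw [hU, one_mul, mul_one]
    rw [mul_sub, sub_mul, this, neg_sub]
  have h2 := norm_le_one_of_star_mul (hU n)
  rw [h1, norm_neg]
  calc _ ≤ ‖star (U n)‖ * ‖U n * B * star (U n) - B'‖ * ‖U n‖ :=
        (norm_mul_le _ _).trans (mul_le_mul_of_nonneg_right (norm_mul_le _ _) (norm_nonneg _))
    _ ≤ 1 * ‖U n * B * star (U n) - B'‖ * 1 := by rw [norm_star]; gcongr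
    _ = _ := by ring

/-- If the conjugations with a sequence of unitaries converge pointwise on a star subalgebra, then
the limit is a star homomorphism. -/
theorem exists_starAlgHom_conj_limit (hU : ∀ n, star (U n) * U n = 1)
    (hU' : ∀ n, U n * star (U n) = 1) {T : StarSubalgebra ℂ A}
    (hT : ∀ B ∈ T, ∃ B' ∈ T, Tendsto (fun n => U n * B * star (U n)) atTop (𝓝 B')) :
    ∃ φ : T →⋆ₐ[ℂ] T, ∀ B : T,
      Tendsto (fun n => U n * (B : A) * star (U n)) atTop (𝓝 (φ B : A)) := by
  choose f hfT hf using hT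
  have key : ∀ (B : T) (C : A),
      Tendsto (fun n => U n * (B : A) * star (U n)) atTop (𝓝 C) → f B B.2 = C :=
    fun B C h => tendsto_nhds_unique (hf B B.2) h
  have halg : ∀ r : ℂ, f (algebraMap ℂ T r : T) (algebraMap ℂ T r).2 = algebraMap ℂ A r := by
    intro r
    refine key _ _ (tendsto_const_nhds.congr fun n => ?_)
    change _ = U n * algebraMap ℂ A r * star (U n)
    rw [← Algebra.commutes, mul_assoc, hU', mul_one]
  refine ⟨{
    toFun := fun B => ⟨f B B.2, hfT B B.2⟩
    map_one' := ?_
    map_mul' := ?_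
    map_zero' := ?_
    map_add' := ?_
    commutes' := ?_
    map_star' := ?_ }, fun B => hf B B.2⟩
  · exact Subtype.ext (by simpa using halg 1)
  · intro B C
    refine Subtype.ext (key _ _ (((hf B B.2).mul (hf C C.2)).congr fun n => ?_))
    calc U n * (B : A) * star (U n) * (U n * (C : A) * star (U n)) =
          U n * B * (star (U n) * U n) * C * star (U n) := by simp only [mul_assoc]
      _ = _ := by rw [hU, mul_one, MulMemClass.coe_mul]; simp only [mul_assoc]
  · exact Subtype.ext (by simpa using halg 0)
  · intro B C
    refine Subtype.ext (key _ _ (((hf B B.2).add (hf C C.2)).congr fun n => ?_))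
    rw [← add_mul, ← mul_add, AddMemClass.coe_add]
  · intro r
    exact Subtype.ext (halg r)
  · intro B
    refine Subtype.ext (key _ _ ((hf B B.2).star.congr fun n => ?_))
    simp [mul_assoc]

theorem exists_starAlgEquiv_conj_limit (hU : ∀ n, star (U n) * U n = 1)
    (hU' : ∀ n, U n * star (U n) = 1) {T : StarSubalgebra ℂ A}
    (hT : ∀ B ∈ T, ∃ B' ∈ T, Tendsto (fun n => U n * B * star (U n)) atTop (𝓝 B'))
    (hT' : ∀ B ∈ T, ∃ B' ∈ T, Tendsto (fun n => star (U n) * B * U n) atTop (𝓝 B')) :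
    ∃ φ : T ≃⋆ₐ[ℂ] T, ∀ B : T,
      Tendsto (fun n => U n * (B : A) * star (U n)) atTop (𝓝 (φ B : A)) := by
  obtain ⟨φ, hφ⟩ := exists_starAlgHom_conj_limit hU hU' hT
  obtain ⟨χ, hχ⟩ := exists_starAlgHom_conj_limit (U := fun n => star (U n)) (T := T)
    (by simpa using hU') (by simpa using hU) (by simpa using hT')
  simp only [star_star] at hχ
  refine ⟨StarAlgEquiv.ofStarAlgHom φ χ ?_ ?_, fun B => hφ B⟩
  · refine StarAlgHom.ext fun B => Subtype.ext ?_
    exact tendsto_nhds_unique (hχ (φ B)) (tendsto_star_conj hU (hφ B))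
  · refine StarAlgHom.ext fun B => Subtype.ext ?_
    have := tendsto_star_conj (U := fun n => star (U n)) (B := (B : A)) (B' := (χ B : A))
      (by simpa using hU') (by simpa using hχ B)
    simp only [star_star] at this
    exact tendsto_nhds_unique (hφ (χ B)) this

end ConjLimit

/-! ### Automorphisms multiplying Weyl operators by phases, and the states they produce -/

section PhaseAut

variable {E : Type*} [NormedAddCommGroup E] [InnerProductSpace ℂ E]

theorem weyl_mem_weylAlgebra {S : Set E} {h : E} (hh : h ∈ S) : weyl h ∈ weylAlgebra S :=
  StarSubalgebra.le_topologicalClosure _ (StarAlgebra.subset_adjoin ℂ _ ⟨h, hh, rfl⟩)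

/-- The Weyl operator `W(h)`, `h ∈ S`, as an element of the Weyl algebra. -/
def weylGen {S : Set E} {h : E} (hh : h ∈ S) : weylAlgebra S := ⟨weyl h, weyl_mem_weylAlgebra hh⟩

/-- The automorphism multiplies each `W(h)` by the phase `e^{iℓ(h)}`. -/
def IsPhaseAut {S : Set E} (ℓ : E → ℝ) (α : weylAlgebra S ≃⋆ₐ[ℂ] weylAlgebra S) : Prop :=
  ∀ h (hh : h ∈ S), α (weylGen hh) = Complex.exp (Complex.I * ℓ h) • weylGen hh

variable {S : Set E} {ℓ : E → ℝ}

theorem norm_weylAlgebra_equiv (α : weylAlgebra S ≃⋆ₐ[ℂ] weylAlgebra S) (B : weylAlgebra S) :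
    ‖α B‖ = ‖B‖ := by
  have : IsClosed (weylAlgebra S : Set (FockSpace E →L[ℂ] FockSpace E)) :=
    StarSubalgebra.isClosed_topologicalClosure _
  -- Closedness makes the Weyl algebra a `C*`-algebra, where star isomorphisms are automatically
  -- isometric.
  let _ : CStarAlgebra (weylAlgebra S) := StarSubalgebra.cstarAlgebra (weylAlgebra S)
  exact StarAlgEquiv.norm_map α B

theorem continuous_weylAlgebra_equiv (α : weylAlgebra S ≃⋆ₐ[ℂ] weylAlgebra S) : Continuous α :=
  (AddMonoidHomClass.isometry_of_norm α (norm_weylAlgebra_equiv α)).continuous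

theorem IsPhaseAut.unique {α β : weylAlgebra S ≃⋆ₐ[ℂ] weylAlgebra S} (hα : IsPhaseAut ℓ α)
    (hβ : IsPhaseAut ℓ β) : α = β := by
  refine StarAlgHomClass.ext_topologicalClosure (continuous_weylAlgebra_equiv α)
    (continuous_weylAlgebra_equiv β) fun x => ?_
  have : ((α : weylAlgebra S →⋆ₐ[ℂ] weylAlgebra S).comp
      (StarSubalgebra.inclusion (StarSubalgebra.le_topologicalClosure
        (StarAlgebra.adjoin ℂ (weyl '' S))))) =
      ((β : weylAlgebra S →⋆ₐ[ℂ] weylAlgebra S).comp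
      (StarSubalgebra.inclusion (StarSubalgebra.le_topologicalClosure
        (StarAlgebra.adjoin ℂ (weyl '' S))))) := by
    refine StarAlgHom.ext_adjoin ?_
    rintro ⟨_, hy⟩ ⟨h, hh, rfl⟩
    exact (hα h hh).trans (hβ h hh).symm
  exact DFunLike.congr_fun this x

/-- Only the pairings of `g n` with `S` have to converge, not `g n` itself. This is what allows
automorphisms that no Weyl operator implements. -/
theorem exists_isPhaseAut {g : ℕ → E}
    (hg : ∀ h ∈ S, Tendsto (fun n => -(inner ℂ (g n) h : ℂ).im) atTop (𝓝 (ℓ h))) :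
    ∃ α : weylAlgebra S ≃⋆ₐ[ℂ] weylAlgebra S, IsPhaseAut ℓ α ∧ ∀ B : weylAlgebra S,
      Tendsto (fun n => weyl (g n) * (B : FockSpace E →L[ℂ] FockSpace E) * star (weyl (g n)))
        atTop (𝓝 (α B : FockSpace E →L[ℂ] FockSpace E)) := by
  have hU : ∀ n, star (weyl (g n)) * weyl (g n) = 1 := fun n => star_mul_weyl _
  have hU' : ∀ n, weyl (g n) * star (weyl (g n)) = 1 := fun n => weyl_mul_star _
  have hlim : ∀ h ∈ S, Tendsto (fun n => weyl (g n) * weyl h * star (weyl (g n))) atTop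
      (𝓝 (Complex.exp (Complex.I * ℓ h) • weyl h)) := by
    intro h hh
    simp only [weyl_conj]
    refine Tendsto.smul_const (((Complex.continuous_exp.tendsto _).comp
      (((Complex.continuous_ofReal.tendsto _).comp (hg h hh)).const_mul Complex.I)).congr
        fun n => ?_) _
    simp
  have hlim' : ∀ h ∈ S, Tendsto (fun n => star (weyl (g n)) * weyl h * weyl (g n)) atTop
      (𝓝 (Complex.exp (-(Complex.I * ℓ h)) • weyl h)) := by
    intro h hh
    have h1 := (tendsto_star_conj hU (hlim h hh)).const_smul (Complex.exp (-(Complex.I * ℓ h)))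
    refine h1.congr fun n => ?_
    rw [mul_smul_comm, smul_mul_assoc, smul_smul, ← Complex.exp_add]
    simp
  have hT : ∀ B ∈ weylAlgebra S, ∃ B' ∈ weylAlgebra S,
      Tendsto (fun n => weyl (g n) * B * star (weyl (g n))) atTop (𝓝 B') := fun B hB =>
    exists_conj_limit_closure hU (fun B hB => exists_conj_limit_adjoin hU hU'
      (by rintro _ ⟨h, hh, rfl⟩; exact ⟨_, hlim h hh⟩) hB) hB
  have hT' : ∀ B ∈ weylAlgebra S, ∃ B' ∈ weylAlgebra S,
      Tendsto (fun n => star (weyl (g n)) * B * weyl (g n)) atTop (𝓝 B') := fun B hB => by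
    have := exists_conj_limit_closure (U := fun n => star (weyl (g n))) (by simpa using hU')
      (fun B hB => exists_conj_limit_adjoin (U := fun n => star (weyl (g n))) (by simpa using hU')
        (by simpa using hU)
        (by rintro _ ⟨h, hh, rfl⟩; exact ⟨_, by simpa using hlim' h hh⟩) hB) hB
    simp only [star_star] at this
    exact this
  obtain ⟨α, hα⟩ := exists_starAlgEquiv_conj_limit hU hU' hT hT'
  exact ⟨α, fun h hh => Subtype.ext (tendsto_nhds_unique (hα (weylGen hh)) (hlim h hh)), hα⟩

/-- Uniqueness identifies `α` with the limit along the constant sequence `g`. -/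
theorem IsPhaseAut.eq_conj {α : weylAlgebra S ≃⋆ₐ[ℂ] weylAlgebra S} (hα : IsPhaseAut ℓ α) {g : E}
    (hg : ∀ h ∈ S, -(inner ℂ g h : ℂ).im = ℓ h) (B : weylAlgebra S) :
    (α B : FockSpace E →L[ℂ] FockSpace E) =
      weyl g * (B : FockSpace E →L[ℂ] FockSpace E) * star (weyl g) := by
  obtain ⟨β, hβ, hlim⟩ := exists_isPhaseAut (S := S) (ℓ := ℓ) (g := fun _ => g)
    fun h hh => by rw [hg h hh]; exact tendsto_const_nhds
  rw [hα.unique hβ]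
  exact tendsto_nhds_unique (hlim B) tendsto_const_nhds

theorem norm_fockVacuum : ‖(fockVacuum : FockSpace E)‖ = 1 := by
  have h : (inner ℂ (fockVacuum : FockSpace E) fockVacuum : ℂ) = 1 := by
    rw [fockVacuum, UniformSpace.Completion.inner_coe, inner_prodVec]
    simp
  rw [inner_self_eq_norm_sq_to_K] at h
  have h' : ‖(fockVacuum : FockSpace E)‖ ^ 2 = 1 :=
    Complex.ofReal_injective (by rw [Complex.ofReal_pow, Complex.ofReal_one]; exact h)
  exact (pow_eq_one_iff_of_nonneg (norm_nonneg _) two_ne_zero).mp h'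

/-- The functional `B ↦ (Ω₀, α(B) Ω₀)`. -/
def vacuumComp (α : weylAlgebra S ≃⋆ₐ[ℂ] weylAlgebra S) : weylAlgebra S →L[ℂ] ℂ :=
  LinearMap.mkContinuous
    { toFun := fun B => inner ℂ (fockVacuum : FockSpace E)
        ((α B : FockSpace E →L[ℂ] FockSpace E) fockVacuum)
      map_add' := fun B C => by simp [inner_add_right]
      map_smul' := fun c B => by
        rw [map_smul, RingHom.id_apply, smul_eq_mul]
        exact inner_smul_right (fockVacuum : FockSpace E) _ c } 1
    fun B => by
      change ‖(inner ℂ (fockVacuum : FockSpace E)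
        ((α B : FockSpace E →L[ℂ] FockSpace E) fockVacuum) : ℂ)‖ ≤ _
      refine (norm_inner_le_norm _ _).trans ?_
      refine (mul_le_mul_of_nonneg_left (ContinuousLinearMap.le_opNorm _ _)
        (norm_nonneg _)).trans ?_
      rw [norm_fockVacuum, one_mul, mul_one, one_mul]
      exact (norm_weylAlgebra_equiv α B).le

theorem isState_of_forall_eq {α : weylAlgebra S ≃⋆ₐ[ℂ] weylAlgebra S} {ω : weylAlgebra S →L[ℂ] ℂ}
    (hω : ∀ B : weylAlgebra S, ω B = inner ℂ (fockVacuum : FockSpace E)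
      ((α B : FockSpace E →L[ℂ] FockSpace E) fockVacuum)) : IsState ω := by
  refine ⟨fun B => ?_, le_antisymm ?_ ?_⟩
  · rw [hω, map_mul, show α (star B) = star (α B) from α.map_star' B]
    change 0 ≤ inner ℂ (fockVacuum : FockSpace E)
      ((star (α B : FockSpace E →L[ℂ] FockSpace E) * (α B : FockSpace E →L[ℂ] FockSpace E))
        fockVacuum)
    rw [mul_apply_eq_comp, ContinuousLinearMap.star_eq_adjoint,
      ContinuousLinearMap.adjoint_inner_right, inner_self_eq_norm_sq_to_K]
    change (0 : ℂ) ≤ ((‖(α B : FockSpace E →L[ℂ] FockSpace E) fockVacuum‖ : ℝ) : ℂ) ^ 2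
    exact_mod_cast sq_nonneg (‖(α B : FockSpace E →L[ℂ] FockSpace E) fockVacuum‖)
  · have : ω = vacuumComp α := ContinuousLinearMap.ext hω
    rw [this]
    exact LinearMap.mkContinuous_norm_le _ zero_le_one _
  · have h1 : ω 1 = 1 := by
      rw [hω, map_one, OneMemClass.coe_one, one_apply_eq_self,
        inner_self_eq_norm_sq_to_K, norm_fockVacuum]
      simp
    have h2 := ω.le_opNorm 1
    rw [h1, norm_one] at h2
    have h3 : ‖(1 : weylAlgebra S)‖ ≤ 1 := ContinuousLinearMap.norm_id_le
    nlinarith [norm_nonneg ω]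

theorem IsPhaseAut.isFockState {α : weylAlgebra S ≃⋆ₐ[ℂ] weylAlgebra S} (hα : IsPhaseAut ℓ α)
    {ω : weylAlgebra S →L[ℂ] ℂ}
    (hω : ∀ B : weylAlgebra S, ω B = inner ℂ (fockVacuum : FockSpace E)
      ((α B : FockSpace E →L[ℂ] FockSpace E) fockVacuum)) {g : E}
    (hg : ∀ h ∈ S, -(inner ℂ g h : ℂ).im = ℓ h) : IsFockState ω := by
  -- Here `α` is conjugation by `W(g)`, and the conjugating unitary is absorbed into the vector.
  refine ⟨star (weyl g) fockVacuum, ?_, fun B => ?_⟩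
  · have h := norm_weyl_apply g (star (weyl g) (fockVacuum : FockSpace E))
    rw [← mul_apply_eq_comp, weyl_mul_star, one_apply_eq_self, norm_fockVacuum] at h
    exact h.symm
  · rw [hω, hα.eq_conj hg, mul_apply_eq_comp, mul_apply_eq_comp,
      ← ContinuousLinearMap.adjoint_inner_left, ContinuousLinearMap.star_eq_adjoint]

theorem IsFockState.isFockNormalState {ω : weylAlgebra S →L[ℂ] ℂ} (h : IsFockState ω) :
    IsFockNormalState ω := by
  obtain ⟨Ψ, hΨ, hω⟩ := h
  refine ⟨fun n => if n = 0 then Ψ else 0, ?_, fun B => ?_⟩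
  · convert! hasSum_single (α := ℝ) 0 ?_ using 1
    · simp [hΨ]
    · intro n hn; simp [hn]
  · convert! hasSum_single (α := ℂ) 0 ?_ using 1
    · simp [hω]
    · intro n hn; simp [hn]

/-- Normal states are continuous along strongly convergent sequences of Weyl operators. -/
theorem IsFockNormalState.tendsto_weyl {ω : weylAlgebra S →L[ℂ] ℂ} (hω : IsFockNormalState ω)
    {h : ℕ → E} (hS : ∀ n, h n ∈ S) (hh : Tendsto h atTop (𝓝 0)) :
    Tendsto (fun n => ω (weylGen (hS n))) atTop (𝓝 1) := by
  obtain ⟨Ψ, hΨ, hω⟩ := hω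
  have h1 : ∀ n, ω (weylGen (hS n)) = ∑' k, inner ℂ (Ψ k) (weyl (h n) (Ψ k)) :=
    fun n => (hω (weylGen (hS n))).tsum_eq.symm
  have h2 : (1 : ℂ) = ∑' k, inner ℂ (Ψ k) (Ψ k) := by
    have : HasSum (fun k => ((‖Ψ k‖ ^ 2 : ℝ) : ℂ)) ((1 : ℝ) : ℂ) := by exact_mod_cast hΨ
    rw [Complex.ofReal_one] at this
    rw [← this.tsum_eq]
    refine tsum_congr fun k => ?_
    rw [inner_self_eq_norm_sq_to_K]; push_cast; rfl
  simp_rw [h1]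
  rw [h2]
  -- Unitarity bounds the `k`-th summand by `‖Ψ k‖ ^ 2` for all `n`, which is summable because the
  -- density matrix has trace one.
  refine tendsto_tsum_of_dominated_convergence hΨ.summable (fun k => ?_)
    (Eventually.of_forall fun n k => ?_)
  · exact tendsto_const_nhds.inner (tendsto_weyl_apply hh (Ψ k))
  · refine (norm_inner_le_norm _ _).trans ?_
    rw [norm_weyl_apply, sq]

/-- The value of `ω` at `W(h n)` is the phase times the vacuum expectation. Both that value, by
normality, and the vacuum expectation tend to 1, so the phase does too: normality forces continuity
of `e^{iℓ}` at zero along sequences in `S`. -/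
theorem IsPhaseAut.tendsto_phase {α : weylAlgebra S ≃⋆ₐ[ℂ] weylAlgebra S} (hα : IsPhaseAut ℓ α)
    {ω : weylAlgebra S →L[ℂ] ℂ}
    (hω : ∀ B : weylAlgebra S, ω B = inner ℂ (fockVacuum : FockSpace E)
      ((α B : FockSpace E →L[ℂ] FockSpace E) fockVacuum)) (hn : IsFockNormalState ω)
    {h : ℕ → E} (hS : ∀ n, h n ∈ S) (hh : Tendsto h atTop (𝓝 0)) :
    Tendsto (fun n => Complex.exp (Complex.I * ℓ (h n))) atTop (𝓝 1) := by
  have h1 := hn.tendsto_weyl hS hh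
  have h2 : ∀ n, ω (weylGen (hS n)) = Complex.exp (Complex.I * ℓ (h n)) *
      inner ℂ (fockVacuum : FockSpace E) (weyl (h n) fockVacuum) := by
    intro n
    rw [hω, hα (h n) (hS n), ← inner_smul_right]; rfl
  have h3 : Tendsto (fun n => (inner ℂ (fockVacuum : FockSpace E) (weyl (h n) fockVacuum) : ℂ))
      atTop (𝓝 1) := by
    have : (inner ℂ (fockVacuum : FockSpace E) (fockVacuum : FockSpace E) : ℂ) = 1 := by
      rw [inner_self_eq_norm_sq_to_K, norm_fockVacuum]; simp
    rw [← this]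
    exact tendsto_const_nhds.inner (tendsto_weyl_apply hh _)
  have h4 := h1.div h3 one_ne_zero
  rw [div_one] at h4
  refine h4.congr' ?_
  filter_upwards [h3.eventually_ne one_ne_zero] with n hn
  rw [Pi.div_apply, h2, mul_div_assoc, div_self hn, mul_one]

end PhaseAut

/-! ### Polar coordinates and the Riemann-Lebesgue lemma along rays -/

section Polar

theorem measurePreserving_polar :
    MeasurePreserving (homeomorphUnitSphereProd R3) ((volume : Measure R3).comap (↑))
      ((volume : Measure R3).toSphere.prod (Measure.volumeIoiPow 2)) := by
  have h := (volume : Measure R3).measurePreserving_homeomorphUnitSphereProd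
  have h3 : Module.finrank ℝ R3 - 1 = 2 := by simp
  rwa [h3] at h

theorem measurable_polar : Measurable
    fun q : Metric.sphere (0 : R3) 1 × Set.Ioi (0 : ℝ) => (q.2 : ℝ) • (q.1 : R3) := by
  fun_prop

theorem polar_homeomorph (p : ({0}ᶜ : Set R3)) :
    ((homeomorphUnitSphereProd R3 p).2 : ℝ) • ((homeomorphUnitSphereProd R3 p).1 : R3) = p := by
  exact congrArg Subtype.val ((homeomorphUnitSphereProd R3).symm_apply_apply p)

/-- Integration in polar coordinates. -/
theorem lintegral_polar {f : R3 → ℝ≥0∞} (hf : Measurable f) :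
    ∫⁻ p, f p = ∫⁻ n : Metric.sphere (0 : R3) 1, (∫⁻ r in Set.Ioi (0 : ℝ),
      ENNReal.ofReal (r ^ 2) * f (r • (n : R3))) ∂(volume : Measure R3).toSphere := by
  have hm : Measurable
      fun q : Metric.sphere (0 : R3) 1 × Set.Ioi (0 : ℝ) => f ((q.2 : ℝ) • (q.1 : R3)) :=
    hf.comp measurable_polar
  calc ∫⁻ p, f p = ∫⁻ p : ({0}ᶜ : Set R3), f p ∂((volume : Measure R3).comap (↑)) := by
        rw [lintegral_subtype_comap (measurableSet_singleton _).compl f, restrict_compl_singleton]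
    _ = ∫⁻ q, f ((q.2 : ℝ) • (q.1 : R3))
          ∂((volume : Measure R3).toSphere.prod (Measure.volumeIoiPow 2)) := by
        rw [← measurePreserving_polar.lintegral_comp hm]
        simp_rw [polar_homeomorph]
    _ = ∫⁻ n, ∫⁻ r : Set.Ioi (0 : ℝ), f ((r : ℝ) • (n : R3)) ∂(Measure.volumeIoiPow 2)
          ∂(volume : Measure R3).toSphere := lintegral_prod _ hm.aemeasurable
    _ = _ := by
        refine lintegral_congr fun n => ?_
        have h1 : Measurable fun r : Set.Ioi (0 : ℝ) => f ((r : ℝ) • (n : R3)) :=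
          hf.comp (by fun_prop)
        rw [Measure.volumeIoiPow, lintegral_withDensity_eq_lintegral_mul _ (by fun_prop) h1,
          ← lintegral_subtype_comap measurableSet_Ioi]
        rfl

theorem integrable_polar {F : R3 → ℂ} (hF : Integrable F) :
    Integrable (fun q : Metric.sphere (0 : R3) 1 × Set.Ioi (0 : ℝ) => F ((q.2 : ℝ) • (q.1 : R3)))
      ((volume : Measure R3).toSphere.prod (Measure.volumeIoiPow 2)) := by
  rw [← measurePreserving_polar.integrable_comp_emb (Homeomorph.measurableEmbedding _)]
  have h : Integrable (fun p : ({0}ᶜ : Set R3) => F p) ((volume : Measure R3).comap (↑)) :=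
    (integrableOn_iff_comap_subtypeVal (measurableSet_singleton _).compl).mp hF.integrableOn
  refine h.congr (Eventually.of_forall fun p => ?_)
  simp only [Function.comp_apply, polar_homeomorph]

theorem integral_polar {F : R3 → ℂ} (hF : Integrable F) :
    ∫ p, F p = ∫ n : Metric.sphere (0 : R3) 1, ∫ r : Set.Ioi (0 : ℝ), F ((r : ℝ) • (n : R3))
      ∂(Measure.volumeIoiPow 2) ∂(volume : Measure R3).toSphere := by
  rw [← integral_prod _ (integrable_polar hF),
    ← measurePreserving_polar.integral_comp (Homeomorph.measurableEmbedding _)]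
  simp_rw [polar_homeomorph]
  rw [integral_subtype_comap (measurableSet_singleton _).compl F, restrict_compl_singleton]

/-- This is the Riemann-Lebesgue lemma on the line for `r ^ 2 * f r` extended by zero. No
integrability is required: in the non-integrable case the Bochner integrals are zero. -/
theorem tendsto_integral_ray_exp (f : ℝ → ℂ) {d : ℝ} (hd : d ≠ 0) :
    Tendsto (fun R : ℝ => ∫ r : Set.Ioi (0 : ℝ), Complex.exp (Complex.I * (R * (r * d) : ℝ)) * f r
      ∂(Measure.volumeIoiPow 2)) atTop (𝓝 0) := by
  have h := Real.tendsto_integral_exp_smul_cocompact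
    ((Set.Ioi (0 : ℝ)).indicator fun r => ((r ^ 2 : ℝ) : ℂ) * f r)
  -- The frequency is rescaled to the convention `e^{-2πi r w}` of the Fourier character; `d ≠ 0`
  -- lets it leave every compact set.
  have h2 : Tendsto (fun R : ℝ => R * (-d / (2 * Real.pi))) atTop (cocompact ℝ) := by
    have h0 : -d / (2 * Real.pi) ≠ 0 :=
      div_ne_zero (neg_ne_zero.mpr hd) (by positivity)
    exact ((Homeomorph.mulRight₀ _ h0).isClosedEmbedding.tendsto_cocompact).comp
      atTop_le_cocompact
  refine (h.comp h2).congr fun R => ?_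
  have h3 : Measurable fun r : Set.Ioi (0 : ℝ) => Real.toNNReal ((r : ℝ) ^ 2) := by fun_prop
  simp only [Function.comp_apply, Measure.volumeIoiPow, ENNReal.ofReal]
  rw [integral_withDensity_eq_integral_smul h3,
    integral_subtype_comap measurableSet_Ioi fun r : ℝ => Real.toNNReal (r ^ 2) •
      (Complex.exp (Complex.I * (R * (r * d) : ℝ)) * f r), ← integral_indicator measurableSet_Ioi]
  refine integral_congr_ae (Eventually.of_forall fun r => ?_)
  by_cases hr : r ∈ Set.Ioi (0 : ℝ)
  · simp only [Set.indicator_of_mem hr, NNReal.smul_def, Real.coe_toNNReal _ (sq_nonneg r)]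
    rw [Circle.smul_def, Real.fourierChar_apply, smul_eq_mul, Complex.real_smul]
    have : ((2 * Real.pi * -(r * (R * (-d / (2 * Real.pi)))) : ℝ) : ℂ) * Complex.I =
        Complex.I * (R * (r * d) : ℝ) := by
      rw [mul_comm]
      congr 2
      field_simp
    rw [this]
    ring
  · simp [Set.indicator_of_notMem hr]

/-- The Riemann-Lebesgue lemma along rays. -/
theorem tendsto_integral_exp_homogeneous {F : R3 → ℂ} (hF : Integrable F) {φ : R3 → ℝ}
    (hφ : Continuous φ) (hhom : ∀ (r : ℝ) (p : R3), 0 < r → φ (r • p) = r * φ p)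
    (hne : ∀ p : R3, ‖p‖ = 1 → φ p ≠ 0) :
    Tendsto (fun R : ℝ => ∫ p, Complex.exp (Complex.I * (R * φ p : ℝ)) * F p) atTop (𝓝 0) := by
  have hFR : ∀ R : ℝ, Integrable fun p => Complex.exp (Complex.I * (R * φ p : ℝ)) * F p := by
    intro R
    refine hF.bdd_mul (c := 1) (by fun_prop) (Eventually.of_forall fun p => ?_)
    rw [mul_comm, Complex.norm_exp_ofReal_mul_I]
  simp_rw [fun R => integral_polar (hFR R)]
  have h0 : (0 : ℂ) = ∫ _ : Metric.sphere (0 : R3) 1, (0 : ℂ) ∂(volume : Measure R3).toSphere := by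
    simp
  rw [h0]
  -- On the ray through `n` the phase is `R r φ(n)` by homogeneity, with `φ(n) ≠ 0`, so each radial
  -- integral tends to zero. The radial integrals of `‖F‖` dominate.
  refine tendsto_integral_filter_of_dominated_convergence
    (fun n => ∫ r : Set.Ioi (0 : ℝ), ‖F ((r : ℝ) • (n : R3))‖ ∂(Measure.volumeIoiPow 2))
    (Eventually.of_forall fun R => (integrable_polar (hFR R)).integral_prod_left.aestronglyMeasurable)
    (Eventually.of_forall fun R => Eventually.of_forall fun n => ?_)
    (integrable_polar hF).norm.integral_prod_left (Eventually.of_forall fun n => ?_)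
  · refine (norm_integral_le_integral_norm _).trans (le_of_eq ?_)
    refine integral_congr_ae (Eventually.of_forall fun r => ?_)
    simp only [norm_mul]
    rw [mul_comm Complex.I, Complex.norm_exp_ofReal_mul_I, one_mul]
  · refine (tendsto_integral_ray_exp (fun r => F (r • (n : R3)))
      (hne n (norm_eq_of_mem_sphere n))).congr fun R => ?_
    refine integral_congr_ae (Eventually.of_forall fun r => ?_)
    simp only [hhom r n r.2]

end Polar

/-! ### The measure `dp / (2ω)` in polar coordinates -/

section PhotonMeasure

/-- The radial density is `r² / (2r) = r / 2`. Hence `|p|⁻²` is exactly the borderline of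
integrability. -/
theorem lintegral_photonMeasure {f : R3 → ℝ≥0∞} (hf : Measurable f) :
    ∫⁻ p, f p ∂photonMeasure = ∫⁻ n : Metric.sphere (0 : R3) 1, (∫⁻ r in Set.Ioi (0 : ℝ),
      ENNReal.ofReal (r / 2) * f (r • (n : R3))) ∂(volume : Measure R3).toSphere := by
  rw [photonMeasure, lintegral_withDensity_eq_lintegral_mul _ (by fun_prop) hf,
    lintegral_polar (by fun_prop)]
  refine lintegral_congr fun n => setLIntegral_congr_fun measurableSet_Ioi fun r hr => ?_
  have hr : 0 < r := hr
  simp only [Pi.mul_apply]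
  rw [← mul_assoc, ← ENNReal.ofReal_mul (by positivity), norm_smul, norm_eq_of_mem_sphere,
    Real.norm_of_nonneg hr.le]
  congr 2
  field_simp

/-- Integrals of radial functions over shells. -/
theorem lintegral_photonMeasure_radial {g : ℝ → ℝ≥0∞} (hg : Measurable g) {I : Set ℝ}
    (hI : MeasurableSet I) :
    ∫⁻ p in {p : R3 | ‖p‖ ∈ I}, g ‖p‖ ∂photonMeasure =
      (∫⁻ r in Set.Ioi (0 : ℝ) ∩ I, ENNReal.ofReal (r / 2) * g r) *
        (volume : Measure R3).toSphere Set.univ := by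
  have hI' : MeasurableSet {p : R3 | ‖p‖ ∈ I} := measurable_norm hI
  rw [← lintegral_indicator hI', lintegral_photonMeasure
      (Measurable.indicator (f := fun p : R3 => g ‖p‖) (by fun_prop) hI'),
    ← lintegral_const]
  refine lintegral_congr fun n => ?_
  rw [Set.inter_comm, ← Measure.restrict_restrict hI, ← lintegral_indicator hI]
  refine setLIntegral_congr_fun measurableSet_Ioi fun r hr => ?_
  have hr : 0 < r := hr
  have hn : ‖r • (n : R3)‖ = r := by
    rw [norm_smul, norm_eq_of_mem_sphere, Real.norm_of_nonneg hr.le, mul_one]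
  by_cases h : r ∈ I
  · rw [Set.indicator_of_mem h, Set.indicator_of_mem (by simpa [hn] using h), hn]
  · rw [Set.indicator_of_notMem h, Set.indicator_of_notMem (by simpa [hn] using h), mul_zero]

theorem ae_photonMeasure_of_ne_zero {q : R3 → Prop} (h : ∀ p, p ≠ 0 → q p) :
    ∀ᵐ p ∂photonMeasure, q p := by
  have h0 : ∀ᵐ p : R3, p ≠ 0 := by
    rw [ae_iff]; simp
  have : photonMeasure ≪ (volume : Measure R3) := withDensity_absolutelyContinuous _ _
  exact this.ae_le (h0.mono h)

theorem lintegral_Icc_inv {a b : ℝ} (ha : 0 < a) (hab : a ≤ b) :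
    ∫⁻ r in Set.Icc a b, ENNReal.ofReal r⁻¹ = ENNReal.ofReal (Real.log (b / a)) := by
  have hint : IntegrableOn (fun r : ℝ => r⁻¹) (Set.Icc a b) := by
    refine ContinuousOn.integrableOn_Icc fun r hr => ?_
    exact (continuousAt_inv₀ (by linarith [hr.1])).continuousWithinAt
  rw [← ofReal_integral_eq_lintegral_ofReal hint, integral_Icc_eq_integral_Ioc,
    ← intervalIntegral.integral_of_le hab, integral_inv_of_pos ha (ha.trans_le hab)]
  filter_upwards [ae_restrict_mem measurableSet_Icc] with r hr
  exact inv_nonneg.mpr (by linarith [hr.1])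

/-- The common majorant for pairings of a rapidly decreasing `h` with an amplitude of size `1/|p|`:
the weight `r / 2` absorbs the singularity, and the decay with exponent `k = 1` suffices at
infinity. -/
theorem integrable_photonMeasure_rapid :
    Integrable (fun p : R3 => ‖p‖⁻¹ * ((1 + ‖p‖ ^ 2) ^ 1)⁻¹) photonMeasure := by
  refine ⟨by fun_prop, ?_⟩
  rw [hasFiniteIntegral_iff_enorm]
  have h := lintegral_photonMeasure_radial (g := fun r => ‖r⁻¹ * ((1 + r ^ 2) ^ 1)⁻¹‖ₑ)
    (by fun_prop) MeasurableSet.univ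
  simp only [Set.mem_univ, Set.ofPred_true, Measure.restrict_univ, Set.inter_univ] at h
  rw [h]
  refine ENNReal.mul_lt_top ?_ (measure_lt_top _ _)
  have h2 : Integrable fun r : ℝ => (1 + r ^ 2)⁻¹ := integrable_inv_one_add_sq
  refine lt_of_le_of_lt ?_ h2.hasFiniteIntegral
  refine (setLIntegral_mono' measurableSet_Ioi fun r hr => ?_).trans (setLIntegral_le_lintegral _ _)
  have hr : 0 < r := hr
  rw [← ofReal_norm, ← ofReal_norm, ← ENNReal.ofReal_mul (by positivity)]
  refine ENNReal.ofReal_le_ofReal ?_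
  rw [Real.norm_of_nonneg (by positivity), Real.norm_of_nonneg (by positivity), pow_one]
  calc r / 2 * (r⁻¹ * (1 + r ^ 2)⁻¹) = (1 / 2) * (1 + r ^ 2)⁻¹ := by field_simp
    _ ≤ 1 * (1 + r ^ 2)⁻¹ := by gcongr; norm_num
    _ = _ := one_mul _

end PhotonMeasure

/-! ### The transverse projection -/

section Projection

theorem norm_toC3 (v : R3) : ‖toC3 v‖ = ‖v‖ := by
  simp [toC3, EuclideanSpace.norm_eq]

/-- The inclusion `ℝ³ ⊆ ℂ³` as a continuous real linear map. -/
def toC3L : R3 →L[ℝ] C3 :=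
  LinearMap.toContinuousLinearMap
    { toFun := toC3
      map_add' := fun v w => by ext j; simp [toC3]
      map_smul' := fun c v => by ext j; simp [toC3] }

theorem toC3L_apply (v : R3) : toC3L v = toC3 v := rfl

theorem continuous_toC3 : Continuous toC3 := toC3L.continuous

theorem transverseProj_eq (p : R3) (z : C3) :
    transverseProj p z = z - ((((‖p‖ ^ 2)⁻¹ : ℝ) : ℂ) * inner ℂ (toC3 p) z) • toC3 p := by
  ext j
  simp only [transverseProj, PiLp.sub_apply, PiLp.smul_apply, sub_mul, Finset.sum_sub_distrib,
    ite_mul, one_mul, zero_mul, Finset.sum_ite_eq, Finset.mem_univ, if_true, smul_eq_mul]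
  congr 1
  simp only [PiLp.inner_apply, toC3, RCLike.inner_apply, Complex.conj_ofReal, Finset.mul_sum,
    Finset.sum_mul]
  refine Finset.sum_congr rfl fun k _ => ?_
  push_cast
  ring

/-- The triangle inequality gives the constant 2 instead of the optimal 1, which is enough for all
estimates. At `p = 0` the inverse is zero by convention. -/
theorem norm_transverseProj_le (p : R3) (z : C3) : ‖transverseProj p z‖ ≤ 2 * ‖z‖ := by
  rw [transverseProj_eq]
  refine (norm_sub_le _ _).trans ?_
  rw [two_mul]
  refine add_le_add_right ?_ _
  rw [norm_smul, norm_mul, Complex.norm_real, norm_toC3, Real.norm_of_nonneg (by positivity)]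
  rcases eq_or_ne p 0 with rfl | hp
  · simp
  · have h := norm_inner_le_norm (𝕜 := ℂ) (toC3 p) z
    rw [norm_toC3] at h
    have hp' : 0 < ‖p‖ := norm_pos_iff.mpr hp
    calc (‖p‖ ^ 2)⁻¹ * ‖(inner ℂ (toC3 p) z : ℂ)‖ * ‖p‖ ≤ (‖p‖ ^ 2)⁻¹ * (‖p‖ * ‖z‖) * ‖p‖ := by
          gcongr
      _ = ‖z‖ := by field_simp

theorem sum_mul_transverseProj {p : R3} (hp : p ≠ 0) (z : C3) :
    ∑ j, ((p j : ℝ) : ℂ) * transverseProj p z j = 0 := by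
  have h : ∀ w : C3, ∑ j, ((p j : ℝ) : ℂ) * w j = inner ℂ (toC3 p) w := by
    intro w
    simp [PiLp.inner_apply, toC3, mul_comm]
  have hp' : ((‖p‖ : ℝ) : ℂ) ≠ 0 := by exact_mod_cast (norm_ne_zero_iff.mpr hp)
  rw [h, transverseProj_eq, inner_sub_right, inner_smul_right, inner_self_eq_norm_sq_to_K,
    norm_toC3]
  simp only [Complex.coe_algebraMap]
  push_cast
  field_simp
  ring

theorem transverseProj_sub (p : R3) (z w : C3) :
    transverseProj p (z - w) = transverseProj p z - transverseProj p w := by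
  simp only [transverseProj_eq, inner_sub_right, mul_sub, sub_smul]
  abel

theorem transverseProj_smul (p : R3) (c : ℂ) (z : C3) :
    transverseProj p (c • z) = c • transverseProj p z := by
  simp only [transverseProj_eq, inner_smul_right, smul_sub, smul_smul]
  congr 2
  ring

theorem transverseProj_smul_left {r : ℝ} (hr : r ≠ 0) (p : R3) (z : C3) :
    transverseProj (r • p) z = transverseProj p z := by
  rw [transverseProj_eq, transverseProj_eq]
  have h : toC3 (r • p) = (r : ℂ) • toC3 p := by
    ext j; simp [toC3]
  rw [h, inner_smul_left, smul_smul, norm_smul]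
  congr 2
  rw [Complex.conj_ofReal, mul_pow, Real.norm_eq_abs, sq_abs]
  have : (r : ℂ) ≠ 0 := by exact_mod_cast hr
  push_cast
  field_simp

theorem measurable_transverseProj {f : R3 → C3} (hf : Measurable f) :
    Measurable fun p => transverseProj p (f p) := by
  have h : Measurable toC3 := continuous_toC3.measurable
  simp only [transverseProj_eq]
  fun_prop

end Projection

/-! ### Pointwise bounds for the source amplitude and its derivative -/

section SourceBounds

/-- The amplitude `(ψ_tt / ψ_t²) x' - (1 / ψ_t) x''` of the source, `-d/dt (x' / ψ_t)`. -/
def sourceAmp (x : ℝ → R3) (p : R3) (t : ℝ) : R3 :=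
  (phaseDD x p t / phaseD x p t ^ 2) • deriv x t - (1 / phaseD x p t) • deriv (deriv x) t

/-- A trajectory with its bounds: it is at constant velocity for `|t| ≥ T`. -/
structure IsScatteringTrajectory (x : ℝ → R3) (vin vout : R3) (v₀ T A X : ℝ) : Prop where
  contDiff : ContDiff ℝ 3 x
  lt_one : v₀ < 1
  speed : ∀ t, ‖deriv x t‖ ≤ v₀
  pos : 0 < T
  eq_in : ∀ t ≤ -T, deriv x t = vin
  eq_out : ∀ t, T ≤ t → deriv x t = vout
  acc_eq_zero : ∀ t, T ≤ |t| → deriv (deriv x) t = 0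
  acc_le : ∀ t, ‖deriv (deriv x) t‖ ≤ A
  jerk_le : ∀ t, ‖deriv (deriv (deriv x)) t‖ ≤ A
  norm_le : ∀ t ∈ Set.Icc (-T) T, ‖x t‖ ≤ X

theorem continuous_deriv_of_contDiff {x : ℝ → R3} (hx : ContDiff ℝ 3 x) :
    ContDiff ℝ 2 (deriv x) ∧ ContDiff ℝ 1 (deriv (deriv x)) ∧
      Continuous (deriv (deriv (deriv x))) :=
  ⟨hx.iterate_deriv' 2 1, hx.iterate_deriv' 1 2, (hx.iterate_deriv' 0 3).continuous⟩

theorem exists_isScatteringTrajectory {x : ℝ → R3} {vin vout : R3} {v₀ : ℝ}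
    (hx : ContDiff ℝ 3 x) (hv₀ : v₀ < 1) (hspeed : ∀ t, ‖deriv x t‖ ≤ v₀)
    (hin : ∀ᶠ t in atBot, deriv x t = vin) (hout : ∀ᶠ t in atTop, deriv x t = vout) :
    ∃ T A X, IsScatteringTrajectory x vin vout v₀ T A X := by
  obtain ⟨c2, c1, c0⟩ := continuous_deriv_of_contDiff hx
  obtain ⟨t₁, h1⟩ := eventually_atBot.mp hin
  obtain ⟨t₂, h2⟩ := eventually_atTop.mp hout
  set S : ℝ := max (max (-t₁) t₂) 0 with hS
  have hS1 : -S ≤ t₁ := by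
    have : -t₁ ≤ S := (le_max_left _ _).trans (le_max_left _ _)
    linarith
  have hS2 : t₂ ≤ S := (le_max_right _ _).trans (le_max_left _ _)
  have hS0 : 0 ≤ S := le_max_right _ _
  have hacc : ∀ t, S < |t| → deriv (deriv x) t = 0 := by
    intro t ht
    rcases lt_abs.mp ht with h | h
    · have : deriv x =ᶠ[𝓝 t] fun _ => vout := by
        filter_upwards [lt_mem_nhds h] with s hs using h2 s (hS2.trans hs.le)
      rw [this.deriv_eq, deriv_const]
    · have : deriv x =ᶠ[𝓝 t] fun _ => vin := by
        filter_upwards [gt_mem_nhds (by linarith : t < -S)] with s hs using h1 s (by linarith)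
      rw [this.deriv_eq, deriv_const]
  have hjerk : ∀ t, S < |t| → deriv (deriv (deriv x)) t = 0 := by
    intro t ht
    have : deriv (deriv x) =ᶠ[𝓝 t] fun _ => 0 := by
      filter_upwards [continuous_abs.continuousAt.eventually_const_lt ht] with s hs using hacc s hs
    rw [this.deriv_eq, deriv_const]
  obtain ⟨A₁, hA₁⟩ := (isCompact_Icc (a := -S) (b := S)).exists_bound_of_continuousOn
    c1.continuous.continuousOn
  obtain ⟨A₂, hA₂⟩ := (isCompact_Icc (a := -S) (b := S)).exists_bound_of_continuousOn
    c0.continuousOn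
  obtain ⟨X, hX⟩ := (isCompact_Icc (a := -(S + 1)) (b := S + 1)).exists_bound_of_continuousOn
    hx.continuous.continuousOn
  -- With `T = S + 1` every `t` with `|t| ≥ T` lies in the open region where the velocity is locally
  -- constant, so the acceleration vanishes there, including at `±T`.
  refine ⟨S + 1, max (max A₁ A₂) 0, X, hx, hv₀, hspeed, by linarith,
    fun t ht => h1 t (by linarith), fun t ht => h2 t (by linarith),
    fun t ht => hacc t (by linarith), fun t => ?_, fun t => ?_, hX⟩
  · rcases lt_or_ge S |t| with h | h
    · rw [hacc t h, norm_zero]; exact le_max_right _ _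
    · exact (hA₁ t (abs_le.mp h)).trans ((le_max_left _ _).trans (le_max_left _ _))
  · rcases lt_or_ge S |t| with h | h
    · rw [hjerk t h, norm_zero]; exact le_max_right _ _
    · exact (hA₂ t (abs_le.mp h)).trans ((le_max_right _ _).trans (le_max_left _ _))

variable {x : ℝ → R3} {vin vout : R3} {v₀ T A X : ℝ}

namespace IsScatteringTrajectory

variable (hx : IsScatteringTrajectory x vin vout v₀ T A X)
include hx

theorem hasDerivAt_pos (t : ℝ) : HasDerivAt x (deriv x t) t :=
  (hx.contDiff.differentiable (by norm_num)).differentiableAt.hasDerivAt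

theorem hasDerivAt_vel (t : ℝ) : HasDerivAt (deriv x) (deriv (deriv x) t) t :=
  ((continuous_deriv_of_contDiff hx.contDiff).1.differentiable
    (by norm_num)).differentiableAt.hasDerivAt

theorem hasDerivAt_acc (t : ℝ) :
    HasDerivAt (deriv (deriv x)) (deriv (deriv (deriv x)) t) t :=
  ((continuous_deriv_of_contDiff hx.contDiff).2.1.differentiable
    (by norm_num)).differentiableAt.hasDerivAt

theorem continuous_pos : Continuous x := hx.contDiff.continuous

theorem continuous_vel : Continuous (deriv x) :=
  (continuous_deriv_of_contDiff hx.contDiff).1.continuous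

theorem continuous_acc : Continuous (deriv (deriv x)) :=
  (continuous_deriv_of_contDiff hx.contDiff).2.1.continuous

theorem continuous_jerk : Continuous (deriv (deriv (deriv x))) :=
  (continuous_deriv_of_contDiff hx.contDiff).2.2

theorem continuous_phase (p : R3) : Continuous (phase x p) := by
  have := hx.continuous_pos
  unfold phase
  fun_prop

theorem continuous_phaseD (p : R3) : Continuous (phaseD x p) := by
  have := hx.continuous_vel
  unfold phaseD
  fun_prop

theorem continuous_phaseDD (p : R3) : Continuous (phaseDD x p) := by
  have := hx.continuous_acc
  unfold phaseDD
  fun_prop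

theorem hasDerivAt_phase (p : R3) (t : ℝ) : HasDerivAt (phase x p) (phaseD x p t) t := by
  have h := ((hasDerivAt_id t).const_mul ‖p‖).sub
    ((innerSL ℝ p).hasFDerivAt.comp_hasDerivAt t (hx.hasDerivAt_pos t))
  rw [mul_one] at h
  exact h

theorem hasDerivAt_phaseD (p : R3) (t : ℝ) : HasDerivAt (phaseD x p) (phaseDD x p t) t :=
  ((innerSL ℝ p).hasFDerivAt.comp_hasDerivAt t (hx.hasDerivAt_vel t)).const_sub ‖p‖

theorem hasDerivAt_phaseDD (p : R3) (t : ℝ) :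
    HasDerivAt (phaseDD x p) (-inner ℝ p (deriv (deriv (deriv x)) t)) t :=
  ((innerSL ℝ p).hasFDerivAt.comp_hasDerivAt t (hx.hasDerivAt_acc t)).neg

theorem nonneg_acc : 0 ≤ A := (norm_nonneg _).trans (hx.acc_le 0)

theorem norm_in_le : ‖vin‖ ≤ v₀ := by
  rw [← hx.eq_in (-T) le_rfl]; exact hx.speed _

theorem norm_out_le : ‖vout‖ ≤ v₀ := by
  rw [← hx.eq_out T le_rfl]; exact hx.speed _

/-- A speed bounded below that of light excludes stationary phase. All divisions by `ψ_t` rest on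
this bound. -/
theorem le_phaseD (p : R3) (t : ℝ) : ‖p‖ * (1 - v₀) ≤ phaseD x p t := by
  have h := real_inner_le_norm p (deriv x t)
  have h2 := mul_le_mul_of_nonneg_left (hx.speed t) (norm_nonneg p)
  unfold phaseD
  linarith

theorem phaseD_pos {p : R3} (hp : p ≠ 0) (t : ℝ) : 0 < phaseD x p t :=
  (mul_pos (norm_pos_iff.mpr hp) (sub_pos.mpr hx.lt_one)).trans_le (hx.le_phaseD p t)

theorem inv_phaseD_le {p : R3} (hp : p ≠ 0) (t : ℝ) :
    (phaseD x p t)⁻¹ ≤ (‖p‖ * (1 - v₀))⁻¹ :=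
  inv_anti₀ (mul_pos (norm_pos_iff.mpr hp) (sub_pos.mpr hx.lt_one)) (hx.le_phaseD p t)

theorem abs_phaseDD_le (p : R3) (t : ℝ) : |phaseDD x p t| ≤ ‖p‖ * A := by
  rw [phaseDD, abs_neg]
  exact (abs_real_inner_le_norm _ _).trans
    (mul_le_mul_of_nonneg_left (hx.acc_le t) (norm_nonneg _))

theorem hasDerivAt_inv_phaseD {p : R3} (hp : p ≠ 0) (t : ℝ) :
    HasDerivAt (fun t => (phaseD x p t)⁻¹) (-phaseDD x p t * (phaseD x p t)⁻¹ ^ 2) t := by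
  have h := (hx.hasDerivAt_phaseD p t).inv (hx.phaseD_pos hp t).ne'
  convert! h using 1
  rw [inv_pow, div_eq_mul_inv]

theorem continuous_sourceAmp {p : R3} (hp : p ≠ 0) : Continuous (sourceAmp x p) := by
  have h1 := hx.continuous_vel
  have h2 := hx.continuous_acc
  have h3 := hx.continuous_phaseD p
  have h4 := hx.continuous_phaseDD p
  have h5 : ∀ t, phaseD x p t ≠ 0 := fun t => (hx.phaseD_pos hp t).ne'
  unfold sourceAmp
  fun_prop (disch := simp [h5])

theorem hasDerivAt_vel_div {p : R3} (hp : p ≠ 0) (t : ℝ) :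
    HasDerivAt (fun t => (phaseD x p t)⁻¹ • deriv x t) (-sourceAmp x p t) t := by
  have h := (hx.hasDerivAt_inv_phaseD hp t).smul (hx.hasDerivAt_vel t)
  convert! h using 1
  rw [sourceAmp, neg_sub, sub_eq_add_neg, ← neg_smul, one_div, inv_pow, ← div_eq_mul_inv, neg_div]

theorem sourceAmp_eq_zero (p : R3) {t : ℝ} (ht : T ≤ |t|) : sourceAmp x p t = 0 := by
  simp [sourceAmp, phaseDD, hx.acc_eq_zero t ht]

theorem norm_sourceAmp_le {p : R3} (hp : p ≠ 0) (t : ℝ) :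
    ‖sourceAmp x p t‖ ≤ (A / (1 - v₀) ^ 2 + A / (1 - v₀)) * ‖p‖⁻¹ := by
  have hp' := norm_pos_iff.mpr hp
  have hδ : 0 < 1 - v₀ := sub_pos.mpr hx.lt_one
  have hD := hx.phaseD_pos hp t
  have h1 := hx.inv_phaseD_le hp t
  have hA := hx.nonneg_acc
  have hu : ‖deriv x t‖ ≤ 1 := (hx.speed t).trans hx.lt_one.le
  refine (norm_sub_le _ _).trans ?_
  rw [norm_smul, norm_smul, Real.norm_eq_abs, Real.norm_eq_abs, abs_div, abs_pow, abs_of_pos hD,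
    abs_of_pos (by positivity : 0 < 1 / phaseD x p t), div_eq_mul_inv, ← inv_pow, one_div]
  calc _ ≤ (‖p‖ * A) * (‖p‖ * (1 - v₀))⁻¹ ^ 2 * 1 + (‖p‖ * (1 - v₀))⁻¹ * A := by
        gcongr
        · exact hx.abs_phaseDD_le p t
        · exact hx.acc_le t
    _ = _ := by field_simp

/-- Input for a further integration by parts, and the place where the third derivative of `x`
enters. Written in powers of `ψ_t⁻¹`, each term is visibly homogeneous of degree -2 in `p`. -/
theorem hasDerivAt_sourceAmp_div {p : R3} (hp : p ≠ 0) (t : ℝ) :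
    HasDerivAt (fun t => (phaseD x p t)⁻¹ • sourceAmp x p t)
      ((-inner ℝ p (deriv (deriv (deriv x)) t) * (phaseD x p t)⁻¹ ^ 3 -
          3 * phaseDD x p t ^ 2 * (phaseD x p t)⁻¹ ^ 4) • deriv x t +
        (3 * phaseDD x p t * (phaseD x p t)⁻¹ ^ 3) • deriv (deriv x) t -
        ((phaseD x p t)⁻¹ ^ 2) • deriv (deriv (deriv x)) t) t := by
  have he := hx.hasDerivAt_inv_phaseD hp t
  have h := (((hx.hasDerivAt_phaseDD p t).mul (he.pow 3)).smul (hx.hasDerivAt_vel t)).sub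
    ((he.pow 2).smul (hx.hasDerivAt_acc t))
  convert! h using 1
  · funext s
    simp only [sourceAmp, smul_sub, smul_smul, Pi.mul_apply, Pi.pow_apply, Pi.sub_apply,
      Pi.smul_apply']
    congr 2
    · rw [div_eq_mul_inv, inv_pow]; ring
    · ring
  · simp only [Pi.mul_apply, Pi.pow_apply]
    push_cast
    module

theorem exists_norm_deriv_sourceAmp_div_le : ∃ K : ℝ, ∀ p : R3, p ≠ 0 → ∀ t : ℝ,
    ‖(-inner ℝ p (deriv (deriv (deriv x)) t) * (phaseD x p t)⁻¹ ^ 3 -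
          3 * phaseDD x p t ^ 2 * (phaseD x p t)⁻¹ ^ 4) • deriv x t +
        (3 * phaseDD x p t * (phaseD x p t)⁻¹ ^ 3) • deriv (deriv x) t -
        ((phaseD x p t)⁻¹ ^ 2) • deriv (deriv (deriv x)) t‖ ≤ K * (‖p‖ ^ 2)⁻¹ := by
  set δ := 1 - v₀ with hδ'
  refine ⟨(A / δ ^ 3 + 3 * A ^ 2 / δ ^ 4) + 3 * A ^ 2 / δ ^ 3 + A / δ ^ 2, fun p hp t => ?_⟩
  have hp' := norm_pos_iff.mpr hp
  have hδ : 0 < δ := sub_pos.mpr hx.lt_one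
  have hD := hx.phaseD_pos hp t
  have h1 := hx.inv_phaseD_le hp t
  rw [← hδ'] at h1
  have hA := hx.nonneg_acc
  have hu : ‖deriv x t‖ ≤ 1 := (hx.speed t).trans hx.lt_one.le
  have hdd := hx.abs_phaseDD_le p t
  have hddd : |inner ℝ p (deriv (deriv (deriv x)) t)| ≤ ‖p‖ * A :=
    (abs_real_inner_le_norm _ _).trans (mul_le_mul_of_nonneg_left (hx.jerk_le t) (norm_nonneg _))
  have hDi : 0 ≤ (phaseD x p t)⁻¹ := (inv_pos.mpr hD).le
  have b1 : ‖(-inner ℝ p (deriv (deriv (deriv x)) t) * (phaseD x p t)⁻¹ ^ 3 -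
      3 * phaseDD x p t ^ 2 * (phaseD x p t)⁻¹ ^ 4) • deriv x t‖ ≤
      (‖p‖ * A) * (‖p‖ * δ)⁻¹ ^ 3 + 3 * (‖p‖ * A) ^ 2 * (‖p‖ * δ)⁻¹ ^ 4 := by
    rw [norm_smul, Real.norm_eq_abs]
    refine (mul_le_of_le_one_right (abs_nonneg _) hu).trans ((abs_sub _ _).trans ?_)
    rw [abs_mul, abs_mul, abs_mul, abs_neg, abs_pow, abs_pow, abs_pow, abs_of_nonneg hDi,
      abs_of_nonneg (by norm_num : (0 : ℝ) ≤ 3)]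
    gcongr
  have b2 : ‖(3 * phaseDD x p t * (phaseD x p t)⁻¹ ^ 3) • deriv (deriv x) t‖ ≤
      (3 * (‖p‖ * A) * (‖p‖ * δ)⁻¹ ^ 3) * A := by
    rw [norm_smul, Real.norm_eq_abs, abs_mul, abs_mul, abs_pow, abs_of_nonneg hDi,
      abs_of_nonneg (by norm_num : (0 : ℝ) ≤ 3)]
    gcongr
    exact hx.acc_le t
  have b3 : ‖((phaseD x p t)⁻¹ ^ 2) • deriv (deriv (deriv x)) t‖ ≤ (‖p‖ * δ)⁻¹ ^ 2 * A := by
    rw [norm_smul, Real.norm_eq_abs, abs_pow, abs_of_nonneg hDi]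
    gcongr
    exact hx.jerk_le t
  refine (norm_sub_le _ _).trans ((add_le_add ((norm_add_le _ _).trans (add_le_add b1 b2))
    b3).trans (le_of_eq ?_))
  field_simp

end IsScatteringTrajectory

end SourceBounds

/-! ### The amplitude at small and large momenta, and its relation to the cut-off amplitudes -/

section SourceAmplitude

/-- The constant `(2π)^{-3/2}`. -/
def sourceConst : ℝ := (2 * Real.pi) ^ (-(3 / 2) : ℝ)

theorem sourceConst_pos : 0 < sourceConst := Real.rpow_pos_of_pos (by positivity) _

theorem sourceJ_eq (x : ℝ → R3) (p : R3) :
    sourceJ x p = (-(sourceConst : ℂ)) •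
      ∫ t, Complex.exp (Complex.I * (phase x p t : ℂ)) • toC3 (sourceAmp x p t) := by
  rw [sourceJ, smul_smul]
  congr 1
  rw [sourceConst]
  field_simp

theorem norm_exp_I_phase (s : ℝ) : ‖Complex.exp (Complex.I * (s : ℂ))‖ = 1 := by
  rw [mul_comm, Complex.norm_exp_ofReal_mul_I]

/-- The boundary amplitude `v_out / (ω - p · v_out) - v_in / (ω - p · v_in)`. -/
def leadAmp (vin vout p : R3) : R3 :=
  (‖p‖ - inner ℝ p vout)⁻¹ • vout - (‖p‖ - inner ℝ p vin)⁻¹ • vin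

variable {x : ℝ → R3} {vin vout : R3} {v₀ T A X : ℝ}

namespace IsScatteringTrajectory

variable (hx : IsScatteringTrajectory x vin vout v₀ T A X)
include hx

theorem hasDerivAt_exp_smul (p : R3) {Z : ℝ → R3} {Z' : R3} {t : ℝ} (hZ : HasDerivAt Z Z' t) :
    HasDerivAt (fun t => (Complex.exp (Complex.I * (phase x p t : ℂ)) / Complex.I) • toC3 (Z t))
      (Complex.exp (Complex.I * (phase x p t : ℂ)) • toC3 (phaseD x p t • Z t) +
        (Complex.exp (Complex.I * (phase x p t : ℂ)) / Complex.I) • toC3 Z') t := by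
  have h1 := (((hx.hasDerivAt_phase p t).ofReal_comp.const_mul Complex.I).cexp).div_const Complex.I
  have h2 : HasDerivAt (fun t => toC3 (Z t)) (toC3 Z') t :=
    toC3L.hasFDerivAt.comp_hasDerivAt t hZ
  have h3 := h1.smul h2
  convert! h3 using 1
  rw [add_comm]
  congr 1
  have : toC3 (phaseD x p t • Z t) = ((phaseD x p t : ℝ) : ℂ) • toC3 (Z t) := by
    ext j; simp [toC3]
  rw [this, smul_smul]
  congr 1
  field_simp

/-- Integration by parts against `e^{iψ}`. It serves twice: with `Z = x' / ψ_t` for the cut-off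
current, and with the source amplitude divided by `ψ_t` for large momenta. -/
theorem integral_exp_smul (p : R3) {Z Z' : ℝ → R3} (hZ : ∀ t, HasDerivAt Z (Z' t) t)
    (hZ' : Continuous Z') (a b : ℝ) :
    (∫ t in a..b, Complex.exp (Complex.I * (phase x p t : ℂ)) • toC3 (phaseD x p t • Z t)) +
      (∫ t in a..b, (Complex.exp (Complex.I * (phase x p t : ℂ)) / Complex.I) • toC3 (Z' t)) =
      (Complex.exp (Complex.I * (phase x p b : ℂ)) / Complex.I) • toC3 (Z b) -
        (Complex.exp (Complex.I * (phase x p a : ℂ)) / Complex.I) • toC3 (Z a) := by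
  have hZc : Continuous Z := continuous_iff_continuousAt.mpr fun t => (hZ t).continuousAt
  have h1 := hx.continuous_phase p
  have h2 := hx.continuous_phaseD p
  have h3 := continuous_toC3
  have c1 : Continuous fun t =>
      Complex.exp (Complex.I * (phase x p t : ℂ)) • toC3 (phaseD x p t • Z t) := by fun_prop
  have c2 : Continuous fun t =>
      (Complex.exp (Complex.I * (phase x p t : ℂ)) / Complex.I) • toC3 (Z' t) := by fun_prop
  rw [← intervalIntegral.integral_add (c1.intervalIntegrable _ _) (c2.intervalIntegrable _ _)]
  exact intervalIntegral.integral_eq_sub_of_hasDerivAt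
    (fun t _ => hx.hasDerivAt_exp_smul p (hZ t)) ((c1.add c2).intervalIntegrable _ _)

theorem integral_source_eq (p : R3) {R : ℝ} (hR : T ≤ R) :
    ∫ t, Complex.exp (Complex.I * (phase x p t : ℂ)) • toC3 (sourceAmp x p t) =
      ∫ t in (-R)..R, Complex.exp (Complex.I * (phase x p t : ℂ)) • toC3 (sourceAmp x p t) := by
  refine (intervalIntegral.integral_eq_integral_of_support_subset fun t ht => ?_).symm
  by_contra hn
  refine ht ?_
  have : T ≤ |t| := by
    rw [Set.mem_Ioc, not_and_or, not_lt, not_le] at hn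
    rcases hn with h | h
    · exact le_abs.mpr (Or.inr (by linarith))
    · exact le_abs.mpr (Or.inl (by linarith))
  have e0 : toC3 0 = 0 := toC3L.map_zero
  simp only [hx.sourceAmp_eq_zero p this, e0, smul_zero]

theorem exists_norm_sourceJ_le : ∃ K : ℝ, 0 < K ∧ ∀ p, p ≠ 0 → ‖sourceJ x p‖ ≤ K * ‖p‖⁻¹ := by
  set K₁ := A / (1 - v₀) ^ 2 + A / (1 - v₀)
  have hδ : 0 < 1 - v₀ := sub_pos.mpr hx.lt_one
  have hA := hx.nonneg_acc
  have hT := hx.pos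
  have hK₁ : 0 ≤ K₁ := by positivity
  -- The summand 1 keeps the constant positive when `A = 0`, that is, without acceleration.
  refine ⟨sourceConst * (K₁ * (2 * T)) + 1, by have := sourceConst_pos; positivity, fun p hp => ?_⟩
  rw [sourceJ_eq, norm_smul, norm_neg, Complex.norm_real, Real.norm_of_nonneg sourceConst_pos.le,
    hx.integral_source_eq p le_rfl]
  have h := intervalIntegral.norm_integral_le_of_norm_le_const (a := -T) (b := T)
    (f := fun t => Complex.exp (Complex.I * (phase x p t : ℂ)) • toC3 (sourceAmp x p t))
    (C := K₁ * ‖p‖⁻¹) fun t _ => by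
      rw [norm_smul, norm_exp_I_phase, one_mul, norm_toC3]
      exact hx.norm_sourceAmp_le hp t
  rw [sub_neg_eq_add, ← two_mul, abs_of_pos (by positivity)] at h
  calc _ ≤ sourceConst * (K₁ * ‖p‖⁻¹ * (2 * T)) := by gcongr; exact sourceConst_pos.le
    _ = sourceConst * (K₁ * (2 * T)) * ‖p‖⁻¹ := by ring
    _ ≤ _ := by gcongr; linarith

theorem exists_norm_sourceJ_le_sq :
    ∃ K : ℝ, ∀ p, p ≠ 0 → ‖sourceJ x p‖ ≤ K * (‖p‖ ^ 2)⁻¹ := by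
  obtain ⟨K, hK⟩ := hx.exists_norm_deriv_sourceAmp_div_le
  have hT := hx.pos
  refine ⟨sourceConst * (K * (2 * T)), fun p hp => ?_⟩
  rw [sourceJ_eq, norm_smul, norm_neg, Complex.norm_real, Real.norm_of_nonneg sourceConst_pos.le,
    hx.integral_source_eq p le_rfl]
  have hc : Continuous fun t =>
      (-inner ℝ p (deriv (deriv (deriv x)) t) * (phaseD x p t)⁻¹ ^ 3 -
          3 * phaseDD x p t ^ 2 * (phaseD x p t)⁻¹ ^ 4) • deriv x t +
        (3 * phaseDD x p t * (phaseD x p t)⁻¹ ^ 3) • deriv (deriv x) t -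
        ((phaseD x p t)⁻¹ ^ 2) • deriv (deriv (deriv x)) t := by
    have h1 := hx.continuous_vel
    have h2 := hx.continuous_acc
    have h3 := hx.continuous_phaseD p
    have h4 := hx.continuous_phaseDD p
    have h6 := hx.continuous_jerk
    have h5 : ∀ t, phaseD x p t ≠ 0 := fun t => (hx.phaseD_pos hp t).ne'
    fun_prop (disch := simp [h5])
  have h := hx.integral_exp_smul p (hx.hasDerivAt_sourceAmp_div hp) hc (-T) T
  -- The source amplitude vanishes at `±T`, so this integration by parts has no boundary terms.
  rw [hx.sourceAmp_eq_zero p (le_abs_self T),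
    hx.sourceAmp_eq_zero p (t := -T) (by rw [abs_neg]; exact le_abs_self T)] at h
  have e0 : toC3 0 = 0 := toC3L.map_zero
  simp only [smul_zero, e0, sub_zero, smul_smul,
    mul_inv_cancel₀ (hx.phaseD_pos hp _).ne', one_smul] at h
  rw [eq_neg_of_add_eq_zero_left h, norm_neg]
  refine (mul_le_mul_of_nonneg_left (intervalIntegral.norm_integral_le_of_norm_le_const
    (C := K * (‖p‖ ^ 2)⁻¹) fun t _ => ?_) sourceConst_pos.le).trans (le_of_eq ?_)
  · rw [norm_smul, norm_div, norm_exp_I_phase, Complex.norm_I, div_one, one_mul, norm_toC3]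
    exact hK p hp t
  · rw [sub_neg_eq_add, ← two_mul, abs_of_pos (by positivity)]
    ring

/-- Replacing `e^{iψ}` by 1 costs `|ψ| ≤ |p| (T + X)` on `[-T, T]`, which cancels the `1/|p|` of the
amplitude. What remains is the integral of a total derivative, evaluated at `±T`. -/
theorem exists_norm_sourceJ_sub_le : ∃ M : ℝ, 0 < M ∧ ∀ p, p ≠ 0 →
    ‖sourceJ x p - (sourceConst : ℂ) • toC3 (leadAmp vin vout p)‖ ≤ M := by
  set K₁ := A / (1 - v₀) ^ 2 + A / (1 - v₀) with hK₁'
  have hδ : 0 < 1 - v₀ := sub_pos.mpr hx.lt_one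
  have hA := hx.nonneg_acc
  have hT := hx.pos
  have hκ := sourceConst_pos
  have hK₁ : 0 ≤ K₁ := by positivity
  have hX : 0 ≤ X := (norm_nonneg _).trans (hx.norm_le 0 ⟨by linarith, by linarith⟩)
  refine ⟨sourceConst * (K₁ * (T + X) * (2 * T)) + 1, by positivity, fun p hp => ?_⟩
  have hp' := norm_pos_iff.mpr hp
  have hG := hx.continuous_sourceAmp hp
  have h1 := hx.continuous_phase p
  have h3 := continuous_toC3
  have hlead : toC3 (leadAmp vin vout p) = -∫ t in (-T)..T, toC3 (sourceAmp x p t) := by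
    have h := intervalIntegral.integral_eq_sub_of_hasDerivAt (a := -T) (b := T)
      (fun t _ => hx.hasDerivAt_vel_div hp t) (hG.neg.intervalIntegrable _ _)
    rw [intervalIntegral.integral_neg, phaseD, phaseD, hx.eq_out T le_rfl,
      hx.eq_in (-T) le_rfl] at h
    change _ = leadAmp vin vout p at h
    rw [← h, ← toC3L_apply, map_neg,
      ← ContinuousLinearMap.intervalIntegral_comp_comm toC3L (hG.intervalIntegrable _ _)]
    rfl
  rw [sourceJ_eq, hx.integral_source_eq p le_rfl, hlead, smul_neg, ← neg_smul, ← smul_sub,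
    ← intervalIntegral.integral_sub (Continuous.intervalIntegrable (by fun_prop) _ _)
      (Continuous.intervalIntegrable (by fun_prop) _ _), norm_smul, norm_neg, Complex.norm_real,
    Real.norm_of_nonneg hκ.le]
  have h := intervalIntegral.norm_integral_le_of_norm_le_const (a := -T) (b := T)
    (f := fun t => Complex.exp (Complex.I * (phase x p t : ℂ)) • toC3 (sourceAmp x p t) -
      toC3 (sourceAmp x p t))
    (C := K₁ * (T + X)) fun t ht => by
      rw [Set.uIoc_of_le (by linarith)] at ht
      have e : Complex.exp (Complex.I * (phase x p t : ℂ)) • toC3 (sourceAmp x p t) -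
          toC3 (sourceAmp x p t) =
          (Complex.exp (Complex.I * (phase x p t : ℂ)) - 1) • toC3 (sourceAmp x p t) := by
        rw [sub_smul, one_smul]
      rw [e, norm_smul, norm_toC3]
      have e1 : ‖Complex.exp (Complex.I * (phase x p t : ℂ)) - 1‖ ≤ ‖p‖ * (T + X) := by
        refine (Real.norm_exp_I_mul_ofReal_sub_one_le).trans ?_
        rw [Real.norm_eq_abs, phase]
        refine (abs_sub _ _).trans ?_
        rw [abs_mul, abs_of_pos hp', mul_add]
        refine add_le_add (mul_le_mul_of_nonneg_left (abs_le.mpr ⟨ht.1.le, ht.2⟩) hp'.le) ?_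
        exact (abs_real_inner_le_norm _ _).trans
          (mul_le_mul_of_nonneg_left (hx.norm_le t ⟨ht.1.le, ht.2⟩) hp'.le)
      calc _ ≤ (‖p‖ * (T + X)) * (K₁ * ‖p‖⁻¹) :=
            mul_le_mul e1 (hx.norm_sourceAmp_le hp t) (norm_nonneg _) (by positivity)
        _ = _ := by field_simp
  rw [sub_neg_eq_add, ← two_mul, abs_of_pos (by positivity)] at h
  refine (mul_le_mul_of_nonneg_left h hκ.le).trans ?_
  linarith

/-- Integration by parts on `[-R, R]`: the bulk term no longer depends on `R` once `R ≥ T`, so all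
dependence on the cut-off sits in the two boundary terms. -/
theorem cutoffJ_eq {p : R3} (hp : p ≠ 0) {R : ℝ} (hR : T ≤ R) :
    cutoffJ x R p = sourceJ x p - (sourceConst : ℂ) •
      (Complex.exp (Complex.I * (phase x p R : ℂ)) •
          toC3 ((‖p‖ - inner ℝ p vout)⁻¹ • vout) -
        Complex.exp (Complex.I * (phase x p (-R) : ℂ)) •
          toC3 ((‖p‖ - inner ℝ p vin)⁻¹ • vin)) := by
  have h := hx.integral_exp_smul p (hx.hasDerivAt_vel_div hp) (hx.continuous_sourceAmp hp).neg
    (-R) R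
  simp only [smul_smul, mul_inv_cancel₀ (hx.phaseD_pos hp _).ne', one_smul] at h
  have e1 : (∫ t in (-R)..R, (Complex.exp (Complex.I * (phase x p t : ℂ)) / Complex.I) •
      toC3 (-sourceAmp x p t)) = (-(1 / Complex.I)) •
        ∫ t, Complex.exp (Complex.I * (phase x p t : ℂ)) • toC3 (sourceAmp x p t) := by
    rw [hx.integral_source_eq p hR, ← intervalIntegral.integral_smul]
    refine intervalIntegral.integral_congr fun t _ => ?_
    have : toC3 (-sourceAmp x p t) = -toC3 (sourceAmp x p t) := toC3L.map_neg _
    simp only [this]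
    rw [smul_neg, neg_smul, smul_smul, one_div, mul_comm Complex.I⁻¹, ← div_eq_mul_inv]
  rw [e1] at h
  have h2 := eq_sub_of_add_eq h
  rw [cutoffJ, h2, sourceJ_eq, phaseD, phaseD, hx.eq_out R hR, hx.eq_in (-R) (by linarith)]
  change (-Complex.I * ((sourceConst : ℝ) : ℂ)) • _ = _
  simp only [smul_sub, smul_smul]
  have e2 : ∀ z : ℂ, -Complex.I * (sourceConst : ℂ) * (z / Complex.I) = -((sourceConst : ℂ) * z) := by
    intro z; field_simp
  have e3 : -Complex.I * (sourceConst : ℂ) * -(1 / Complex.I) = (sourceConst : ℂ) := by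
    field_simp
  simp only [e2, neg_smul, e3]
  module

/-- The trajectory is affine after `T`. The phase splits into `R` times a function homogeneous of
degree one in `p`, as the Riemann-Lebesgue lemma along rays needs, and a part independent of `R`. -/
theorem phase_out {R : ℝ} (hR : T ≤ R) (p : R3) :
    phase x p R = R * (‖p‖ - inner ℝ p vout) - inner ℝ p (x T - T • vout) := by
  have h := intervalIntegral.integral_eq_sub_of_hasDerivAt (a := T) (b := R)
    (fun t _ => hx.hasDerivAt_pos t) (hx.continuous_vel.intervalIntegrable _ _)
  have h2 : (∫ t in T..R, deriv x t) = ∫ _ in T..R, vout := by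
    refine intervalIntegral.integral_congr fun t ht => ?_
    rw [Set.uIcc_of_le hR] at ht
    exact hx.eq_out t ht.1
  rw [h2, intervalIntegral.integral_const] at h
  rw [phase, eq_add_of_sub_eq h.symm, inner_add_right, inner_sub_right, inner_smul_right,
    inner_smul_right]
  ring

theorem phase_in {R : ℝ} (hR : T ≤ R) (p : R3) :
    phase x p (-R) = R * (-(‖p‖ - inner ℝ p vin)) - inner ℝ p (x (-T) + T • vin) := by
  have h := intervalIntegral.integral_eq_sub_of_hasDerivAt (a := -R) (b := -T)
    (fun t _ => hx.hasDerivAt_pos t) (hx.continuous_vel.intervalIntegrable _ _)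
  have h2 : (∫ t in (-R)..(-T), deriv x t) = ∫ _ in (-R)..(-T), vin := by
    refine intervalIntegral.integral_congr fun t ht => ?_
    rw [Set.uIcc_of_le (by linarith)] at ht
    exact hx.eq_in t ht.2
  rw [h2, intervalIntegral.integral_const] at h
  have h3 : x (-R) = x (-T) - (-T - -R) • vin := by rw [h]; abel
  rw [phase, h3, inner_add_right, inner_sub_right, inner_smul_right, inner_smul_right]
  ring

theorem measurable_sourceJ : Measurable (sourceJ x) := by
  have h1 := hx.continuous_vel
  have h2 := hx.continuous_acc
  have h3 := hx.continuous_pos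
  have h4 := continuous_toC3.measurable
  have h : StronglyMeasurable fun q : R3 × ℝ =>
      Complex.exp (Complex.I * (phase x q.1 q.2 : ℂ)) • toC3 (sourceAmp x q.1 q.2) := by
    refine Measurable.stronglyMeasurable ?_
    unfold phase sourceAmp phaseD phaseDD
    fun_prop
  have h5 := h.integral_prod_right' (ν := volume)
  have h6 : sourceJ x = fun p => (-(sourceConst : ℂ)) •
      ∫ t, Complex.exp (Complex.I * (phase x p t : ℂ)) • toC3 (sourceAmp x p t) :=
    funext (sourceJ_eq x)
  rw [h6]
  exact (h5.const_smul (-(sourceConst : ℂ))).measurable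

theorem measurable_sourceJT : Measurable (sourceJT x) :=
  measurable_transverseProj hx.measurable_sourceJ

end IsScatteringTrajectory

end SourceAmplitude

/-! ### Square integrals over momentum shells -/

section ShellBounds

theorem memLp_two_iff_lintegral {f : R3 → C3} (hf : AEStronglyMeasurable f photonMeasure) :
    MemLp f 2 photonMeasure ↔ ∫⁻ p, ‖f p‖ₑ ^ 2 ∂photonMeasure < ∞ := by
  have h := eLpNorm_lt_top_iff_lintegral_rpow_enorm_lt_top (f := f) (p := 2) (μ := photonMeasure)
    two_ne_zero ENNReal.ofNat_ne_top
  simp only [ENNReal.toReal_ofNat, ENNReal.rpow_ofNat] at h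
  exact ⟨fun hm => h.mp hm.2, fun hl => ⟨hf, h.mpr hl⟩⟩

theorem lintegral_sq_shell_le {f : R3 → C3} {g : ℝ → ℝ} (hg : Measurable g) {I : Set ℝ}
    (hI : MeasurableSet I) (h : ∀ p, p ≠ 0 → ‖p‖ ∈ I → ‖f p‖ ≤ g ‖p‖) :
    ∫⁻ p in {p : R3 | ‖p‖ ∈ I}, ‖f p‖ₑ ^ 2 ∂photonMeasure ≤
      (∫⁻ r in Set.Ioi (0 : ℝ) ∩ I, ENNReal.ofReal (r / 2 * g r ^ 2)) *
        (volume : Measure R3).toSphere Set.univ := by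
  have h1 := lintegral_photonMeasure_radial (g := fun r => ENNReal.ofReal (g r ^ 2))
    (by fun_prop) hI
  refine (setLIntegral_mono_ae' (measurable_norm hI) ?_).trans (h1.trans_le ?_)
  · refine ae_photonMeasure_of_ne_zero fun p hp hpI => ?_
    rw [← ofReal_norm, ← ENNReal.ofReal_pow (norm_nonneg _)]
    exact ENNReal.ofReal_le_ofReal (pow_le_pow_left₀ (norm_nonneg _) (h p hp hpI) 2)
  · refine mul_le_mul_left ?_ _
    refine le_of_eq (setLIntegral_congr_fun (measurableSet_Ioi.inter hI) fun r hr => ?_)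
    have hr : 0 < r := hr.1
    exact (ENNReal.ofReal_mul (by positivity)).symm

/-- The radial integrand is at most `(r / 2) (K / r)² = K² / (2r)`. -/
theorem lintegral_sq_shell_le_log {f : R3 → C3} {K : ℝ} (hK : ∀ p, p ≠ 0 → ‖f p‖ ≤ K * ‖p‖⁻¹)
    {a b : ℝ} (ha : 0 < a) (hab : a ≤ b) :
    ∫⁻ p in {p : R3 | a ≤ ‖p‖ ∧ ‖p‖ ≤ b}, ‖f p‖ₑ ^ 2 ∂photonMeasure ≤
      ENNReal.ofReal (K ^ 2 / 2 * ((volume : Measure R3).toSphere Set.univ).toReal *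
        Real.log (b / a)) := by
  refine (lintegral_sq_shell_le (g := fun r => K * r⁻¹) (by fun_prop) (measurableSet_Icc (a := a)
    (b := b)) fun p hp _ => hK p hp).trans ?_
  have h1 : Set.Ioi (0 : ℝ) ∩ Set.Icc a b = Set.Icc a b :=
    Set.inter_eq_right.mpr fun r hr => ha.trans_le hr.1
  have h2 : ∫⁻ r in Set.Icc a b, ENNReal.ofReal (r / 2 * (K * r⁻¹) ^ 2) =
      ENNReal.ofReal (K ^ 2 / 2) * ENNReal.ofReal (Real.log (b / a)) := by
    rw [← lintegral_Icc_inv ha hab, ← lintegral_const_mul' _ _ ENNReal.ofReal_ne_top]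
    refine setLIntegral_congr_fun measurableSet_Icc fun r hr => ?_
    have hr : 0 < r := ha.trans_le hr.1
    rw [← ENNReal.ofReal_mul (by positivity)]
    congr 1
    field_simp
  have hlog : 0 ≤ Real.log (b / a) := Real.log_nonneg ((one_le_div ha).mpr hab)
  rw [h1, h2, mul_right_comm, ENNReal.ofReal_mul (by positivity), ENNReal.ofReal_mul (by positivity),
    ENNReal.ofReal_toReal (measure_ne_top _ _)]

theorem lintegral_sq_outside_lt_top {f : R3 → C3} {K : ℝ}
    (hK : ∀ p, p ≠ 0 → ‖f p‖ ≤ K * (‖p‖ ^ 2)⁻¹) :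
    ∫⁻ p in {p : R3 | 1 ≤ ‖p‖}, ‖f p‖ₑ ^ 2 ∂photonMeasure < ∞ := by
  refine (lintegral_sq_shell_le (g := fun r => K * (r ^ 2)⁻¹) (by fun_prop)
    (measurableSet_Ici (a := (1 : ℝ))) fun p hp _ => hK p hp).trans_lt
    (ENNReal.mul_lt_top ?_ (measure_lt_top _ _))
  have h2 : Integrable fun r : ℝ => K ^ 2 * (1 + r ^ 2)⁻¹ :=
    integrable_inv_one_add_sq.const_mul (K ^ 2)
  refine lt_of_le_of_lt ?_ h2.hasFiniteIntegral
  refine (setLIntegral_mono' (measurableSet_Ioi.inter measurableSet_Ici) fun r hr => ?_).trans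
    (setLIntegral_le_lintegral _ _)
  have hr : 1 ≤ r := hr.2
  rw [← ofReal_norm, Real.norm_of_nonneg (by positivity)]
  refine ENNReal.ofReal_le_ofReal ?_
  -- The radial tail `r⁻³ / 2` is compared with the integrable `(1 + r²)⁻¹`; for `r ≥ 1` one has `2
  -- r³ ≥ 2 r² ≥ 1 + r²`.
  have h3 : (2 * r ^ 3)⁻¹ ≤ (1 + r ^ 2)⁻¹ := by
    refine inv_anti₀ (by positivity) ?_
    nlinarith [mul_nonneg (sq_nonneg r) (sub_nonneg.mpr hr)]
  calc r / 2 * (K * (r ^ 2)⁻¹) ^ 2 = K ^ 2 * (2 * r ^ 3)⁻¹ := by field_simp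
    _ ≤ _ := mul_le_mul_of_nonneg_left h3 (sq_nonneg K)

theorem lintegral_sq_inside_lt_top {f : R3 → C3} {K : ℝ} (hK : ∀ p, p ≠ 0 → ‖f p‖ ≤ K) :
    ∫⁻ p in {p : R3 | ‖p‖ ≤ 1}, ‖f p‖ₑ ^ 2 ∂photonMeasure < ∞ := by
  refine (lintegral_sq_shell_le (g := fun _ => K) (by fun_prop)
    (measurableSet_Iic (a := (1 : ℝ))) fun p hp _ => hK p hp).trans_lt
    (ENNReal.mul_lt_top ?_ (measure_lt_top _ _))
  refine (setLIntegral_mono' (g := fun _ => ENNReal.ofReal (K ^ 2))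
    (measurableSet_Ioi.inter measurableSet_Iic) fun r hr => ?_).trans_lt ?_
  · have hr0 : 0 < r := hr.1
    have hr1 : r ≤ 1 := hr.2
    refine ENNReal.ofReal_le_ofReal ?_
    nlinarith [sq_nonneg K]
  · rw [setLIntegral_const, Set.Ioi_inter_Iic, Real.volume_Ioc]
    exact ENNReal.mul_lt_top ENNReal.ofReal_lt_top ENNReal.ofReal_lt_top

/-- A lower bound `δ / |p|` in an open cone gives a logarithmic divergence at `p = 0`. -/
theorem le_lintegral_sq_shell_of_cone {f : R3 → C3} (hf : Measurable f)
    {O : Set (Metric.sphere (0 : R3) 1)} (hO : IsOpen O) (hne : O.Nonempty) {δ r₀ : ℝ} (hδ : 0 < δ)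
    (hr₀ : 0 < r₀) (hr₁ : r₀ ≤ 1)
    (h : ∀ n ∈ O, ∀ r : ℝ, 0 < r → r ≤ r₀ → δ * r⁻¹ ≤ ‖f (r • (n : R3))‖) :
    ∃ c > 0, ∃ ε₀ > 0, ∀ ε : ℝ, 0 < ε → ε < ε₀ →
      ENNReal.ofReal (c * Real.log (1 / ε)) ≤
        ∫⁻ p in {p : R3 | ε ≤ ‖p‖ ∧ ‖p‖ ≤ 1}, ‖f p‖ₑ ^ 2 ∂photonMeasure := by
  set σ := (volume : Measure R3).toSphere O with hσ
  have hσ0 : 0 < σ := hO.measure_pos _ hne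
  have hσt : σ ≠ ∞ := measure_ne_top _ _
  have hσr : 0 < σ.toReal := ENNReal.toReal_pos hσ0.ne' hσt
  -- The cone gives `(δ² / 2) σ log (r₀ / ε)`. For `ε < r₀²` this logarithm is at least half of `log
  -- (1 / ε)`, whence the threshold `r₀²` and the constant `δ² / 4`.
  refine ⟨δ ^ 2 / 4 * σ.toReal, by positivity, r₀ ^ 2, by positivity, fun ε hε hεr => ?_⟩
  have hε₀ : ε ≤ r₀ := by nlinarith
  have hS : MeasurableSet {p : R3 | ε ≤ ‖p‖ ∧ ‖p‖ ≤ 1} :=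
    measurable_norm (measurableSet_Icc (a := ε) (b := 1))
  have hlog : Real.log (1 / ε) ≤ 2 * Real.log (r₀ / ε) := by
    have e1 : Real.log (1 / ε) = -Real.log ε := by rw [one_div, Real.log_inv]
    have e2 : Real.log (r₀ / ε) = Real.log r₀ - Real.log ε := Real.log_div hr₀.ne' hε.ne'
    have e3 : Real.log ε ≤ 2 * Real.log r₀ := by
      have := Real.log_le_log hε hεr.le
      rwa [Real.log_pow, Nat.cast_ofNat] at this
    linarith
  have hlog0 : 0 ≤ Real.log (r₀ / ε) := Real.log_nonneg ((one_le_div hε).mpr hε₀)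
  rw [← lintegral_indicator hS, lintegral_photonMeasure
    (Measurable.indicator (f := fun p => ‖f p‖ₑ ^ 2) (by fun_prop) hS)]
  calc ENNReal.ofReal (δ ^ 2 / 4 * σ.toReal * Real.log (1 / ε))
      ≤ ENNReal.ofReal (δ ^ 2 / 2 * Real.log (r₀ / ε) * σ.toReal) := by
        refine ENNReal.ofReal_le_ofReal ?_
        nlinarith [mul_le_mul_of_nonneg_left hlog (by positivity : 0 ≤ δ ^ 2 / 4 * σ.toReal)]
    _ = ENNReal.ofReal (δ ^ 2 / 2) * ENNReal.ofReal (Real.log (r₀ / ε)) * σ := by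
        rw [ENNReal.ofReal_mul (by positivity), ENNReal.ofReal_mul (by positivity),
          ENNReal.ofReal_toReal hσt]
    _ = ∫⁻ _ in O, ENNReal.ofReal (δ ^ 2 / 2) * ENNReal.ofReal (Real.log (r₀ / ε))
          ∂(volume : Measure R3).toSphere := (setLIntegral_const _ _).symm
    _ ≤ ∫⁻ n in O, (∫⁻ r in Set.Ioi (0 : ℝ), ENNReal.ofReal (r / 2) *
          {p : R3 | ε ≤ ‖p‖ ∧ ‖p‖ ≤ 1}.indicator (fun p => ‖f p‖ₑ ^ 2) (r • (n : R3)))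
          ∂(volume : Measure R3).toSphere := by
        refine setLIntegral_mono' hO.measurableSet fun n hn => ?_
        rw [← lintegral_Icc_inv hε hε₀, ← lintegral_const_mul' _ _ ENNReal.ofReal_ne_top]
        refine le_trans ?_ (lintegral_mono_set (s := Set.Icc ε r₀) fun r hr => hε.trans_le hr.1)
        refine setLIntegral_mono' measurableSet_Icc fun r hr => ?_
        have hr0 : 0 < r := hε.trans_le hr.1
        have hn' : ‖r • (n : R3)‖ = r := by
          rw [norm_smul, norm_eq_of_mem_sphere, Real.norm_of_nonneg hr0.le, mul_one]
        rw [Set.indicator_of_mem (by rw [Set.mem_ofPred_eq, hn']; exact ⟨hr.1, hr.2.trans hr₁⟩),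
          ← ofReal_norm, ← ENNReal.ofReal_pow (norm_nonneg _),
          ← ENNReal.ofReal_mul (by positivity), ← ENNReal.ofReal_mul (by positivity)]
        refine ENNReal.ofReal_le_ofReal ?_
        calc δ ^ 2 / 2 * r⁻¹ = r / 2 * (δ * r⁻¹) ^ 2 := by field_simp
          _ ≤ r / 2 * ‖f (r • (n : R3))‖ ^ 2 := by
            gcongr
            exact h n hn r hr0 hr.2
    _ ≤ _ := setLIntegral_le_lintegral _ _

end ShellBounds

/-! ### Infrared behaviour of the transverse amplitude and square integrability -/

section Divergence

/-- Two vectors cannot span a three-dimensional space. Orthogonality to both velocities reduces both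
denominators of the boundary amplitude to `|p|` and makes it transverse. -/
theorem exists_unit_orthogonal (v w : R3) : ∃ n : R3, ‖n‖ = 1 ∧ inner ℝ n v = 0 ∧ inner ℝ n w = 0 := by
  have h1 : (Submodule.span ℝ {v, w})ᗮ ≠ ⊥ := by
    intro h
    rw [Submodule.orthogonal_eq_bot_iff] at h
    have h2 : Module.finrank ℝ (Submodule.span ℝ ({v, w} : Set R3)) ≤ 2 := by
      classical
      have := finrank_span_finset_le_card (R := ℝ) ({v, w} : Finset R3)
      rw [Finset.coe_pair] at this
      exact this.trans Finset.card_le_two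
    rw [h, finrank_top] at h2
    simp at h2
  obtain ⟨n, hn, hn0⟩ := Submodule.exists_mem_ne_zero_of_ne_bot h1
  rw [Submodule.mem_orthogonal'] at hn
  refine ⟨‖n‖⁻¹ • n, norm_smul_inv_norm hn0, ?_, ?_⟩
  · rw [inner_smul_left, hn v (Submodule.subset_span (by simp)), mul_zero]
  · rw [inner_smul_left, hn w (Submodule.subset_span (by simp)), mul_zero]

theorem leadAmp_smul (vin vout p : R3) {r : ℝ} (hr : 0 < r) :
    leadAmp vin vout (r • p) = r⁻¹ • leadAmp vin vout p := by
  simp only [leadAmp, norm_smul, inner_smul_left, Real.norm_of_nonneg hr.le, smul_sub, smul_smul,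
    ← mul_inv, conj_trivial, mul_sub]

variable {x : ℝ → R3} {vin vout : R3} {v₀ T A X : ℝ}

theorem sphere_sub_inner_pos {v : R3} (hv : ‖v‖ < 1) (n : Metric.sphere (0 : R3) 1) :
    0 < ‖(n : R3)‖ - inner ℝ (n : R3) v := by
  have := real_inner_le_norm (n : R3) v
  rw [norm_eq_of_mem_sphere] at this ⊢
  linarith

theorem continuous_norm_transverseProj_leadAmp (hin : ‖vin‖ < 1) (hout : ‖vout‖ < 1) :
    Continuous fun n : Metric.sphere (0 : R3) 1 =>
      ‖transverseProj (n : R3) (toC3 (leadAmp vin vout n))‖ := by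
  have h3 := continuous_toC3
  have h1 := fun n => (sphere_sub_inner_pos hin n).ne'
  have h2 := fun n => (sphere_sub_inner_pos hout n).ne'
  simp only [transverseProj_eq, leadAmp, norm_eq_of_mem_sphere] at h1 h2 ⊢
  fun_prop (disch := simpa using by assumption)

namespace IsScatteringTrajectory

variable (hx : IsScatteringTrajectory x vin vout v₀ T A X)
include hx

/-- In a direction orthogonal to both velocities the boundary amplitude is the transverse vector
`vout - vin`. By continuity its projection stays larger than half of that in nearby directions, and
scaling by `1/r` lets it dominate the bounded remainder. -/
theorem exists_cone (hne : vin ≠ vout) : ∃ O : Set (Metric.sphere (0 : R3) 1), IsOpen O ∧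
    O.Nonempty ∧ ∃ δ > 0, ∃ r₀ > 0, r₀ ≤ 1 ∧
      ∀ n ∈ O, ∀ r : ℝ, 0 < r → r ≤ r₀ → δ * r⁻¹ ≤ ‖sourceJT x (r • (n : R3))‖ := by
  obtain ⟨M, hM0, hM⟩ := hx.exists_norm_sourceJ_sub_le
  set d := ‖vout - vin‖ with hd
  have hd0 : 0 < d := norm_pos_iff.mpr (sub_ne_zero.mpr hne.symm)
  have hκ := sourceConst_pos
  obtain ⟨n₀, hn₀, hi1, hi2⟩ := exists_unit_orthogonal vin vout
  -- The main term is at least `sourceConst * d / (2 r)` and the projected error at most `2 * M`.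
  -- The bound on `r₀` makes the error at most half of the main term, leaving `sourceConst * d / (4
  -- r)`.
  refine ⟨{n | d / 2 < ‖transverseProj (n : R3) (toC3 (leadAmp vin vout n))‖},
    isOpen_lt continuous_const (continuous_norm_transverseProj_leadAmp
      (hx.norm_in_le.trans_lt hx.lt_one) (hx.norm_out_le.trans_lt hx.lt_one)),
    ⟨⟨n₀, by simpa using hn₀⟩, ?_⟩, sourceConst * d / 4, by positivity,
    min 1 (sourceConst * d / (8 * M)), by positivity, min_le_left _ _, fun n hn r hr hrr => ?_⟩
  · have h1 : leadAmp vin vout n₀ = vout - vin := by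
      simp [leadAmp, hn₀, hi1, hi2]
    have h2 : (inner ℂ (toC3 n₀) (toC3 (vout - vin)) : ℂ) = ((inner ℝ n₀ (vout - vin) : ℝ) : ℂ) := by
      simp [PiLp.inner_apply, toC3]
    have h3 : inner ℝ n₀ (vout - vin) = 0 := by rw [inner_sub_right, hi1, hi2, sub_zero]
    rw [Set.mem_ofPred_eq, h1, transverseProj_eq, h2, h3]
    simp only [Complex.ofReal_zero, mul_zero, zero_smul, sub_zero, norm_toC3]
    linarith
  · have hn0 : (n : R3) ≠ 0 := by
      intro h; have := norm_eq_of_mem_sphere n; rw [h, norm_zero] at this; norm_num at this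
    have hrn : r • (n : R3) ≠ 0 := smul_ne_zero hr.ne' hn0
    have e1 : sourceJT x (r • (n : R3)) =
        ((sourceConst * r⁻¹ : ℝ) : ℂ) • transverseProj (n : R3) (toC3 (leadAmp vin vout n)) +
        transverseProj (r • (n : R3)) (sourceJ x (r • (n : R3)) -
          (sourceConst : ℂ) • toC3 (leadAmp vin vout (r • (n : R3)))) := by
      have e2 : toC3 (r⁻¹ • leadAmp vin vout n) = (r⁻¹ : ℂ) • toC3 (leadAmp vin vout n) := by
        ext j; simp [toC3]
      rw [transverseProj_sub, leadAmp_smul _ _ _ hr, transverseProj_smul, e2, transverseProj_smul,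
        transverseProj_smul_left hr.ne' _ (toC3 _), sourceJT, smul_smul]
      push_cast
      abel
    have e3 := (norm_transverseProj_le (r • (n : R3)) _).trans
      (mul_le_mul_of_nonneg_left (hM _ hrn) zero_le_two)
    have e4 := norm_sub_le_norm_add (((sourceConst * r⁻¹ : ℝ) : ℂ) •
      transverseProj (n : R3) (toC3 (leadAmp vin vout n)))
      (transverseProj (r • (n : R3)) (sourceJ x (r • (n : R3)) -
          (sourceConst : ℂ) • toC3 (leadAmp vin vout (r • (n : R3)))))
    rw [← e1, norm_smul, Complex.norm_real, Real.norm_of_nonneg (by positivity)] at e4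
    have e5 : sourceConst * r⁻¹ * (d / 2) ≤
        sourceConst * r⁻¹ * ‖transverseProj (n : R3) (toC3 (leadAmp vin vout n))‖ := by
      have : d / 2 < ‖transverseProj (n : R3) (toC3 (leadAmp vin vout n))‖ := hn
      gcongr
    have e6 : 2 * M ≤ sourceConst * d / 4 * r⁻¹ := by
      have h7 : r ≤ sourceConst * d / (8 * M) := hrr.trans (min_le_right _ _)
      rw [le_div_iff₀ (by positivity)] at h7
      rw [← div_eq_mul_inv, le_div_iff₀ hr]
      linarith
    have e7 : sourceConst * r⁻¹ * (d / 2) =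
        sourceConst * d / 4 * r⁻¹ + sourceConst * d / 4 * r⁻¹ := by ring
    linarith

theorem exists_norm_sourceJT_le :
    ∃ K : ℝ, 0 < K ∧ ∀ p, p ≠ 0 → ‖sourceJT x p‖ ≤ K * ‖p‖⁻¹ := by
  obtain ⟨K, hK0, hK⟩ := hx.exists_norm_sourceJ_le
  refine ⟨2 * K, by positivity, fun p hp => (norm_transverseProj_le _ _).trans ?_⟩
  rw [mul_assoc]
  gcongr
  exact hK p hp

theorem lintegral_outside_lt_top :
    ∫⁻ p in {p : R3 | 1 ≤ ‖p‖}, ‖sourceJT x p‖ₑ ^ 2 ∂photonMeasure < ∞ := by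
  obtain ⟨K, hK⟩ := hx.exists_norm_sourceJ_le_sq
  refine lintegral_sq_outside_lt_top (K := 2 * K) fun p hp => (norm_transverseProj_le _ _).trans ?_
  rw [mul_assoc]
  gcongr
  exact hK p hp

theorem log_divergence (hne : vin ≠ vout) :
    ∃ c > 0, ∃ C > 0, ∃ ε₀ > 0, ∀ ε : ℝ, 0 < ε → ε < ε₀ →
      ENNReal.ofReal (c * Real.log (1 / ε)) ≤
        ∫⁻ p in {p : R3 | ε ≤ ‖p‖ ∧ ‖p‖ ≤ 1}, ‖sourceJT x p‖ₑ ^ 2 ∂photonMeasure ∧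
      (∫⁻ p in {p : R3 | ε ≤ ‖p‖ ∧ ‖p‖ ≤ 1}, ‖sourceJT x p‖ₑ ^ 2 ∂photonMeasure) ≤
        ENNReal.ofReal (C * Real.log (1 / ε)) := by
  obtain ⟨O, hO, hOn, δ, hδ, r₀, hr₀, hr₁, hcone⟩ := hx.exists_cone hne
  obtain ⟨c, hc, ε₀, hε₀, hlow⟩ := le_lintegral_sq_shell_of_cone hx.measurable_sourceJT hO hOn hδ
    hr₀ hr₁ hcone
  obtain ⟨K, hK0, hK⟩ := hx.exists_norm_sourceJT_le
  have hσ : 0 < ((volume : Measure R3).toSphere Set.univ).toReal :=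
    ENNReal.toReal_pos ((hO.measure_pos _ hOn).trans_le (measure_mono (Set.subset_univ _))).ne'
      (measure_ne_top _ _)
  refine ⟨c, hc, K ^ 2 / 2 * ((volume : Measure R3).toSphere Set.univ).toReal, by positivity,
    min ε₀ 1, lt_min hε₀ one_pos, fun ε h0 h1 =>
      ⟨hlow ε h0 (h1.trans_le (min_le_left _ _)),
        lintegral_sq_shell_le_log hK h0 (h1.trans_le (min_le_right _ _)).le⟩⟩

theorem memLp_of_eq (h : vin = vout) : MemLp (sourceJT x) 2 photonMeasure := by
  rw [memLp_two_iff_lintegral hx.measurable_sourceJT.aestronglyMeasurable]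
  obtain ⟨M, hM0, hM⟩ := hx.exists_norm_sourceJ_sub_le
  -- With equal velocities the singular term is absent, so the amplitude is bounded near `p = 0`.
  have hlead : ∀ p, leadAmp vin vout p = 0 := fun p => by simp [leadAmp, h]
  have e0 : toC3 0 = 0 := toC3L.map_zero
  have h1 : ∫⁻ p in {p : R3 | ‖p‖ ≤ 1}, ‖sourceJT x p‖ₑ ^ 2 ∂photonMeasure < ∞ := by
    refine lintegral_sq_inside_lt_top (K := 2 * M) fun p hp =>
      (norm_transverseProj_le _ _).trans ?_
    have := hM p hp
    rw [hlead, e0, smul_zero, sub_zero] at this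
    gcongr
  have h2 := hx.lintegral_outside_lt_top
  have h3 : {p : R3 | ‖p‖ ≤ 1} ∪ {p : R3 | 1 ≤ ‖p‖} = Set.univ :=
    Set.eq_univ_of_forall fun p => le_total ‖p‖ 1
  rw [← setLIntegral_univ, ← h3]
  exact (lintegral_union_le _ _ _).trans_lt (ENNReal.add_lt_top.mpr ⟨h1, h2⟩)

theorem memLp_iff : MemLp (sourceJT x) 2 photonMeasure ↔ vin = vout := by
  refine ⟨fun h => ?_, hx.memLp_of_eq⟩
  by_contra hne
  obtain ⟨c, hc, C, hC, ε₀, hε₀, hlog⟩ := hx.log_divergence hne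
  rw [memLp_two_iff_lintegral hx.measurable_sourceJT.aestronglyMeasurable] at h
  set L := ∫⁻ p, ‖sourceJT x p‖ₑ ^ 2 ∂photonMeasure with hL
  have h1 : ∀ ε : ℝ, 0 < ε → ε < ε₀ → c * Real.log (1 / ε) ≤ L.toReal := fun ε h0 h1 =>
    (ENNReal.ofReal_le_iff_le_toReal h.ne).mp ((hlog ε h0 h1).1.trans (setLIntegral_le_lintegral _ _))
  have h2 : Tendsto (fun ε : ℝ => c * Real.log (1 / ε)) (𝓝[>] 0) atTop := by
    refine Tendsto.const_mul_atTop hc (Real.tendsto_log_atTop.comp ?_)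
    exact (tendsto_inv_nhdsGT_zero (𝕜 := ℝ)).congr fun ε => (one_div ε).symm
  obtain ⟨ε, hε1, hε2, hε3⟩ := ((h2.eventually_gt_atTop L.toReal).and
    ((eventually_mem_nhdsWithin (a := (0 : ℝ)) (s := Set.Ioi 0)).and
      (eventually_nhdsWithin_of_eventually_nhds (gt_mem_nhds hε₀)))).exists
  exact absurd (h1 ε hε2 hε3) (not_le.mpr hε1)

end IsScatteringTrajectory

end Divergence

/-! ### From a phase functional to the state: the abstract criterion -/

section OutState

variable {E : Type*} [NormedAddCommGroup E] [InnerProductSpace ℂ E]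

/-- Explains the choice `g = i√2 J`: conjugation by `W(g)` then produces the phase of a classical
source `J`. -/
theorem neg_im_inner_smul (J h : E) :
    -(inner ℂ ((Complex.I * (Real.sqrt 2 : ℂ)) • J) h : ℂ).im =
      Real.sqrt 2 * (inner ℂ h J : ℂ).re := by
  rw [inner_smul_left, ← inner_conj_symm J h]
  simp only [map_mul, Complex.conj_I, Complex.conj_ofReal, Complex.mul_im, Complex.mul_re,
    Complex.neg_re, Complex.neg_im, Complex.I_re, Complex.I_im, Complex.ofReal_re,
    Complex.ofReal_im, Complex.conj_re, Complex.conj_im]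
  ring

/-- The automorphism takes each `W'(h)` (an element of the Weyl algebra) to `W(h)`. -/
def IsWeylAut {S : Set E} (W' : E → FockSpace E →L[ℂ] FockSpace E)
    (α : weylAlgebra S ≃⋆ₐ[ℂ] weylAlgebra S) : Prop :=
  ∀ h ∈ S, ∃ B : weylAlgebra S, (B : FockSpace E →L[ℂ] FockSpace E) = W' h ∧
    (α B : FockSpace E →L[ℂ] FockSpace E) = weyl h

/-- The vacuum composed with an automorphism taking each `W'(h)` to `W(h)`. -/
def IsWeylState {S : Set E} (W' : E → FockSpace E →L[ℂ] FockSpace E)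
    (ω : weylAlgebra S →L[ℂ] ℂ) : Prop :=
  ∃ α : weylAlgebra S ≃⋆ₐ[ℂ] weylAlgebra S, IsWeylAut W' α ∧
    ∀ B : weylAlgebra S, ω B = inner ℂ (fockVacuum : FockSpace E)
      ((α B : FockSpace E →L[ℂ] FockSpace E) fockVacuum)

variable {S : Set E} {ℓ : E → ℝ} {W' : E → FockSpace E →L[ℂ] FockSpace E}

theorem isWeylAut_iff (hW : ∀ h, W' h = Complex.exp (-(Complex.I * ℓ h)) • weyl h)
    (α : weylAlgebra S ≃⋆ₐ[ℂ] weylAlgebra S) : IsWeylAut W' α ↔ IsPhaseAut ℓ α := by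
  constructor
  · intro H h hh
    obtain ⟨B, hB, hαB⟩ := H h hh
    have h1 : α B = weylGen hh := Subtype.ext hαB
    have h2 : B = Complex.exp (-(Complex.I * ℓ h)) • weylGen hh := Subtype.ext (hB.trans (hW h))
    rw [h2, map_smul] at h1
    conv_rhs => rw [← h1, smul_smul, ← Complex.exp_add]
    simp
  · intro H h hh
    refine ⟨Complex.exp (-(Complex.I * ℓ h)) • weylGen hh, (hW h).symm, ?_⟩
    rw [map_smul, H h hh, smul_smul, ← Complex.exp_add]
    simp [weylGen]

/-- All operator algebra in one statement, with three analytic inputs: the phase is a limit of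
phases of Weyl operators; under `Q` a single vector represents it; without `Q` it takes the value
`π` along a null sequence. Any such discontinuity excludes normal states, since `e^{iπ} = -1`
differs from the required limit 1. -/
theorem isWeylState_main (hW : ∀ h, W' h = Complex.exp (-(Complex.I * ℓ h)) • weyl h)
    (hg : ∃ g : ℕ → E, ∀ h ∈ S, Tendsto (fun n => -(inner ℂ (g n) h : ℂ).im) atTop (𝓝 (ℓ h)))
    {Q : Prop} (hQ : Q → ∃ k : E, ∀ h ∈ S, -(inner ℂ k h : ℂ).im = ℓ h)
    (hnQ : ¬Q → ∃ f : ℕ → E, (∀ n, f n ∈ S) ∧ Tendsto f atTop (𝓝 0) ∧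
      ∀ᶠ n in atTop, ℓ (f n) = Real.pi) :
    (∃! α : weylAlgebra S ≃⋆ₐ[ℂ] weylAlgebra S, IsWeylAut W' α) ∧
    (∃! ω : weylAlgebra S →L[ℂ] ℂ, IsWeylState W' ω) ∧
    ∀ ω : weylAlgebra S →L[ℂ] ℂ, IsWeylState W' ω →
      IsState ω ∧ (IsFockState ω ↔ Q) ∧ (IsFockNormalState ω ↔ Q) := by
  obtain ⟨g, hg⟩ := hg
  obtain ⟨α, hα, -⟩ := exists_isPhaseAut hg
  have huniq : ∀ β : weylAlgebra S ≃⋆ₐ[ℂ] weylAlgebra S, IsWeylAut W' β → β = α := fun β hβ =>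
    ((isWeylAut_iff hW β).mp hβ).unique hα
  have hω : ∀ ω : weylAlgebra S →L[ℂ] ℂ, IsWeylState W' ω →
      ∀ B : weylAlgebra S, ω B = inner ℂ (fockVacuum : FockSpace E)
        ((α B : FockSpace E →L[ℂ] FockSpace E) fockVacuum) := by
    rintro ω ⟨β, hβ, hωβ⟩
    rwa [huniq β hβ] at hωβ
  have hfock : ∀ ω : weylAlgebra S →L[ℂ] ℂ, IsWeylState W' ω → Q → IsFockState ω := by
    intro ω hout hq
    obtain ⟨k, hk⟩ := hQ hq
    exact hα.isFockState (hω ω hout) hk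
  have hnormal : ∀ ω : weylAlgebra S →L[ℂ] ℂ, IsWeylState W' ω → IsFockNormalState ω → Q := by
    intro ω hout hn
    by_contra hne
    obtain ⟨f, hf, hf0, hpi⟩ := hnQ hne
    have h1 := hα.tendsto_phase (hω ω hout) hn hf hf0
    have h2 : Tendsto (fun n => Complex.exp (Complex.I * ℓ (f n))) atTop (𝓝 (-1)) := by
      refine tendsto_const_nhds.congr' ?_
      filter_upwards [hpi] with n hn
      rw [hn, mul_comm, Complex.exp_pi_mul_I]
    have h3 := tendsto_nhds_unique h1 h2
    norm_num at h3
  exact ⟨⟨α, (isWeylAut_iff hW α).mpr hα, huniq⟩,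
    ⟨vacuumComp α, ⟨α, (isWeylAut_iff hW α).mpr hα, fun B => rfl⟩, fun ω hout =>
      ContinuousLinearMap.ext (hω ω hout)⟩,
    fun ω hout => ⟨isState_of_forall_eq (hω ω hout),
      ⟨fun hF => hnormal ω hout hF.isFockNormalState, hfock ω hout⟩,
      ⟨hnormal ω hout, fun hq => (hfock ω hout hq).isFockNormalState⟩⟩⟩

end OutState

/-! ### Pairings with rapidly decreasing functions -/

section Pairing

theorem photonPairing_conj (f g : R3 → C3) : conj (photonPairing f g) = photonPairing g f := by
  unfold photonPairing
  rw [← integral_conj]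
  simp only [inner_conj_symm]

theorem inner_eq_photonPairing (f g : transverseSpace) :
    (inner ℂ f g : ℂ) =
      photonPairing ((f : PhotonL2) : R3 → C3) ((g : PhotonL2) : R3 → C3) := by
  rw [Submodule.coe_inner, L2.inner_def]
  rfl

theorem integrable_inner_rapid {h : transverseSpace} (hh : h ∈ rapidSpace) {F : R3 → C3}
    (hF : AEStronglyMeasurable F photonMeasure) {K : ℝ} (hK : ∀ p, p ≠ 0 → ‖F p‖ ≤ K * ‖p‖⁻¹) :
    Integrable (fun p => (inner ℂ (((h : PhotonL2) : R3 → C3) p) (F p) : ℂ)) photonMeasure := by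
  obtain ⟨C, hC⟩ := hh 1
  refine (integrable_photonMeasure_rapid.const_mul (C * K)).mono'
    ((Lp.aestronglyMeasurable _).inner hF) ?_
  filter_upwards [hC, ae_photonMeasure_of_ne_zero hK] with p h1 h2
  calc _ ≤ ‖((h : PhotonL2) : R3 → C3) p‖ * ‖F p‖ := norm_inner_le_norm _ _
    _ ≤ (C * ((1 + ‖p‖ ^ 2) ^ 1)⁻¹) * (K * ‖p‖⁻¹) :=
        mul_le_mul h1 h2 (norm_nonneg _) ((norm_nonneg _).trans h1)
    _ = _ := by ring

theorem smul_mem_rapidSpace {h : transverseSpace} (hh : h ∈ rapidSpace) (c : ℂ) :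
    c • h ∈ rapidSpace := by
  intro k
  obtain ⟨C, hC⟩ := hh k
  refine ⟨‖c‖ * C, ?_⟩
  filter_upwards [hC, Lp.coeFn_smul c (h : PhotonL2)] with p h1 h2
  rw [Submodule.coe_smul, h2, Pi.smul_apply, norm_smul, mul_assoc]
  gcongr

theorem tendsto_photonMeasure_exp_homogeneous {G : R3 → ℂ} (hG : Integrable G photonMeasure)
    {φ : R3 → ℝ} (hφ : Continuous φ) (hhom : ∀ (r : ℝ) (p : R3), 0 < r → φ (r • p) = r * φ p)
    (hne : ∀ p : R3, ‖p‖ = 1 → φ p ≠ 0) :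
    Tendsto (fun R : ℝ => ∫ p, Complex.exp (Complex.I * (R * φ p : ℝ)) * G p ∂photonMeasure)
      atTop (𝓝 0) := by
  have hm : Measurable fun p : R3 => Real.toNNReal (1 / (2 * ‖p‖)) := by fun_prop
  have hint : Integrable fun p : R3 => Real.toNNReal (1 / (2 * ‖p‖)) • G p :=
    (integrable_withDensity_iff_integrable_smul hm).mp hG
  refine (tendsto_integral_exp_homogeneous hint hφ hhom hne).congr fun R => ?_
  rw [photonMeasure]
  simp only [ENNReal.ofReal]
  rw [integral_withDensity_eq_integral_smul hm]
  refine integral_congr_ae (Eventually.of_forall fun p => ?_)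
  simp only [mul_smul_comm]

end Pairing

/-! ### Outgoing fields as incoming fields shifted by a number -/

section OutFields

/-- The phase `√2 Re (h, J_T)` by which the outgoing Weyl operators differ from the incoming. -/
def outPhase (x : ℝ → R3) (h : transverseSpace) : ℝ :=
  Real.sqrt 2 * (photonPairing ((h : PhotonL2) : R3 → C3) (sourceJT x)).re

/-- The shifts of the creation and annihilation parts are complex conjugates, so they add up to a
real number; with the factor `1 / √2` it is `√2` times a real part. -/
theorem fieldOpOut_eq (x : ℝ → R3) (h : transverseSpace) :
    fieldOpOut x h = fieldOp h + ((-outPhase x h : ℝ) : ℂ) • 1 := by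
  set z := photonPairing ((h : PhotonL2) : R3 → C3) (sourceJT x) with hz
  have h1 : photonPairing (sourceJT x) ((h : PhotonL2) : R3 → C3) = conj z :=
    (photonPairing_conj _ _).symm
  have h2 : (((1 / Real.sqrt 2 : ℝ) : ℂ)) * (conj z + z) = ((outPhase x h : ℝ) : ℂ) := by
    rw [add_comm, Complex.add_conj, ← Complex.ofReal_mul]
    congr 1
    rw [outPhase, ← hz]
    have : Real.sqrt 2 * Real.sqrt 2 = 2 := Real.mul_self_sqrt (by norm_num)
    field_simp
    rw [Real.sq_sqrt (by norm_num)]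
  rw [fieldOpOut, creationOut, annihilationOut, fieldOp, h1, ← hz, Complex.ofReal_neg, ← h2]
  module

theorem weylOut_eq (x : ℝ → R3) (h : transverseSpace) :
    weylOut x h = Complex.exp (-(Complex.I * outPhase x h)) • weyl h := by
  rw [weylOut, fieldOpOut_eq, (isAnalyticSymm_fieldOp h).expI_add_smul, weyl]
  push_cast
  rw [mul_neg]

end OutFields

/-! ### Shell cut-offs of the amplitude and the limit of the cut-off currents -/

section ShellAmplitude

variable {x : ℝ → R3} {vin vout : R3} {v₀ T A X : ℝ}

/-- The momentum shell `1/(n+1) ≤ |p| ≤ n+1`. -/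
def momentumShell (n : ℕ) : Set R3 := {p | (n + 1 : ℝ)⁻¹ ≤ ‖p‖ ∧ ‖p‖ ≤ n + 1}

theorem measurableSet_momentumShell (n : ℕ) : MeasurableSet (momentumShell n) :=
  measurable_norm (measurableSet_Icc (a := (n + 1 : ℝ)⁻¹) (b := (n + 1 : ℝ)))

theorem eventually_mem_momentumShell {p : R3} (hp : p ≠ 0) : ∀ᶠ n in atTop, p ∈ momentumShell n := by
  have h1 : Tendsto (fun n : ℕ => (n + 1 : ℝ)) atTop atTop :=
    tendsto_atTop_add_const_right _ _ tendsto_natCast_atTop_atTop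
  filter_upwards [h1.eventually_ge_atTop ‖p‖, h1.eventually_ge_atTop ‖p‖⁻¹] with n h2 h3
  exact ⟨inv_le_of_inv_le₀ (norm_pos_iff.mpr hp) h3, h2⟩

theorem ae_transverse_sourceJT (x : ℝ → R3) :
    ∀ᵐ p ∂photonMeasure, ∑ j, ((p j : ℝ) : ℂ) * sourceJT x p j = 0 :=
  ae_photonMeasure_of_ne_zero fun _ hp => sum_mul_transverseProj hp _

theorem exists_transverse_of_memLp {f : R3 → C3} (hf : MemLp f 2 photonMeasure)
    (ht : ∀ᵐ p ∂photonMeasure, ∑ j, ((p j : ℝ) : ℂ) * f p j = 0) :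
    ∃ J : transverseSpace, ((J : PhotonL2) : R3 → C3) =ᵐ[photonMeasure] f := by
  refine ⟨⟨hf.toLp f, ?_⟩, hf.coeFn_toLp⟩
  change ∀ᵐ p ∂photonMeasure, ∑ j, ((p j : ℝ) : ℂ) * (hf.toLp f : R3 → C3) p j = 0
  filter_upwards [ht, hf.coeFn_toLp] with p h1 h2
  rw [h2, h1]

/-- Outside the shell `J` vanishes and inside it equals the amplitude, so pairing with the full
amplitude sees `J` alone. -/
theorem photonPairing_shell {J : transverseSpace} {n : ℕ}
    (hJ : ((J : PhotonL2) : R3 → C3) =ᵐ[photonMeasure]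
      (momentumShell n).indicator (sourceJT x)) :
    photonPairing ((J : PhotonL2) : R3 → C3) (sourceJT x) = ((‖J‖ ^ 2 : ℝ) : ℂ) := by
  have h1 : (inner ℂ J J : ℂ) = ((‖J‖ ^ 2 : ℝ) : ℂ) :=
    (inner_self_eq_norm_sq_to_K (𝕜 := ℂ) J).trans (Complex.ofReal_pow _ _).symm
  rw [← h1, inner_eq_photonPairing]
  refine integral_congr_ae ?_
  filter_upwards [hJ] with p hp
  rw [hp]
  by_cases hpn : p ∈ momentumShell n <;> simp [hpn]

namespace IsScatteringTrajectory

variable (hx : IsScatteringTrajectory x vin vout v₀ T A X)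
include hx

theorem exists_shell_seq : ∃ J : ℕ → transverseSpace, (∀ n, J n ∈ rapidSpace) ∧
    ∀ n, ((J n : PhotonL2) : R3 → C3) =ᵐ[photonMeasure]
      (momentumShell n).indicator (sourceJT x) := by
  obtain ⟨K, hK0, hK⟩ := hx.exists_norm_sourceJT_le
  have hn0 : ∀ n : ℕ, (0 : ℝ) < n + 1 := fun n => by positivity
  have hmem : ∀ n, MemLp ((momentumShell n).indicator (sourceJT x)) 2 photonMeasure := by
    intro n
    rw [memLp_two_iff_lintegral
      (hx.measurable_sourceJT.indicator (measurableSet_momentumShell n)).aestronglyMeasurable]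
    have h := lintegral_sq_shell_le_log hK (inv_pos.mpr (hn0 n))
      ((inv_le_one_of_one_le₀ (by linarith [n.cast_nonneg (α := ℝ)])).trans
        (by linarith [n.cast_nonneg (α := ℝ)] : (1 : ℝ) ≤ n + 1))
    refine lt_of_le_of_lt (le_of_eq ?_) (h.trans_lt ENNReal.ofReal_lt_top)
    change _ = ∫⁻ p in momentumShell n, _ ∂photonMeasure
    rw [← lintegral_indicator (measurableSet_momentumShell n)]
    refine lintegral_congr fun p => ?_
    by_cases hp : p ∈ momentumShell n <;> simp [hp]
  have hex : ∀ n, ∃ J : transverseSpace, ((J : PhotonL2) : R3 → C3) =ᵐ[photonMeasure]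
      (momentumShell n).indicator (sourceJT x) := fun n => by
    refine exists_transverse_of_memLp (hmem n) ?_
    filter_upwards [ae_transverse_sourceJT x] with p hp
    by_cases hpn : p ∈ momentumShell n <;> simp [hpn, hp]
  choose J hJ using hex
  -- On the shell both `‖p‖⁻¹` and `‖p‖` are at most `n + 1`; bounded support makes any power of
  -- decay available.
  refine ⟨J, fun n k => ⟨K * (n + 1) * (1 + (n + 1 : ℝ) ^ 2) ^ k, ?_⟩, hJ⟩
  filter_upwards [hJ n, ae_photonMeasure_of_ne_zero hK] with p h1 h2
  rw [h1]
  by_cases hp : p ∈ momentumShell n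
  · rw [Set.indicator_of_mem hp, ← div_eq_mul_inv, le_div_iff₀ (by positivity)]
    have h3 : ‖p‖⁻¹ ≤ n + 1 := inv_le_of_inv_le₀ (hn0 n) hp.1
    have h4 : ‖p‖ ≤ n + 1 := hp.2
    have h5 : ‖sourceJT x p‖ ≤ K * (n + 1) := h2.trans (by gcongr)
    gcongr
  · rw [Set.indicator_of_notMem hp, norm_zero]
    positivity

theorem integrable_inner_sourceJT {h : transverseSpace} (hh : h ∈ rapidSpace) :
    Integrable (fun p => (inner ℂ (((h : PhotonL2) : R3 → C3) p) (sourceJT x p) : ℂ))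
      photonMeasure := by
  obtain ⟨K, hK0, hK⟩ := hx.exists_norm_sourceJT_le
  exact integrable_inner_rapid hh hx.measurable_sourceJT.aestronglyMeasurable hK

theorem tendsto_inner_shell {J : ℕ → transverseSpace}
    (hJ : ∀ n, ((J n : PhotonL2) : R3 → C3) =ᵐ[photonMeasure]
      (momentumShell n).indicator (sourceJT x)) {h : transverseSpace} (hh : h ∈ rapidSpace) :
    Tendsto (fun n => (inner ℂ h (J n) : ℂ)) atTop
      (𝓝 (photonPairing ((h : PhotonL2) : R3 → C3) (sourceJT x))) := by
  simp only [inner_eq_photonPairing, photonPairing]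
  refine tendsto_integral_of_dominated_convergence _
    (fun n => (Lp.aestronglyMeasurable _).inner (Lp.aestronglyMeasurable _))
    (hx.integrable_inner_sourceJT hh).norm (fun n => ?_) ?_
  · filter_upwards [hJ n] with p hp
    rw [hp]
    by_cases hpn : p ∈ momentumShell n <;> simp [hpn]
  · filter_upwards [ae_all_iff.mpr hJ, ae_photonMeasure_of_ne_zero
      (fun p hp => eventually_mem_momentumShell hp)] with p h1 h2
    refine tendsto_const_nhds.congr' ?_
    filter_upwards [h2] with n hn
    rw [h1 n, Set.indicator_of_mem hn]

theorem exists_tendsto_outPhase : ∃ g : ℕ → transverseSpace, ∀ h ∈ rapidSpace,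
    Tendsto (fun n => -(inner ℂ (g n) h : ℂ).im) atTop (𝓝 (outPhase x h)) := by
  obtain ⟨J, -, hJ⟩ := hx.exists_shell_seq
  refine ⟨fun n => (Complex.I * (Real.sqrt 2 : ℂ)) • J n, fun h hh => ?_⟩
  refine Tendsto.congr (fun n => (neg_im_inner_smul (J n) h).symm) ?_
  exact ((Complex.continuous_re.tendsto _).comp (hx.tendsto_inner_shell hJ hh)).const_mul _

theorem exists_eq_outPhase (heq : vin = vout) : ∃ k : transverseSpace, ∀ h ∈ rapidSpace,
    -(inner ℂ k h : ℂ).im = outPhase x h := by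
  obtain ⟨G, hG⟩ := exists_transverse_of_memLp (hx.memLp_of_eq heq) (ae_transverse_sourceJT x)
  refine ⟨(Complex.I * (Real.sqrt 2 : ℂ)) • G, fun h _ => ?_⟩
  refine (neg_im_inner_smul G h).trans ?_
  rw [inner_eq_photonPairing, outPhase]
  congr 2
  refine integral_congr_ae ?_
  filter_upwards [hG] with p hp
  rw [hp]

/-- The shell contains `1/(n+1) ≤ |p| ≤ 1`, so the lower logarithmic bound with `ε = 1/(n+1)`
applies. -/
theorem tendsto_norm_shell (hne : vin ≠ vout) {J : ℕ → transverseSpace}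
    (hJ : ∀ n, ((J n : PhotonL2) : R3 → C3) =ᵐ[photonMeasure]
      (momentumShell n).indicator (sourceJT x)) :
    Tendsto (fun n => ‖J n‖ ^ 2) atTop atTop := by
  obtain ⟨c, hc, C, hC, ε₀, hε₀, hlog⟩ := hx.log_divergence hne
  have h1 : Tendsto (fun n : ℕ => (n + 1 : ℝ)) atTop atTop :=
    tendsto_atTop_add_const_right _ _ tendsto_natCast_atTop_atTop
  refine tendsto_atTop_mono' _ ?_ ((Real.tendsto_log_atTop.comp h1).const_mul_atTop hc)
  filter_upwards [h1.eventually_gt_atTop ε₀⁻¹] with n hn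
  have hn0 : (0 : ℝ) < n + 1 := by positivity
  have h2 := (hlog (n + 1 : ℝ)⁻¹ (inv_pos.mpr hn0) (inv_lt_of_inv_lt₀ hε₀ hn)).1
  rw [one_div, inv_inv] at h2
  have h3 : ‖((J n : transverseSpace) : PhotonL2)‖ₑ ^ 2 =
      ∫⁻ p, ‖((J n : PhotonL2) : R3 → C3) p‖ₑ ^ 2 ∂photonMeasure := by
    have := eLpNorm_nnreal_pow_eq_lintegral (μ := photonMeasure) (p := 2)
      (f := ((J n : PhotonL2) : R3 → C3)) two_ne_zero
    simp only [NNReal.coe_ofNat, ENNReal.rpow_ofNat] at this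
    rw [Lp.enorm_def]
    exact this
  have h4 : (∫⁻ p in {p : R3 | (n + 1 : ℝ)⁻¹ ≤ ‖p‖ ∧ ‖p‖ ≤ 1}, ‖sourceJT x p‖ₑ ^ 2 ∂photonMeasure) ≤
      ∫⁻ p, ‖((J n : PhotonL2) : R3 → C3) p‖ₑ ^ 2 ∂photonMeasure := by
    have h5 : {p : R3 | (n + 1 : ℝ)⁻¹ ≤ ‖p‖ ∧ ‖p‖ ≤ 1} ⊆ momentumShell n := fun p hp =>
      ⟨hp.1, hp.2.trans (by linarith [n.cast_nonneg (α := ℝ)])⟩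
    refine (lintegral_mono_set h5).trans ?_
    rw [← lintegral_indicator (measurableSet_momentumShell n)]
    refine lintegral_mono_ae ?_
    filter_upwards [hJ n] with p hp
    rw [hp]
    by_cases hpn : p ∈ momentumShell n <;> simp [hpn]
  have h6 := h2.trans h4
  rw [← h3, ← ofReal_norm, ← ENNReal.ofReal_pow (norm_nonneg _)] at h6
  exact (ENNReal.ofReal_le_ofReal_iff (sq_nonneg _)).mp h6

/-- If `v_in ≠ v_out`, the phase is not continuous at zero in the norm of the one-photon space. -/
theorem exists_seq_phase_eq_pi (hne : vin ≠ vout) : ∃ h : ℕ → transverseSpace,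
    (∀ n, h n ∈ rapidSpace) ∧ Tendsto h atTop (𝓝 0) ∧ ∀ᶠ n in atTop, outPhase x (h n) = Real.pi := by
  obtain ⟨J, hJr, hJ⟩ := hx.exists_shell_seq
  have hlim := hx.tendsto_norm_shell hne hJ
  have h2 : 0 < Real.sqrt 2 := by positivity
  -- The phase of `c • J n` is `√2 c ‖J n‖²`, which equals `π` for this scalar, while the norm is `π
  -- / (√2 ‖J n‖)` and tends to zero. Where `J n = 0` the scalar is a default value, excluded for
  -- large `n`.
  refine ⟨fun n => ((Real.pi / (Real.sqrt 2 * ‖J n‖ ^ 2) : ℝ) : ℂ) • J n,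
    fun n => smul_mem_rapidSpace (hJr n) _, ?_, ?_⟩
  · rw [tendsto_zero_iff_norm_tendsto_zero]
    have hlim' : Tendsto (fun n => ‖J n‖) atTop atTop := by
      have := Real.tendsto_sqrt_atTop.comp hlim
      simpa [Function.comp_def, Real.sqrt_sq (norm_nonneg _)] using this
    have h3 : Tendsto (fun n => Real.pi / Real.sqrt 2 * ‖J n‖⁻¹) atTop (𝓝 0) := by
      simpa using hlim'.inv_tendsto_atTop.const_mul (Real.pi / Real.sqrt 2)
    refine h3.congr' ?_
    filter_upwards [hlim'.eventually_gt_atTop 0] with n hn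
    rw [norm_smul, Complex.norm_real, Real.norm_of_nonneg (by positivity)]
    field_simp
  · filter_upwards [hlim.eventually_gt_atTop 0] with n hn
    set c := Real.pi / (Real.sqrt 2 * ‖J n‖ ^ 2) with hc
    have h4 : photonPairing (((((c : ℝ) : ℂ) • J n : transverseSpace) : PhotonL2) : R3 → C3)
        (sourceJT x) = ((c * ‖J n‖ ^ 2 : ℝ) : ℂ) := by
      rw [Complex.ofReal_mul, ← photonPairing_shell (hJ n), photonPairing, photonPairing,
        ← integral_const_mul]
      refine integral_congr_ae ?_
      filter_upwards [Lp.coeFn_smul ((c : ℝ) : ℂ) (J n : PhotonL2)] with p hp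
      rw [Submodule.coe_smul, hp, Pi.smul_apply, inner_smul_left, Complex.conj_ofReal]
    rw [outPhase, h4, Complex.ofReal_re, hc]
    have : ‖J n‖ ≠ 0 := fun h => by rw [h] at hn; norm_num at hn
    field_simp

theorem tendsto_pairing_cutoffJ {h : transverseSpace} (hh : h ∈ rapidSpace) :
    Tendsto (fun R : ℝ => photonPairing ((h : PhotonL2) : R3 → C3)
        fun p => transverseProj p (cutoffJ x R p)) atTop
      (𝓝 (photonPairing ((h : PhotonL2) : R3 → C3) (sourceJT x))) := by
  have hδ : 0 < 1 - v₀ := sub_pos.mpr hx.lt_one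
  -- Treats both boundary terms: `s = 1` at `t = R` and `s = -1` at `t = -R`. The vector `c` carries
  -- the part of the phase that does not depend on `R`, which goes into the integrable factor.
  have key : ∀ (v c : R3) (s : ℝ), ‖v‖ ≤ v₀ → s ≠ 0 →
      (∀ R : ℝ, Integrable (fun p => Complex.exp (Complex.I * (R * (s * (‖p‖ - inner ℝ p v)) : ℝ)) *
        (Complex.exp (Complex.I * (-inner ℝ p c : ℝ)) *
          inner ℂ (((h : PhotonL2) : R3 → C3) p)
            (transverseProj p (toC3 ((‖p‖ - inner ℝ p v)⁻¹ • v))))) photonMeasure) ∧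
      Tendsto (fun R : ℝ => ∫ p, Complex.exp (Complex.I * (R * (s * (‖p‖ - inner ℝ p v)) : ℝ)) *
        (Complex.exp (Complex.I * (-inner ℝ p c : ℝ)) *
          inner ℂ (((h : PhotonL2) : R3 → C3) p)
            (transverseProj p (toC3 ((‖p‖ - inner ℝ p v)⁻¹ • v)))) ∂photonMeasure)
        atTop (𝓝 0) := by
    intro v c s hv hs
    have hpos : ∀ p : R3, ‖p‖ * (1 - v₀) ≤ ‖p‖ - inner ℝ p v := fun p => by
      have h1 := real_inner_le_norm p v
      have h2 := mul_le_mul_of_nonneg_left hv (norm_nonneg p)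
      linarith
    have hm : AEStronglyMeasurable
        (fun p => transverseProj p (toC3 ((‖p‖ - inner ℝ p v)⁻¹ • v))) photonMeasure :=
      (measurable_transverseProj
        (continuous_toC3.measurable.comp (by fun_prop))).aestronglyMeasurable
    have h1 := integrable_inner_rapid hh hm (K := 2 * (1 - v₀)⁻¹) fun p hp => by
      have hp' := norm_pos_iff.mpr hp
      have hD : 0 < ‖p‖ - inner ℝ p v := (by positivity : 0 < ‖p‖ * (1 - v₀)).trans_le (hpos p)
      refine (norm_transverseProj_le _ _).trans ?_
      rw [norm_toC3, norm_smul, Real.norm_of_nonneg (by positivity), mul_assoc]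
      refine mul_le_mul_of_nonneg_left ?_ zero_le_two
      calc (‖p‖ - inner ℝ p v)⁻¹ * ‖v‖ ≤ (‖p‖ * (1 - v₀))⁻¹ * 1 := by
            gcongr
            · exact hpos p
            · exact hv.trans hx.lt_one.le
        _ = _ := by rw [mul_one, mul_inv, mul_comm]
    have hb : ∀ (φ : R3 → ℝ) (G : R3 → ℂ), Continuous φ → Integrable G photonMeasure →
        Integrable (fun p => Complex.exp (Complex.I * (φ p : ℝ)) * G p) photonMeasure := by
      intro φ G hφ hG
      refine hG.bdd_mul (c := 1) (by fun_prop) (Eventually.of_forall fun p => ?_)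
      rw [norm_exp_I_phase]
    have h2 := hb (fun p => -inner ℝ p c) _ (by fun_prop) h1
    refine ⟨fun R => hb (fun p => R * (s * (‖p‖ - inner ℝ p v))) _ (by fun_prop) h2,
      tendsto_photonMeasure_exp_homogeneous h2 (φ := fun p => s * (‖p‖ - inner ℝ p v))
        (by fun_prop) (fun r p hr => ?_) (fun p hp => ?_)⟩
    · rw [norm_smul, Real.norm_of_nonneg hr.le, inner_smul_left, conj_trivial]
      ring
    · refine mul_ne_zero hs (ne_of_gt (lt_of_lt_of_le ?_ (hpos p)))
      rw [hp]; linarith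
  obtain ⟨i1, t1⟩ := key vout (x T - T • vout) 1 hx.norm_out_le one_ne_zero
  obtain ⟨i2, t2⟩ := key vin (x (-T) + T • vin) (-1) hx.norm_in_le (by norm_num)
  have hlim := (tendsto_const_nhds (x := photonPairing ((h : PhotonL2) : R3 → C3) (sourceJT x))
    (f := atTop (α := ℝ))).sub (((t1.sub t2)).const_mul (sourceConst : ℂ))
  rw [sub_zero, mul_zero, sub_zero] at hlim
  refine hlim.congr' ?_
  filter_upwards [eventually_ge_atTop T] with R hR
  rw [← integral_sub (i1 R) (i2 R), ← integral_const_mul, photonPairing, photonPairing]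
  refine (integral_sub (hx.integrable_inner_sourceJT hh)
    (((i1 R).sub (i2 R)).const_mul (sourceConst : ℂ))).symm.trans ?_
  refine integral_congr_ae (ae_photonMeasure_of_ne_zero fun p hp => ?_)
  have hE : ∀ (a b : ℝ) (z : ℂ), Complex.exp (Complex.I * a) * (Complex.exp (Complex.I * b) * z) =
      Complex.exp (Complex.I * (a + b : ℝ)) * z := fun a b z => by
    rw [← mul_assoc, ← Complex.exp_add, ← mul_add, Complex.ofReal_add]
  simp only [Pi.sub_apply]
  rw [hx.cutoffJ_eq hp hR, hx.phase_out hR, hx.phase_in hR, transverseProj_sub,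
    transverseProj_smul, transverseProj_sub, transverseProj_smul, transverseProj_smul,
    inner_sub_right (𝕜 := ℂ), inner_smul_right (𝕜 := ℂ), inner_sub_right (𝕜 := ℂ),
    inner_smul_right (𝕜 := ℂ), inner_smul_right (𝕜 := ℂ),
    hE, hE, one_mul, neg_one_mul, ← sub_eq_add_neg, ← sub_eq_add_neg]
  rfl

end IsScatteringTrajectory

end ShellAmplitude

end

theorem mainTheorem1 (x : ℝ → R3) (vin vout : R3) (v₀ : ℝ)
    (hx : ContDiff ℝ 3 x) (hv₀ : v₀ < 1) (hspeed : ∀ t, ‖deriv x t‖ ≤ v₀)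
    (hin : ∀ᶠ t in atBot, deriv x t = vin) (hout : ∀ᶠ t in atTop, deriv x t = vout) :
    -- `J` is the amplitude of the source: weak limit of the amplitudes of the cut-off currents
    (∀ h ∈ rapidSpace,
      Integrable (fun p => (inner ℂ (((h : PhotonL2) : R3 → C3) p) (sourceJT x p) : ℂ))
        photonMeasure ∧
      Tendsto (fun R : ℝ => photonPairing ((h : PhotonL2) : R3 → C3)
          fun p => transverseProj p (cutoffJ x R p)) atTop
        (𝓝 (photonPairing ((h : PhotonL2) : R3 → C3) (sourceJT x)))) ∧
    -- the automorphism and the out-state exist and are unique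
    (∃! α : fieldAlgebra ≃⋆ₐ[ℂ] fieldAlgebra, IsScatteringAut x α) ∧
    (∃! ω : fieldAlgebra →L[ℂ] ℂ, IsOutState x ω) ∧
    -- the out-state is a Fock state if and only if `v_in = v_out`
    (∀ ω : fieldAlgebra →L[ℂ] ℂ, IsOutState x ω →
      IsState ω ∧ (IsFockState ω ↔ vin = vout) ∧ (IsFockNormalState ω ↔ vin = vout)) ∧
    -- square integrability of `J_T`
    (MemLp (sourceJT x) 2 photonMeasure ↔ vin = vout) ∧
    -- there is no divergence at large momenta, and if `v_in ≠ v_out` the divergence at `p = 0` is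
    -- exactly logarithmic
    ((∫⁻ p in {p : R3 | 1 ≤ ‖p‖}, ‖sourceJT x p‖ₑ ^ 2 ∂photonMeasure) < ∞) ∧
    (vin ≠ vout → ∃ c > 0, ∃ C > 0, ∃ ε₀ > 0, ∀ ε : ℝ, 0 < ε → ε < ε₀ →
      ENNReal.ofReal (c * Real.log (1 / ε)) ≤
        ∫⁻ p in {p : R3 | ε ≤ ‖p‖ ∧ ‖p‖ ≤ 1}, ‖sourceJT x p‖ₑ ^ 2 ∂photonMeasure ∧
      (∫⁻ p in {p : R3 | ε ≤ ‖p‖ ∧ ‖p‖ ≤ 1}, ‖sourceJT x p‖ₑ ^ 2 ∂photonMeasure) ≤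
        ENNReal.ofReal (C * Real.log (1 / ε))) := by
  refine (exists_isScatteringTrajectory hx hv₀ hspeed hin hout).elim fun T hT =>
    hT.elim fun A hA => hA.elim fun X h => ?_
  -- The abstract criterion is used with `Q` the equality of the velocities; the scattering notions
  -- in the statement unfold to its hypotheses with `S = rapidSpace` and `W' = weylOut x`.
  have hmain := isWeylState_main (weylOut_eq x) h.exists_tendsto_outPhase h.exists_eq_outPhase
    h.exists_seq_phase_eq_pi
  exact ⟨fun f hf => ⟨h.integrable_inner_sourceJT hf, h.tendsto_pairing_cutoffJ hf⟩,
    hmain.1, hmain.2.1, hmain.2.2, h.memLp_iff, h.lintegral_outside_lt_top, h.log_divergence⟩
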